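/- Fix $\mu\in(1/2,1]$ and put $p=\frac{1-\mu}{\mu}\in[0,1)$. For ${\bf v}=(v_x,v_y)\in\mathbb{R}^2$ let $U({\bf v})=\exp\big(i(v_x\sigma_x+v_y\sigma_y)\big)$, where $\sigma_x,\sigma_y$ are the Pauli matrices. For $n\ge 1$ and ${\bf u}=(u_x,u_y)\in\mathbb{R}^2$ let $$\rho^{\bf u}_n=\Big[U\big({\bf u}/\sqrt n\big)\begin{pmatrix}\mu&0\\0&1-\mu\end{pmatrix}U\big({\bf u}/\sqrt n\big)^*\Big]^{\otimes n},$$ a density matrix on $(\mathbb{C}^2)^{\otimes n}$. On $L^2(\mathbb{R})$ let $Q$ and $P$ be the position and momentum operators, $(Qf)(x)=xf(x)$ and $Pf=-if'$, and let $a=(Q+iP)/\sqrt2$. Let $|k\rangle$, $k\ge0$, be the eigenbasis of the number operator $a^*a$, given by the functions $\psi_k(x)=H_k(x)e^{-x^2/2}/\sqrt{\sqrt\pi\,2^k k!}$ with $H_k$ the (physicists') Hermite polynomials. Let $D(z)=\exp(za^*-\bar za)$, $z\in\mathbb{C}$, be the unitary displacement operators. Let $$\phi^{\bf 0}=(1-p)\sum_{k=0}^\infty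 p^k|k\rangle\langle k|,\qquad \phi^{\bf u}=D\big(\sqrt{2\mu-1}\,\alpha_{\bf u}\big)\,\phi^{\bf 0}\,D\big(\sqrt{2\mu-1}\,\alpha_{\bf u}\big)^*,\qquad \alpha_{\bf u}=-u_y+iu_x .$$ Let $\mathcal{T}(L^2(\mathbb{R}))$ denote the space of trace-class operators on $L^2(\mathbb{R})$ and $\|\cdot\|_1$ the trace norm. Then for each $n$ there exist quantum channels (linear, completely positive, trace-preserving maps) $$T_n: M\big((\mathbb{C}^2)^{\otimes n}\big)\to\mathcal{T}(L^2(\mathbb{R})),\qquad S_n:\mathcal{T}(L^2(\mathbb{R}))\to M\big((\mathbb{C}^2)^{\otimes n}\big)$$ such that, for every bounded interval $I\subset\mathbb{R}$, $$\lim_{n\to\infty}\,\sup_{{\bf u}\in I^2}\big\|\phi^{\bf u}-T_n(\rho^{\bf u}_n)\big\|_1=0\qquad\text{and}\qquad \lim_{n\to\infty}\,\sup_{{\bf u}\in I^2}\big\|\rho^{\bf u}_n-S_n(\phi^{\bf u})\big\|_1=0 .$$ The channels depend on $n$ and $\mu$ only, not on $I$ or ${\bf u}$. -/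

import Mathlib

open MeasureTheory Filter Topology
open scoped ENNReal NNReal ComplexOrder ComplexConjugate SchwartzMap

noncomputable section

namespace QubitLAN

/-! ### Trace-class operators and quantum channels -/

section TraceClass

variable {H K : Type*}
  [NormedAddCommGroup H] [InnerProductSpace ℂ H]
  [NormedAddCommGroup K] [InnerProductSpace ℂ K]

/-- The trace norm `‖A‖₁ = Tr |A|` of a bounded operator on a Hilbert space, as the supremum of
`∑ᵢ |⟨eᵢ, A fᵢ⟩|` over all pairs of finite orthonormal systems `e`, `f`. -/
def traceNorm (A : H →L[ℂ] H) : ℝ≥0∞ :=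
  ⨆ (m : ℕ) (e : Fin m → H) (f : Fin m → H) (_ : Orthonormal ℂ e) (_ : Orthonormal ℂ f),
    ∑ i, ENNReal.ofReal ‖inner ℂ (e i) (A (f i))‖

theorem le_traceNorm (A : H →L[ℂ] H) {m : ℕ} {e f : Fin m → H}
    (he : Orthonormal ℂ e) (hf : Orthonormal ℂ f) :
    ∑ i, ENNReal.ofReal ‖inner ℂ (e i) (A (f i))‖ ≤ traceNorm A := by
  unfold traceNorm
  exact le_iSup_of_le m (le_iSup_of_le e (le_iSup_of_le f
    (le_iSup_of_le he (le_iSup_of_le hf le_rfl))))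

theorem traceNorm_le {A : H →L[ℂ] H} {c : ℝ≥0∞}
    (h : ∀ (m : ℕ) (e f : Fin m → H), Orthonormal ℂ e → Orthonormal ℂ f →
      ∑ i, ENNReal.ofReal ‖inner ℂ (e i) (A (f i))‖ ≤ c) : traceNorm A ≤ c := by
  unfold traceNorm
  exact iSup_le fun m => iSup_le fun e => iSup_le fun f => iSup_le fun he => iSup_le fun hf =>
    h m e f he hf

theorem traceNorm_zero : traceNorm (0 : H →L[ℂ] H) = 0 :=
  le_antisymm (traceNorm_le fun m e f _ _ => by simp) bot_le

theorem traceNorm_add_le (A B : H →L[ℂ] H) : traceNorm (A + B) ≤ traceNorm A + traceNorm B := by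
  refine traceNorm_le fun m e f he hf => ?_
  refine le_trans ?_ (add_le_add (le_traceNorm A he hf) (le_traceNorm B he hf))
  rw [← Finset.sum_add_distrib]
  refine Finset.sum_le_sum fun i _ => ?_
  rw [← ENNReal.ofReal_add (norm_nonneg _) (norm_nonneg _)]
  refine ENNReal.ofReal_le_ofReal ?_
  rw [_root_.add_apply, inner_add_right]
  exact norm_add_le _ _

theorem traceNorm_smul_le (c : ℂ) (A : H →L[ℂ] H) :
    traceNorm (c • A) ≤ ENNReal.ofReal ‖c‖ * traceNorm A := by
  refine traceNorm_le fun m e f he hf => ?_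
  refine le_trans ?_ (mul_le_mul_right (le_traceNorm A he hf) _)
  rw [Finset.mul_sum]
  refine Finset.sum_le_sum fun i _ => ?_
  rw [_root_.smul_apply, inner_smul_right, norm_mul,
    ENNReal.ofReal_mul (norm_nonneg _)]

variable (H) in
/-- The space `𝒯(H)` of trace-class operators on the Hilbert space `H`. If `H` is
finite-dimensional, this is the space of all linear operators on `H`. -/
def TraceClass : Submodule ℂ (H →L[ℂ] H) where
  carrier := {A | traceNorm A < ∞}
  add_mem' {A B} hA hB := lt_of_le_of_lt (traceNorm_add_le A B) (ENNReal.add_lt_top.2 ⟨hA, hB⟩)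
  zero_mem' := by simp [traceNorm_zero]
  smul_mem' c A hA := lt_of_le_of_lt (traceNorm_smul_le c A)
    (ENNReal.mul_lt_top ENNReal.ofReal_lt_top hA)

theorem mem_traceClass_iff {A : H →L[ℂ] H} : A ∈ TraceClass H ↔ traceNorm A < ∞ := Iff.rfl

/-- The trace `∑ᵢ ⟨bᵢ, A bᵢ⟩` of an operator, computed in some orthonormal basis `b` of `H`.
For trace-class operators the sum converges absolutely and does not depend on `b`. -/
def trace [CompleteSpace H] (A : H →L[ℂ] H) : ℂ :=
  ∑' i, inner ℂ ((exists_hilbertBasis ℂ H).choose_spec.choose i)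
    (A ((exists_hilbertBasis ℂ H).choose_spec.choose i))

/-- A `k × k` block matrix of operators on `H` is positive as an operator on `H^k`. -/
def BlockPositive {k : ℕ} (A : Fin k → Fin k → TraceClass H) : Prop :=
  ∀ v : Fin k → H, 0 ≤ ∑ i, ∑ j, inner ℂ (v i) ((A i j : H →L[ℂ] H) (v j))

/-- Complete positivity: for every `k`, the amplification `id ⊗ T` to `k × k` block matrices maps
positive block matrices to positive block matrices. -/
def IsCompletelyPositive (T : TraceClass H →ₗ[ℂ] TraceClass K) : Prop :=
  ∀ (k : ℕ) (A : Fin k → Fin k → TraceClass H),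
    BlockPositive A → BlockPositive fun i j => T (A i j)

/-- The map `T` preserves the trace. -/
def IsTracePreserving [CompleteSpace H] [CompleteSpace K]
    (T : TraceClass H →ₗ[ℂ] TraceClass K) : Prop :=
  ∀ A : TraceClass H, trace (T A : K →L[ℂ] K) = trace (A : H →L[ℂ] H)

/-- A quantum channel: a completely positive trace-preserving linear map between the spaces of
trace-class operators on two Hilbert spaces. -/
def IsChannel [CompleteSpace H] [CompleteSpace K]
    (T : TraceClass H →ₗ[ℂ] TraceClass K) : Prop :=
  IsCompletelyPositive T ∧ IsTracePreserving T

theorem mem_traceClass_of_finiteDimensional [FiniteDimensional ℂ H] (A : H →L[ℂ] H) :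
    A ∈ TraceClass H := by
  rw [mem_traceClass_iff]
  refine lt_of_le_of_lt (b := (Module.finrank ℂ H : ℝ≥0∞) * ENNReal.ofReal ‖A‖)
    (traceNorm_le fun m e f he hf => ?_)
    (ENNReal.mul_lt_top (ENNReal.natCast_lt_top _) ENNReal.ofReal_lt_top)
  have hm : m ≤ Module.finrank ℂ H := by
    simpa using he.linearIndependent.fintype_card_le_finrank
  calc ∑ i, ENNReal.ofReal ‖inner ℂ (e i) (A (f i))‖
      ≤ ∑ _i : Fin m, ENNReal.ofReal ‖A‖ := by
        refine Finset.sum_le_sum fun i _ => ENNReal.ofReal_le_ofReal ?_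
        refine (norm_inner_le_norm _ _).trans ?_
        rw [he.1 i, one_mul]
        simpa [hf.1 i] using A.le_opNorm (f i)
    _ = (m : ℝ≥0∞) * ENNReal.ofReal ‖A‖ := by simp
    _ ≤ _ := by gcongr

theorem traceNorm_rankOne_le (x : H) :
    traceNorm (InnerProductSpace.rankOne ℂ x x) ≤ ENNReal.ofReal (‖x‖ ^ 2) := by
  refine traceNorm_le fun m e f he hf => ?_
  rw [← ENNReal.ofReal_sum_of_nonneg fun i _ => norm_nonneg _]
  refine ENNReal.ofReal_le_ofReal ?_
  have h1 := he.sum_inner_products_le (x := x) (s := Finset.univ)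
  have h2 := hf.sum_inner_products_le (x := x) (s := Finset.univ)
  have h3 : ∀ i, ‖inner ℂ (e i) (InnerProductSpace.rankOne ℂ x x (f i))‖
      ≤ (‖inner ℂ (e i) x‖ ^ 2 + ‖inner ℂ (f i) x‖ ^ 2) / 2 := by
    intro i
    rw [InnerProductSpace.rankOne_apply, inner_smul_right, norm_mul, norm_inner_symm x (f i)]
    nlinarith [sq_nonneg (‖inner ℂ (e i) x‖ - ‖inner ℂ (f i) x‖)]
  calc _ ≤ ∑ i, (‖inner ℂ (e i) x‖ ^ 2 + ‖inner ℂ (f i) x‖ ^ 2) / 2 :=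
        Finset.sum_le_sum fun i _ => h3 i
    _ ≤ ‖x‖ ^ 2 := by
        rw [← Finset.sum_div, Finset.sum_add_distrib]; linarith

theorem traceNorm_tsum_le {A : ℕ → H →L[ℂ] H} (hA : Summable A) :
    traceNorm (∑' k, A k) ≤ ∑' k, traceNorm (A k) := by
  refine traceNorm_le fun m e f he hf => ?_
  have hS : HasSum A (∑' k, A k) := hA.hasSum
  have h1 : Tendsto (fun s : Finset ℕ =>
      ∑ i, ENNReal.ofReal ‖inner ℂ (e i) ((∑ k ∈ s, A k) (f i))‖) atTop
      (𝓝 (∑ i, ENNReal.ofReal ‖inner ℂ (e i) ((∑' k, A k) (f i))‖)) := by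
    refine tendsto_finsetSum _ fun i _ => ?_
    have hc : Continuous fun B : H →L[ℂ] H => ENNReal.ofReal ‖inner ℂ (e i) (B (f i))‖ := by
      refine ENNReal.continuous_ofReal.comp (continuous_norm.comp ?_)
      exact continuous_const.inner ((ContinuousLinearMap.apply ℂ H (f i)).continuous)
    exact (hc.tendsto _).comp hS
  refine le_of_tendsto' h1 fun s => ?_
  refine (le_traceNorm _ he hf).trans (le_trans ?_ (ENNReal.sum_le_tsum s))
  induction s using Finset.cons_induction with
  | empty => simp [traceNorm_zero]
  | cons a s ha ih =>
    rw [Finset.sum_cons, Finset.sum_cons]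
    exact (traceNorm_add_le _ _).trans (by gcongr)

end TraceClass

/-! ### The `n`-qubit states -/

/-- The Hilbert space `(ℂ²)^{⊗ n}`, with the product basis indexed by `Fin n → Fin 2`. -/
abbrev QubitSpace (n : ℕ) : Type := EuclideanSpace ℂ (Fin n → Fin 2)

def pauliX : Matrix (Fin 2) (Fin 2) ℂ := !![0, 1; 1, 0]

def pauliY : Matrix (Fin 2) (Fin 2) ℂ := !![0, -Complex.I; Complex.I, 0]

/-- `U(v) = exp(i (v_x σ_x + v_y σ_y))`. -/
def qubitUnitary (v : ℝ × ℝ) : Matrix (Fin 2) (Fin 2) ℂ :=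
  NormedSpace.exp (Complex.I • ((v.1 : ℂ) • pauliX + (v.2 : ℂ) • pauliY))

/-- `U(v) diag(μ, 1 - μ) U(v)^*`. -/
def rotatedQubit (μ : ℝ) (v : ℝ × ℝ) : Matrix (Fin 2) (Fin 2) ℂ :=
  qubitUnitary v * Matrix.diagonal ![(μ : ℂ), 1 - (μ : ℂ)] * (qubitUnitary v).conjTranspose

/-- The matrix of `M^{⊗ n}` in the product basis. -/
def tensorPower (n : ℕ) (M : Matrix (Fin 2) (Fin 2) ℂ) :
    Matrix (Fin n → Fin 2) (Fin n → Fin 2) ℂ :=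
  Matrix.of fun i j => ∏ k, M (i k) (j k)

/-- The state `ρ_n^u = [U(u/√n) diag(μ, 1 - μ) U(u/√n)^*]^{⊗ n}` of `n` qubits. -/
def qubitState (μ : ℝ) (n : ℕ) (u : ℝ × ℝ) : TraceClass (QubitSpace n) :=
  ⟨Matrix.toEuclideanCLM (𝕜 := ℂ) (tensorPower n (rotatedQubit μ ((√(n : ℝ))⁻¹ • u))),
    mem_traceClass_of_finiteDimensional _⟩

/-! ### The quantum harmonic oscillator on `L²(ℝ)` -/

/-- The Hilbert space `L²(ℝ)` of complex-valued functions. -/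
abbrev L2R : Type := Lp ℂ 2 (volume : Measure ℝ)

/-- The `k`-th energy eigenfunction `ψ_k(x) = H_k(x) e^{-x²/2} / √(√π 2^k k!)` of the oscillator,
where `H_k(x) = 2^{k/2} He_k(√2 x)` is the physicists' Hermite polynomial and `He_k`, called
`Polynomial.hermite k` in Mathlib, the probabilists' one. -/
def numberFun (k : ℕ) (x : ℝ) : ℝ :=
  Polynomial.aeval (√2 * x) (Polynomial.hermite k) * Real.exp (-x ^ 2 / 2) /
    √(√Real.pi * (k.factorial : ℝ))

theorem integrable_poly_gauss (q : Polynomial ℝ) :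
    Integrable fun y : ℝ => q.eval y * Real.exp (-(y ^ 2 / 2)) := by
  induction q using Polynomial.induction_on' with
  | add p q hp hq =>
    refine (hp.add hq).congr (ae_of_all _ fun y => ?_)
    simp [add_mul]
  | monomial n a =>
    have h := integrable_rpow_mul_exp_neg_mul_sq (b := 1 / 2) (by norm_num) (s := (n : ℝ))
      (by have : (0 : ℝ) ≤ n := n.cast_nonneg
          linarith)
    refine (h.const_mul a).congr (ae_of_all _ fun y => ?_)
    simp only [Polynomial.eval_monomial, Real.rpow_natCast]
    rw [show -(1 / 2) * y ^ 2 = -(y ^ 2 / 2) by ring]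
    ring

theorem derivative_hermite_succ (n : ℕ) :
    Polynomial.derivative (Polynomial.hermite (n + 1)) =
      ((n : Polynomial ℤ) + 1) * Polynomial.hermite n := by
  induction n with
  | zero => simp
  | succ n ih =>
    rw [Polynomial.hermite_succ (n + 1), Polynomial.derivative_sub, Polynomial.derivative_mul, ih]
    simp only [Polynomial.derivative_X, one_mul, Polynomial.derivative_mul,
      Polynomial.derivative_add, Polynomial.derivative_natCast, Polynomial.derivative_one, add_zero,
      zero_mul, zero_add]
    rw [Polynomial.hermite_succ n]
    push_cast
    ring

/-- The real Hermite polynomial. -/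
def hermiteR (n : ℕ) : Polynomial ℝ := (Polynomial.hermite n).map (Int.castRingHom ℝ)

theorem hermiteR_succ (n : ℕ) :
    hermiteR (n + 1) = Polynomial.X * hermiteR n - Polynomial.derivative (hermiteR n) := by
  simp [hermiteR, Polynomial.hermite_succ, Polynomial.derivative_map]

theorem derivative_hermiteR_succ (n : ℕ) :
    Polynomial.derivative (hermiteR (n + 1)) = Polynomial.C ((n : ℝ) + 1) * hermiteR n := by
  rw [hermiteR, Polynomial.derivative_map, derivative_hermite_succ]
  simp [hermiteR]

theorem integral_hermiteR_sq (n : ℕ) :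
    ∫ y : ℝ, (hermiteR n).eval y ^ 2 * Real.exp (-(y ^ 2 / 2)) =
      (n.factorial : ℝ) * √(2 * Real.pi) := by
  induction n with
  | zero =>
    have h := integral_gaussian (1 / 2)
    simp only [hermiteR, Polynomial.hermite_zero]
    simp only [map_one, Polynomial.map_one, Polynomial.eval_one, one_pow, one_mul,
      Nat.factorial_zero, Nat.cast_one]
    rw [show 2 * Real.pi = Real.pi / (1 / 2) by ring, ← h]
    congr 1
    ext y
    congr 1
    ring
  | succ n ih =>
    have hg : ∀ y : ℝ, HasDerivAt (fun y : ℝ => (hermiteR n).eval y * Real.exp (-(y ^ 2 / 2)))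
        (-((hermiteR (n + 1)).eval y * Real.exp (-(y ^ 2 / 2)))) y := by
      intro y
      have h1 : HasDerivAt (fun y : ℝ => -(y ^ 2 / 2)) (-y) y := by
        have := ((hasDerivAt_pow 2 y).div_const 2).neg
        convert! this using 1
        simp
      convert! ((hermiteR n).hasDerivAt y).mul h1.exp using 1
      rw [hermiteR_succ]
      simp
      ring
    have hp := integral_mul_deriv_eq_deriv_mul_of_integrable
      (u := fun y => (hermiteR (n + 1)).eval y)
      (u' := fun y => (Polynomial.derivative (hermiteR (n + 1))).eval y)
      (v := fun y : ℝ => (hermiteR n).eval y * Real.exp (-(y ^ 2 / 2)))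
      (v' := fun y : ℝ => -((hermiteR (n + 1)).eval y * Real.exp (-(y ^ 2 / 2))))
      (fun y _ => (hermiteR (n + 1)).hasDerivAt y) (fun y _ => hg y)
      (by
        refine (integrable_poly_gauss (-(hermiteR (n + 1) * hermiteR (n + 1)))).congr
          (ae_of_all _ fun y => ?_)
        simp
        ring)
      (by
        refine (integrable_poly_gauss
          (Polynomial.derivative (hermiteR (n + 1)) * hermiteR n)).congr (ae_of_all _ fun y => ?_)
        simp
        ring)
      (by
        refine (integrable_poly_gauss (hermiteR (n + 1) * hermiteR n)).congr
          (ae_of_all _ fun y => ?_)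
        simp
        ring)
    have e1 : ∫ y : ℝ, (hermiteR (n + 1)).eval y ^ 2 * Real.exp (-(y ^ 2 / 2)) =
        -∫ y : ℝ, (hermiteR (n + 1)).eval y *
          -((hermiteR (n + 1)).eval y * Real.exp (-(y ^ 2 / 2))) := by
      rw [← integral_neg]
      congr 1
      ext y
      ring
    rw [e1, hp, neg_neg, Nat.factorial_succ]
    have e2 : ∀ y : ℝ, (Polynomial.derivative (hermiteR (n + 1))).eval y *
        ((hermiteR n).eval y * Real.exp (-(y ^ 2 / 2))) =
        ((n : ℝ) + 1) * ((hermiteR n).eval y ^ 2 * Real.exp (-(y ^ 2 / 2))) := by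
      intro y
      rw [derivative_hermiteR_succ]
      simp
      ring
    simp_rw [e2]
    rw [integral_const_mul, ih]
    push_cast
    ring

theorem numberFun_sq (k : ℕ) (x : ℝ) :
    numberFun k x ^ 2 = (√Real.pi * (k.factorial : ℝ))⁻¹ *
      ((hermiteR k).eval (√2 * x) ^ 2 * Real.exp (-((√2 * x) ^ 2 / 2))) := by
  have h1 : (Polynomial.aeval (√2 * x) (Polynomial.hermite k) : ℝ) =
      (hermiteR k).eval (√2 * x) := by
    rw [hermiteR, Polynomial.eval_map, Polynomial.aeval_def]
    rfl
  have h2 : Real.exp (-((√2 * x) ^ 2 / 2)) = Real.exp (-x ^ 2 / 2) ^ 2 := by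
    rw [← Real.exp_nat_mul, mul_pow, Real.sq_sqrt (by norm_num)]
    congr 1
    push_cast
    ring
  have h3 : √(√Real.pi * (k.factorial : ℝ)) ^ 2 = √Real.pi * (k.factorial : ℝ) :=
    Real.sq_sqrt (by positivity)
  rw [numberFun, h1, h2, div_pow, h3, mul_pow, div_eq_inv_mul]

theorem memLp_numberFun (k : ℕ) : MemLp (fun x : ℝ => (numberFun k x : ℂ)) 2 volume := by
  have hc : Continuous (numberFun k) := by
    unfold numberFun
    have := (Polynomial.hermite k).continuous_aeval (A := ℝ)
    fun_prop
  refine (memLp_two_iff_integrable_sq_norm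
    (Complex.continuous_ofReal.comp hc).aestronglyMeasurable).2 ?_
  have h := ((integrable_poly_gauss (hermiteR k ^ 2)).comp_mul_left'
    (show √(2 : ℝ) ≠ 0 by positivity)).const_mul (√Real.pi * (k.factorial : ℝ))⁻¹
  refine h.congr (ae_of_all _ fun x => ?_)
  simp only [Polynomial.eval_pow, Function.comp_apply, Complex.norm_real, Real.norm_eq_abs, sq_abs]
  rw [numberFun_sq]

/-- The number state `|k⟩` in `L²(ℝ)`. -/
def numberState (k : ℕ) : L2R := (memLp_numberFun k).toLp _

theorem norm_numberState (k : ℕ) : ‖numberState k‖ = 1 := by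
  have h : ‖numberState k‖ ^ 2 = 1 := by
    have h1 := L2.inner_def (𝕜 := ℂ) (numberState k) (numberState k)
    rw [inner_self_eq_norm_sq_to_K] at h1
    have h2 : ∫ x, inner ℂ (numberState k x) (numberState k x) =
        ((∫ x, numberFun k x ^ 2 : ℝ) : ℂ) := by
      rw [← integral_complex_ofReal]
      refine integral_congr_ae ?_
      filter_upwards [(memLp_numberFun k).coeFn_toLp] with x hx
      rw [numberState, hx, inner_self_eq_norm_sq_to_K]
      simp [← Complex.ofReal_pow, sq_abs]
    have h3 : ∫ x, numberFun k x ^ 2 = 1 := by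
      simp_rw [numberFun_sq]
      rw [integral_const_mul, Measure.integral_comp_mul_left
        (fun y : ℝ => (hermiteR k).eval y ^ 2 * Real.exp (-(y ^ 2 / 2))), integral_hermiteR_sq]
      rw [Real.sqrt_mul (by norm_num), abs_of_pos (by positivity), smul_eq_mul]
      have := Real.pi_pos
      field_simp
    rw [h2, h3] at h1
    have h4 : ((‖numberState k‖ ^ 2 : ℝ) : ℂ) = ((1 : ℝ) : ℂ) := by
      rw [← h1]
      push_cast
      rfl
    exact Complex.ofReal_injective h4
  nlinarith [norm_nonneg (numberState k)]

/-- The thermal equilibrium state `(1 - p) ∑ₖ pᵏ |k⟩⟨k|`, for `0 ≤ p < 1`. -/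
def thermalOp (p : ℝ) : L2R →L[ℂ] L2R :=
  (1 - (p : ℂ)) • ∑' k : ℕ, (p : ℂ) ^ k •
    InnerProductSpace.rankOne ℂ (numberState k) (numberState k)

/-- The function `x ↦ exp(i (√2 Im z · x - Re z · Im z)) f(x - √2 Re z)`. -/
def displacedFun (z : ℂ) (f : ℝ → ℂ) (x : ℝ) : ℂ :=
  Complex.exp (Complex.I * ((√2 * z.im * x - z.re * z.im : ℝ) : ℂ)) * f (x - √2 * z.re)

theorem norm_displacedFun (z : ℂ) (f : ℝ → ℂ) (x : ℝ) :
    ‖displacedFun z f x‖ = ‖f (x - √2 * z.re)‖ := by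
  rw [displacedFun, norm_mul, mul_comm Complex.I, Complex.norm_exp_ofReal_mul_I, one_mul]

theorem displacedFun_congr (z : ℂ) {f g : ℝ → ℂ} (h : f =ᵐ[volume] g) :
    displacedFun z f =ᵐ[volume] displacedFun z g := by
  have h' := (measurePreserving_sub_right volume (√2 * z.re)).quasiMeasurePreserving.ae_eq_comp h
  filter_upwards [h'] with x hx
  simp only [Function.comp_apply] at hx
  rw [displacedFun, displacedFun, hx]

theorem aestronglyMeasurable_displacedFun (z : ℂ) {f : ℝ → ℂ}
    (hf : AEStronglyMeasurable f volume) : AEStronglyMeasurable (displacedFun z f) volume := by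
  refine AEStronglyMeasurable.mul ?_
    (hf.comp_measurePreserving (measurePreserving_sub_right volume (√2 * z.re)))
  refine Continuous.aestronglyMeasurable ?_
  fun_prop

theorem eLpNorm_displacedFun (z : ℂ) {f : ℝ → ℂ} (hf : AEStronglyMeasurable f volume) :
    eLpNorm (displacedFun z f) 2 volume = eLpNorm f 2 volume := by
  rw [← eLpNorm_comp_measurePreserving hf (measurePreserving_sub_right volume (√2 * z.re))]
  exact eLpNorm_congr_norm_ae (ae_of_all _ fun x => norm_displacedFun z f x)

theorem memLp_displacedFun (z : ℂ) {f : ℝ → ℂ} (hf : MemLp f 2 volume) :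
    MemLp (displacedFun z f) 2 volume :=
  ⟨aestronglyMeasurable_displacedFun z hf.1, by rw [eLpNorm_displacedFun z hf.1]; exact hf.2⟩

/-- The displacement operator `D(z) = exp(z a^* - z̄ a) = exp(i √2 (Im z · Q - Re z · P))` on
`L²(ℝ)`, where `a = (Q + i P) / √2`, `(Q f)(x) = x f(x)` and `P f = - i f'`; explicitly,
`(D(z) f)(x) = exp(i (√2 Im z · x - Re z · Im z)) f(x - √2 Re z)`.
The next theorems show that `t ↦ D(t z)` is indeed the one-parameter group of unitaries
whose generator is `z a^* - z̄ a` on Schwartz functions. -/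
def displacement (z : ℂ) : L2R →ₗᵢ[ℂ] L2R where
  toFun f := (memLp_displacedFun z (Lp.memLp f)).toLp _
  map_add' f g := by
    refine (MemLp.toLp_congr _ ((memLp_displacedFun z (Lp.memLp f)).add
      (memLp_displacedFun z (Lp.memLp g))) ?_).trans (MemLp.toLp_add _ _)
    refine (displacedFun_congr z (Lp.coeFn_add f g)).trans (ae_of_all _ fun x => ?_)
    simp [displacedFun, mul_add]
  map_smul' c f := by
    refine (MemLp.toLp_congr _ ((memLp_displacedFun z (Lp.memLp f)).const_smul c) ?_).trans
      (MemLp.toLp_const_smul _ _)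
    refine (displacedFun_congr z (Lp.coeFn_smul c f)).trans (ae_of_all _ fun x => ?_)
    simp only [displacedFun, Pi.smul_apply, smul_eq_mul]
    ring
  norm_map' f := by
    change ‖(memLp_displacedFun z (Lp.memLp f)).toLp _‖ = ‖f‖
    rw [Lp.norm_toLp, eLpNorm_displacedFun z (Lp.memLp f).1, Lp.norm_def]

theorem displacement_toLp (z : ℂ) {f : ℝ → ℂ} (hf : MemLp f 2 volume) :
    displacement z (hf.toLp f) = (memLp_displacedFun z hf).toLp _ :=
  MemLp.toLp_congr (memLp_displacedFun z (Lp.memLp (hf.toLp f))) _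
    (displacedFun_congr z hf.coeFn_toLp)

theorem displacement_zero (f : L2R) : displacement 0 f = f := by
  obtain ⟨g, hg, rfl⟩ : ∃ g, ∃ hg : MemLp g 2 volume, f = hg.toLp g :=
    ⟨f, Lp.memLp f, (Lp.toLp_coeFn f (Lp.memLp f)).symm⟩
  rw [displacement_toLp]
  refine MemLp.toLp_congr _ _ (ae_of_all _ fun x => ?_)
  simp [displacedFun]

/-- The group law along each line; with `displacement_zero`, every `D(z)` is unitary. -/
theorem displacement_add_mul (z : ℂ) (s t : ℝ) (f : L2R) :
    displacement ((s + t : ℝ) * z) f = displacement (s * z) (displacement (t * z) f) := by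
  obtain ⟨g, hg, rfl⟩ : ∃ g, ∃ hg : MemLp g 2 volume, f = hg.toLp g :=
    ⟨f, Lp.memLp f, (Lp.toLp_coeFn f (Lp.memLp f)).symm⟩
  rw [displacement_toLp, displacement_toLp, displacement_toLp]
  refine MemLp.toLp_congr _ _ (ae_of_all _ fun x => ?_)
  simp only [displacedFun, Complex.re_ofReal_mul, Complex.im_ofReal_mul]
  rw [← mul_assoc (Complex.exp _) (Complex.exp _), ← Complex.exp_add, ← mul_add Complex.I,
    ← Complex.ofReal_add]
  have h2 : √(2 : ℝ) * √2 = 2 := Real.mul_self_sqrt (by norm_num)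
  have e1 : √2 * ((s + t) * z.im) * x - (s + t) * z.re * ((s + t) * z.im) =
      √2 * (s * z.im) * x - s * z.re * (s * z.im) +
        (√2 * (t * z.im) * (x - √2 * (s * z.re)) - t * z.re * (t * z.im)) := by
    linear_combination (s * t * z.re * z.im) * h2
  have e2 : x - √2 * ((s + t) * z.re) = x - √2 * (s * z.re) - √2 * (t * z.re) := by ring
  rw [e1, e2]

/-- The position operator `(Q f)(x) = x f(x)` on Schwartz functions. -/
def positionOp : 𝓢(ℝ, ℂ) →L[ℂ] 𝓢(ℝ, ℂ) := SchwartzMap.smulLeftCLM ℂ (fun x : ℝ => (x : ℂ))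

/-- The momentum operator `P f = - i f'` on Schwartz functions. -/
def momentumOp : 𝓢(ℝ, ℂ) →L[ℂ] 𝓢(ℝ, ℂ) := (-Complex.I) • SchwartzMap.derivCLM ℂ ℂ

/-- The annihilation operator `a = (Q + i P) / √2` on Schwartz functions. -/
def annihilationOp : 𝓢(ℝ, ℂ) →L[ℂ] 𝓢(ℝ, ℂ) :=
  ((√2 : ℝ) : ℂ)⁻¹ • (positionOp + Complex.I • momentumOp)

/-- The creation operator `a^* = (Q - i P) / √2` on Schwartz functions. -/
def creationOp : 𝓢(ℝ, ℂ) →L[ℂ] 𝓢(ℝ, ℂ) :=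
  ((√2 : ℝ) : ℂ)⁻¹ • (positionOp - Complex.I • momentumOp)

theorem displacementGenerator_apply (z : ℂ) (f : 𝓢(ℝ, ℂ)) (x : ℝ) :
    (z • creationOp f - conj z • annihilationOp f) x =
      Complex.I * ((√2 * z.im * x : ℝ) : ℂ) * f x - ((√2 * z.re : ℝ) : ℂ) * deriv f x := by
  have hQ : positionOp f x = (x : ℂ) * f x := by
    rw [positionOp, SchwartzMap.smulLeftCLM_apply_apply (by fun_prop)]
    rfl
  have hP : momentumOp f x = -Complex.I * deriv f x := by
    simp [momentumOp]
  have ha : annihilationOp f x = ((√2 : ℝ) : ℂ)⁻¹ * (x * f x + deriv f x) := by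
    have : annihilationOp f x =
        ((√2 : ℝ) : ℂ)⁻¹ * (positionOp f x + Complex.I * momentumOp f x) := rfl
    rw [this, hQ, hP]
    linear_combination (-((√2 : ℝ) : ℂ)⁻¹ * deriv f x) * Complex.I_mul_I
  have hc : creationOp f x = ((√2 : ℝ) : ℂ)⁻¹ * (x * f x - deriv f x) := by
    have : creationOp f x =
        ((√2 : ℝ) : ℂ)⁻¹ * (positionOp f x - Complex.I * momentumOp f x) := rfl
    rw [this, hQ, hP]
    linear_combination (((√2 : ℝ) : ℂ)⁻¹ * deriv f x) * Complex.I_mul_I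
  have h2 : ((√2 : ℝ) : ℂ) * ((√2 : ℝ) : ℂ) = 2 := by
    rw [← Complex.ofReal_mul, Real.mul_self_sqrt (by norm_num)]
    norm_num
  have h0 : ((√2 : ℝ) : ℂ) ≠ 0 := by
    intro h
    rw [h] at h2
    norm_num at h2
  have hz : z = z.re + z.im * Complex.I := (Complex.re_add_im z).symm
  have hzc : conj z = z.re - z.im * Complex.I := by
    apply Complex.ext <;> simp
  rw [_root_.sub_apply, _root_.smul_apply, _root_.smul_apply, ha, hc, hzc]
  simp only [smul_eq_mul]
  nth_rewrite 1 [hz]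
  push_cast
  field_simp
  linear_combination (z.re * deriv f x - z.im * Complex.I * x * f x) * h2

theorem hasDerivAt_displacedFun (z : ℂ) (f : 𝓢(ℝ, ℂ)) (x s : ℝ) :
    HasDerivAt (fun s : ℝ => displacedFun (s * z) f x)
      (displacedFun (s * z) (z • creationOp f - conj z • annihilationOp f : 𝓢(ℝ, ℂ)) x) s := by
  have h1 : HasDerivAt (fun s : ℝ => √2 * (s * z.im) * x - (s * z.re) * (s * z.im))
      (√2 * z.im * x - 2 * s * z.re * z.im) s := by
    have h := ((((hasDerivAt_id s).mul_const z.im).const_mul √2).mul_const x).sub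
      (((hasDerivAt_id s).mul_const z.re).mul ((hasDerivAt_id s).mul_const z.im))
    convert! h using 1
    simp
    ring
  have h2 : HasDerivAt (fun s : ℝ => x - √2 * (s * z.re)) (-(√2 * z.re)) s := by
    have h := (((hasDerivAt_id s).mul_const z.re).const_mul √2).const_sub x
    convert! h using 1
    simp
  have h3 := (h1.ofReal_comp.const_mul Complex.I).cexp
  have h4 := HasDerivAt.scomp s (f.differentiableAt (x := x - √2 * (s * z.re))).hasDerivAt h2
  have h5 := h3.mul h4
  simp only [displacedFun, Complex.re_ofReal_mul, Complex.im_ofReal_mul]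
  convert! h5 using 1
  rw [displacementGenerator_apply]
  have hs : √(2 : ℝ) * √2 = 2 := Real.mul_self_sqrt (by norm_num)
  have hs' : ((√2 : ℝ) : ℂ) * ((√2 : ℝ) : ℂ) = 2 := by
    rw [← Complex.ofReal_mul, hs]
    norm_num
  simp only [Complex.real_smul, Function.comp_apply]
  push_cast
  linear_combination (-(Complex.exp (Complex.I * (√2 * (s * z.im) * x - s * z.re * (s * z.im)))
    * Complex.I * s * z.re * z.im * f (x - √2 * (s * z.re)))) * hs'

theorem exists_bound_displacedFun (z : ℂ) (g : 𝓢(ℝ, ℂ)) :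
    ∃ C : ℝ, 0 ≤ C ∧ ∀ r x : ℝ, |r| ≤ 1 → ‖displacedFun (r * z) g x‖ ≤ C * (1 + ‖x‖) ^ (-1 : ℝ) := by
  obtain ⟨C₀, hC₀, h0⟩ := g.decay 0 0
  obtain ⟨C₁, hC₁, h1⟩ := g.decay 1 0
  simp only [norm_iteratedFDeriv_zero, pow_zero, one_mul, pow_one] at h0 h1
  refine ⟨(C₀ + C₁) * (1 + |√2 * z.re|), by positivity, fun r x hr => ?_⟩
  rw [norm_displacedFun, Complex.re_ofReal_mul]
  set y := x - √2 * (r * z.re) with hy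
  have hx : ‖x‖ ≤ ‖y‖ + |√2 * z.re| := by
    have : x = y + r * (√2 * z.re) := by rw [hy]; ring
    rw [this]
    refine (norm_add_le _ _).trans ?_
    rw [Real.norm_eq_abs (r * _), abs_mul r]
    nlinarith [abs_nonneg (√2 * z.re), abs_nonneg r]
  rw [Real.rpow_neg_one, ← div_eq_mul_inv, le_div_iff₀ (by positivity)]
  have ha := abs_nonneg (√2 * z.re)
  have hyn := norm_nonneg y
  have hg := norm_nonneg (g y)
  have e0 := h0 y
  have e1 := h1 y
  calc ‖g y‖ * (1 + ‖x‖) ≤ ‖g y‖ * ((1 + ‖y‖) * (1 + |√2 * z.re|)) := by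
        gcongr
        nlinarith
    _ = (‖g y‖ + ‖y‖ * ‖g y‖) * (1 + |√2 * z.re|) := by ring
    _ ≤ _ := by gcongr

/-- On Schwartz functions the generator of the unitary group `t ↦ D(t z)` is `z a^* - z̄ a`. -/
theorem hasDerivAt_displacement (z : ℂ) (f : 𝓢(ℝ, ℂ)) :
    HasDerivAt (fun t : ℝ => displacement (t * z) (f.toLp 2 volume))
      ((z • creationOp f - conj z • annihilationOp f).toLp 2 volume) 0 := by
  set G : 𝓢(ℝ, ℂ) → 𝓢(ℝ, ℂ) := fun f => z • creationOp f - conj z • annihilationOp f with hG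
  obtain ⟨C, hC, hb⟩ := exists_bound_displacedFun z (G (G f))
  have h0 : ∀ (g : ℝ → ℂ) x, displacedFun ((0 : ℝ) * z) g x = g x := by
    intro g x
    simp [displacedFun]
  have key : ∀ t x : ℝ, |t| ≤ 1 →
      ‖displacedFun (t * z) f x - f x - t • G f x‖ ≤ t ^ 2 * (C * (1 + ‖x‖) ^ (-1 : ℝ)) := by
    intro t x ht
    set M := C * (1 + ‖x‖) ^ (-1 : ℝ) with hM
    have hM0 : 0 ≤ M := by positivity
    have hmem : ∀ r ∈ Metric.closedBall (0 : ℝ) |t|, |r| ≤ |t| := by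
      intro r hr
      simpa using hr
    have hz0 : (0 : ℝ) ∈ Metric.closedBall (0 : ℝ) |t| := by simp
    have ht0 : t ∈ Metric.closedBall (0 : ℝ) |t| := by simp
    have s1 : ∀ r ∈ Metric.closedBall (0 : ℝ) |t|,
        ‖displacedFun (r * z) (G f) x - G f x‖ ≤ M * |t| := by
      intro r hr
      have := (convex_closedBall (0 : ℝ) |t|).norm_image_sub_le_of_norm_hasDerivWithin_le
        (f := fun s : ℝ => displacedFun (s * z) (G f) x)
        (fun s _ => (hasDerivAt_displacedFun z (G f) x s).hasDerivWithinAt)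
        (fun s hs => hb s x ((hmem s hs).trans ht)) hz0 hr
      rw [h0] at this
      refine this.trans ?_
      rw [sub_zero, Real.norm_eq_abs]
      exact mul_le_mul_of_nonneg_left (hmem r hr) hM0
    have s2 := (convex_closedBall (0 : ℝ) |t|).norm_image_sub_le_of_norm_hasDerivWithin_le
        (f := fun s : ℝ => displacedFun (s * z) f x - s • G f x)
        (f' := fun s : ℝ => displacedFun (s * z) (G f) x - G f x)
        (fun s _ => by
          have h := ((hasDerivAt_displacedFun z f x s).sub
            ((hasDerivAt_id s).smul_const (G f x)))
          rw [one_smul] at h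
          exact h.hasDerivWithinAt)
        s1 hz0 ht0
    rw [h0, zero_smul, sub_zero, sub_zero, Real.norm_eq_abs] at s2
    have e : displacedFun (t * z) f x - f x - t • G f x =
        displacedFun (t * z) f x - t • G f x - f x := by ring
    rw [e]
    refine s2.trans (le_of_eq ?_)
    rw [mul_assoc, abs_mul_abs_self]
    ring
  have hB : MemLp (fun x : ℝ => C * (1 + ‖x‖) ^ (-1 : ℝ)) 2 volume := by
    refine MemLp.const_mul ?_ C
    have hcont : Continuous fun x : ℝ => (1 + ‖x‖) ^ (-1 : ℝ) := by
      refine Continuous.rpow_const (by fun_prop) fun x => Or.inl ?_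
      positivity
    refine (memLp_two_iff_integrable_sq_norm hcont.aestronglyMeasurable).2 ?_
    have h := integrable_one_add_norm (E := ℝ) (μ := volume) (r := 2) (by simp)
    refine h.congr (ae_of_all _ fun x => ?_)
    have hx : (0 : ℝ) ≤ 1 + ‖x‖ := by positivity
    simp only [Real.norm_eq_abs, sq_abs] at hx ⊢
    rw [← Real.rpow_natCast, ← Real.rpow_mul hx]
    norm_num
  set B : ℝ := ‖hB.toLp _‖ with hBdef
  have hL : ∀ t : ℝ, |t| ≤ 1 →
      ‖displacement (t * z) (f.toLp 2 volume) - f.toLp 2 volume - t • (G f).toLp 2 volume‖ ≤ t ^ 2 * B := by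
    intro t ht
    refine Lp.norm_le_mul_norm_of_ae_le_mul ?_
    have e1 : (displacement (t * z) (f.toLp 2 volume) : ℝ → ℂ) =ᵐ[volume]
        displacedFun (t * z) f := by
      rw [SchwartzMap.toLp, displacement_toLp]
      exact MemLp.coeFn_toLp _
    filter_upwards [e1, f.coeFn_toLp 2 volume, (G f).coeFn_toLp 2 volume, hB.coeFn_toLp,
      Lp.coeFn_sub (displacement (t * z) (f.toLp 2 volume) - f.toLp 2 volume)
        (t • (G f).toLp 2 volume),
      Lp.coeFn_sub (displacement (t * z) (f.toLp 2 volume)) (f.toLp 2 volume),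
      Lp.coeFn_smul t ((G f).toLp 2 volume)] with x a1 a2 a3 a4 a5 a6 a7
    rw [a5, Pi.sub_apply, a6, Pi.sub_apply, a7, Pi.smul_apply, a1, a2, a3, a4]
    refine (key t x ht).trans (le_of_eq ?_)
    rw [Real.norm_of_nonneg (show 0 ≤ C * (1 + ‖x‖) ^ (-1 : ℝ) by positivity)]
  rw [hasDerivAt_iff_isLittleO]
  have hd0 : displacement (((0 : ℝ) : ℂ) * z) (f.toLp 2 volume) = f.toLp 2 volume := by
    rw [Complex.ofReal_zero, zero_mul, displacement_zero]
  simp only [hd0, sub_zero]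
  have hO : (fun t : ℝ => displacement (t * z) (f.toLp 2 volume) - f.toLp 2 volume -
      t • (G f).toLp 2 volume) =O[𝓝 0] fun t : ℝ => t ^ 2 := by
    refine Asymptotics.IsBigO.of_bound B ?_
    have hn : ∀ᶠ t : ℝ in 𝓝 0, |t| ≤ 1 := by
      filter_upwards [Metric.closedBall_mem_nhds (0 : ℝ) one_pos] with t ht
      simpa using ht
    filter_upwards [hn] with t ht
    refine (hL t ht).trans (le_of_eq ?_)
    rw [Real.norm_of_nonneg (sq_nonneg t)]
    ring
  refine hO.trans_isLittleO ?_
  simpa using Asymptotics.isLittleO_pow_pow (𝕜 := ℝ) (show 1 < 2 by norm_num)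

/-- The operator `D(√(2μ-1) α_u) φ⁰ D(√(2μ-1) α_u)^*` with `α_u = - u_y + i u_x` and
`φ⁰` the thermal state with `p = (1 - μ) / μ`. -/
def displacedThermalOp (μ : ℝ) (u : ℝ × ℝ) : L2R →L[ℂ] L2R :=
  let D : L2R →L[ℂ] L2R :=
    (displacement (√(2 * μ - 1) * (-(u.2 : ℂ) + Complex.I * u.1))).toContinuousLinearMap
  D ∘L thermalOp ((1 - μ) / μ) ∘L ContinuousLinearMap.adjoint D

theorem conj_thermalOp_mem {p : ℝ} (hp0 : 0 ≤ p) (hp1 : p < 1) (D : L2R →ₗᵢ[ℂ] L2R) :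
    D.toContinuousLinearMap ∘L thermalOp p ∘L
      ContinuousLinearMap.adjoint D.toContinuousLinearMap ∈ TraceClass L2R := by
  set E := D.toContinuousLinearMap with hE
  set A : ℕ → L2R →L[ℂ] L2R := fun k =>
    (p : ℂ) ^ k • InnerProductSpace.rankOne ℂ (numberState k) (numberState k) with hA
  have hs : Summable A := by
    refine Summable.of_norm_bounded (summable_geometric_of_lt_one hp0 hp1) fun k => ?_
    rw [hA]
    simp [norm_smul, norm_numberState, abs_of_nonneg hp0]
  let Φ : (L2R →L[ℂ] L2R) →L[ℂ] (L2R →L[ℂ] L2R) :=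
    (ContinuousLinearMap.compL ℂ L2R L2R L2R E) ∘L
      ((ContinuousLinearMap.compL ℂ L2R L2R L2R).flip (ContinuousLinearMap.adjoint E))
  have hΦ : E ∘L thermalOp p ∘L ContinuousLinearMap.adjoint E = (1 - (p : ℂ)) • ∑' k, Φ (A k) := by
    rw [← Φ.map_tsum hs, ← map_smul]
    rfl
  rw [hΦ]
  refine Submodule.smul_mem _ _ ?_
  rw [mem_traceClass_iff]
  refine lt_of_le_of_lt (traceNorm_tsum_le (Φ.summable hs)) ?_
  have hk : ∀ k, traceNorm (Φ (A k)) ≤ ENNReal.ofReal (p ^ k) := by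
    intro k
    have e : Φ (A k) = (p : ℂ) ^ k •
        InnerProductSpace.rankOne ℂ (E (numberState k)) (E (numberState k)) := by
      ext1 x
      simp [Φ, hA, ContinuousLinearMap.adjoint_inner_right]
    rw [e]
    refine (traceNorm_smul_le _ _).trans ?_
    refine (mul_le_mul_right (traceNorm_rankOne_le _) _).trans ?_
    have : ‖E (numberState k)‖ = 1 := by
      rw [← norm_numberState k]
      exact D.norm_map _
    rw [this]
    simp [abs_of_nonneg hp0]
  refine lt_of_le_of_lt (ENNReal.tsum_le_tsum hk) ?_
  rw [← ENNReal.ofReal_tsum_of_nonneg (fun k => pow_nonneg hp0 k)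
    (summable_geometric_of_lt_one hp0 hp1)]
  exact ENNReal.ofReal_lt_top

/-- The displaced thermal equilibrium state `φ^u` of the oscillator. -/
def oscillatorState (μ : ℝ) (hμ : 1 / 2 < μ ∧ μ ≤ 1) (u : ℝ × ℝ) : TraceClass L2R :=
  ⟨displacedThermalOp μ u, conj_thermalOp_mem
    (div_nonneg (by linarith [hμ.2]) (by linarith [hμ.1]))
    ((div_lt_one (by linarith [hμ.1])).2 (by linarith [hμ.1])) _⟩

end QubitLAN

end

noncomputable section

namespace QubitLAN

/-! ### Trace norm estimates for rank-one operators. -/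

section TraceClassTheory

variable {H K : Type*}
  [NormedAddCommGroup H] [InnerProductSpace ℂ H]
  [NormedAddCommGroup K] [InnerProductSpace ℂ K]

open InnerProductSpace (rankOne rankOne_apply)

/-! The proof is a quantitative form of the bosonic (Holstein–Primakoff) picture of large spins.
Under the collective action of 𝔰𝔲(2), the space of n qubits splits into orthogonal irreducible
components, each with an orthonormal ladder e_0, …, e_d (`IsSpinTriple.exists_ladderBasis`). The
unrotated state is diagonal in the product basis with entry μⁿ p^(number of ones), and e_k is
supported on strings with (n-d)/2 + k ones. So on a component the state is λ ∑_{k ≤ d} pᵏ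
|e_k⟩⟨e_k|: a truncated thermal state, of total weight `componentProb`.

Let V be the partial isometry e_k ↦ |k⟩ of a component. The generator of the rotation acts on the
ladder like z a^* - z̄ a acts on number states, with √((k+1)(d-k)/n) in place of √(2μ-1) √(k+1). The
two coefficients are close when d/n is close to 2μ-1. Both orbits are expanded in Taylor sums whose
r-th term involves only ladder indices up to k + r, and whose remainder is at most of order constʳ
√(r!) / r!. Hence V U e_k is close to the displaced |k⟩, uniformly in bounded u, for each fixed k
(`IsLadder.norm_modeMap_rotation_sub_le`). Large k are negligible because of the factor pᵏ.
Components with atypical d are negligible because the total spin has variance O(n)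
(`IsLadderBasis.sum_topWeight_mul_abs_le`). These estimates are collected in
`exists_forall_totalError_le`.

The channel to the oscillator is ∑ V A V^*, over all components. The channel back is ∑ (component
weight) V^* A V, with the lost trace put on |0⋯0⟩. Both trace norm errors reduce to `totalError`
through `traceNorm_sum_geometricMixture_sub_le`, which compares mixtures of pure states term by
term. Trace preservation of the first channel controls the trace lost by the second one. -/

theorem inner_self_eq_ofReal (x : H) : inner ℂ x x = ((‖x‖ ^ 2 : ℝ) : ℂ) := by
  rw [inner_self_eq_norm_sq_to_K]
  norm_cast

/-- Cauchy–Schwarz over the index, then Bessel for each of the two orthonormal systems. -/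
theorem traceNorm_rankOne_le_mul (x y : H) :
    traceNorm (rankOne ℂ x y) ≤ ENNReal.ofReal (‖x‖ * ‖y‖) := by
  refine traceNorm_le fun m e f he hf => ?_
  rw [← ENNReal.ofReal_sum_of_nonneg fun i _ => norm_nonneg _]
  refine ENNReal.ofReal_le_ofReal ?_
  have h1 := he.sum_inner_products_le (x := x) (s := Finset.univ)
  have h2 := hf.sum_inner_products_le (x := y) (s := Finset.univ)
  calc ∑ i, ‖inner ℂ (e i) (rankOne ℂ x y (f i))‖
      = ∑ i, ‖inner ℂ (e i) x‖ * ‖inner ℂ (f i) y‖ := by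
        refine Finset.sum_congr rfl fun i _ => ?_
        rw [rankOne_apply, inner_smul_right, norm_mul, norm_inner_symm y (f i), mul_comm]
    _ ≤ √(∑ i, ‖inner ℂ (e i) x‖ ^ 2) * √(∑ i, ‖inner ℂ (f i) y‖ ^ 2) :=
        Real.sum_mul_le_sqrt_mul_sqrt _ _ _
    _ ≤ √(‖x‖ ^ 2) * √(‖y‖ ^ 2) := by gcongr
    _ = ‖x‖ * ‖y‖ := by simp

theorem rankOne_mem_traceClass (x y : H) : rankOne ℂ x y ∈ TraceClass H :=
  mem_traceClass_iff.2 ((traceNorm_rankOne_le_mul x y).trans_lt ENNReal.ofReal_lt_top)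

/-- Telescoping: |x⟩⟨x| - c|y⟩⟨y| = |x⟩⟨x-y| + |x-y⟩⟨y| + (1-c)|y⟩⟨y|. In the application c = 1 -
p^(d+1) accounts for the truncation of the thermal state at level d. -/
theorem traceNorm_rankOne_sub_smul_le {x y : H} (hx : ‖x‖ ≤ 1) (hy : ‖y‖ ≤ 1) {c : ℝ}
    (hc : c ≤ 1) :
    traceNorm (rankOne ℂ x x - (c : ℂ) • rankOne ℂ y y) ≤
      ENNReal.ofReal (2 * ‖x - y‖ + (1 - c)) := by
  have e : rankOne ℂ x x - (c : ℂ) • rankOne ℂ y y =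
      (rankOne ℂ x (x - y) + rankOne ℂ (x - y) y) + ((1 - c : ℝ) : ℂ) • rankOne ℂ y y := by
    ext1 v
    simp only [_root_.add_apply, _root_.sub_apply, _root_.smul_apply, rankOne_apply, inner_sub_left]
    push_cast
    module
  rw [e]
  have h1 := (traceNorm_rankOne_le_mul x (x - y)).trans (ENNReal.ofReal_le_ofReal
    (mul_le_of_le_one_left (norm_nonneg _) hx))
  have h2 := (traceNorm_rankOne_le_mul (x - y) y).trans (ENNReal.ofReal_le_ofReal
    (mul_le_of_le_one_right (norm_nonneg _) hy))
  have h3 : traceNorm (((1 - c : ℝ) : ℂ) • rankOne ℂ y y) ≤ ENNReal.ofReal (1 - c) := by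
    refine (traceNorm_smul_le _ _).trans ?_
    rw [Complex.norm_real, Real.norm_of_nonneg (by linarith)]
    refine (mul_le_mul_right ((traceNorm_rankOne_le_mul y y).trans (ENNReal.ofReal_le_ofReal
      (mul_le_one₀ hy (norm_nonneg _) hy))) _).trans ?_
    simp
  refine (traceNorm_add_le _ _).trans ((add_le_add ((traceNorm_add_le _ _).trans
    (add_le_add h1 h2)) h3).trans ?_)
  rw [← ENNReal.ofReal_add (norm_nonneg _) (norm_nonneg _), ← two_mul,
    ← ENNReal.ofReal_add (by positivity) (by linarith)]

theorem traceNorm_sum_le {ι : Type*} (s : Finset ι) (A : ι → H →L[ℂ] H) :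
    traceNorm (∑ i ∈ s, A i) ≤ ∑ i ∈ s, traceNorm (A i) := by
  induction s using Finset.cons_induction with
  | empty => simp [traceNorm_zero]
  | cons a s ha ih =>
    rw [Finset.sum_cons, Finset.sum_cons]
    exact (traceNorm_add_le _ _).trans (by gcongr)

/-! ### Geometric mixtures of pure states -/

/-- The operator `∑ₖ pᵏ |yₖ⟩⟨yₖ|`. -/
def geometricMixture (p : ℝ) (y : ℕ → H) : H →L[ℂ] H :=
  ∑' k : ℕ, (p : ℂ) ^ k • rankOne ℂ (y k) (y k)

theorem summable_geometricMixture [CompleteSpace H] {p : ℝ} (hp0 : 0 ≤ p) (hp1 : p < 1) {y : ℕ → H}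
    (hy : ∀ k, ‖y k‖ ≤ 1) : Summable fun k : ℕ => (p : ℂ) ^ k • rankOne ℂ (y k) (y k) := by
  refine Summable.of_norm_bounded (summable_geometric_of_lt_one hp0 hp1) fun k => ?_
  rw [norm_smul, norm_pow, Complex.norm_real, Real.norm_of_nonneg hp0,
    InnerProductSpace.norm_rankOne]
  exact mul_le_of_le_one_right (by positivity) (mul_le_one₀ (hy k) (norm_nonneg _) (hy k))

theorem conj_geometricMixture [CompleteSpace H] [CompleteSpace K] {p : ℝ} (hp0 : 0 ≤ p)
    (hp1 : p < 1) {y : ℕ → H} (hy : ∀ k, ‖y k‖ ≤ 1) (E : H →L[ℂ] K) :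
    E ∘L geometricMixture p y ∘L ContinuousLinearMap.adjoint E =
      geometricMixture p fun k => E (y k) := by
  let Φ : (H →L[ℂ] H) →L[ℂ] (K →L[ℂ] K) :=
    (ContinuousLinearMap.compL ℂ K H K E) ∘L
      ((ContinuousLinearMap.compL ℂ K H H).flip (ContinuousLinearMap.adjoint E))
  have h : E ∘L geometricMixture p y ∘L ContinuousLinearMap.adjoint E =
      Φ (geometricMixture p y) := rfl
  rw [h, geometricMixture, Φ.map_tsum (summable_geometricMixture hp0 hp1 hy), geometricMixture]
  refine tsum_congr fun k => ?_
  ext1 x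
  simp [Φ, ContinuousLinearMap.adjoint_inner_right]

theorem comp_sum_smul_comp {ι : Type*} [Fintype ι] (E : H →L[ℂ] K) (F : K →L[ℂ] H) (c : ι → ℂ)
    (A : ι → H →L[ℂ] H) : E ∘L (∑ i, c i • A i) ∘L F = ∑ i, c i • (E ∘L A i ∘L F) := by
  ext1 x
  simp [_root_.sum_apply, map_sum]

theorem summable_geometric_mul {p : ℝ} (hp0 : 0 ≤ p) (hp1 : p < 1) {a : ℕ → ℝ} {M : ℝ}
    (ha0 : ∀ k, 0 ≤ a k) (ha : ∀ k, a k ≤ M) : Summable fun k => p ^ k * a k := by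
  refine Summable.of_nonneg_of_le (fun k => mul_nonneg (by positivity) (ha0 k))
    (fun k => mul_le_mul_of_nonneg_left (ha k) (by positivity))
    ((summable_geometric_of_lt_one hp0 hp1).mul_right M)

theorem traceNorm_geometricMixture_sub_le [CompleteSpace H] {p : ℝ} (hp0 : 0 ≤ p) (hp1 : p < 1)
    {y z : ℕ → H} (hy : ∀ k, ‖y k‖ ≤ 1) (hz : ∀ k, ‖z k‖ ≤ 1) {c : ℝ} (hc : c ≤ 1) :
    traceNorm (geometricMixture p y - (c : ℂ) • geometricMixture p z) ≤
      ENNReal.ofReal (∑' k, p ^ k * (2 * ‖y k - z k‖ + (1 - c))) := by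
  have hsy := summable_geometricMixture hp0 hp1 hy
  have hsz := summable_geometricMixture hp0 hp1 hz
  have e : geometricMixture p y - (c : ℂ) • geometricMixture p z = ∑' k : ℕ, (p : ℂ) ^ k •
      (rankOne ℂ (y k) (y k) - (c : ℂ) • rankOne ℂ (z k) (z k)) := by
    rw [geometricMixture, geometricMixture, ← hsz.tsum_const_smul, ← hsy.tsum_sub
      (hsz.const_smul _)]
    refine tsum_congr fun k => ?_
    rw [smul_sub, smul_comm]
  have hs : Summable fun k : ℕ => (p : ℂ) ^ k •
      (rankOne ℂ (y k) (y k) - (c : ℂ) • rankOne ℂ (z k) (z k)) := by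
    refine (hsy.sub (hsz.const_smul (c : ℂ))).congr fun k => ?_
    rw [smul_sub, smul_comm]
  have hyz : ∀ k, ‖y k - z k‖ ≤ 2 := fun k => (norm_sub_le _ _).trans (by linarith [hy k, hz k])
  rw [e]
  refine (traceNorm_tsum_le hs).trans ?_
  have hn : ∀ k, 0 ≤ 2 * ‖y k - z k‖ + (1 - c) := fun k => by
    have := norm_nonneg (y k - z k)
    linarith
  rw [ENNReal.ofReal_tsum_of_nonneg (fun k => mul_nonneg (by positivity) (hn k))
    (summable_geometric_mul hp0 hp1 hn (M := 4 + (1 - c)) fun k => by linarith [hyz k])]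
  refine ENNReal.tsum_le_tsum fun k => (traceNorm_smul_le _ _).trans ?_
  rw [ENNReal.ofReal_mul (by positivity), norm_pow, Complex.norm_real, Real.norm_of_nonneg hp0]
  exact mul_le_mul_right (traceNorm_rankOne_sub_smul_le (hy k) (hz k) hc) _

/-- Comparison of two mixtures of geometric mixtures, the first of them truncated. -/
theorem traceNorm_sum_geometricMixture_sub_le [CompleteSpace H] {ι : Type*} [Fintype ι] {p : ℝ}
    (hp0 : 0 ≤ p) (hp1 : p < 1) {l w : ι → ℝ} {d : ι → ℕ} (hl : ∀ i, 0 ≤ l i)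
    (hw : ∀ i, w i * (1 - p) = l i * (1 - p ^ (d i + 1)))
    {y z : ι → ℕ → H} (hy : ∀ i k, ‖y i k‖ ≤ 1) (hz : ∀ i k, ‖z i k‖ ≤ 1) :
    traceNorm (∑ i, (l i : ℂ) • geometricMixture p (y i) -
        ∑ i, (w i : ℂ) • (1 - (p : ℂ)) • geometricMixture p (z i)) ≤
      ENNReal.ofReal (∑ i, l i * ∑' k, p ^ k * (2 * ‖y i k - z i k‖ + p ^ (d i + 1))) := by
  rw [← Finset.sum_sub_distrib]
  have hpd : ∀ i, p ^ (d i + 1) ≥ 0 := fun i => by positivity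
  rw [ENNReal.ofReal_sum_of_nonneg fun i _ => mul_nonneg (hl i)
    (tsum_nonneg fun k => mul_nonneg (by positivity) (by have := norm_nonneg (y i k - z i k)
                                                         linarith [hpd i]))]
  refine (traceNorm_sum_le _ _).trans (Finset.sum_le_sum fun i _ => ?_)
  -- `hw` turns the normalised weight w(1-p) into l(1 - p^(d+1)), so that l factors out of both
  -- mixtures and c = 1 - p^(d+1) ≤ 1 remains.
  have e : (l i : ℂ) • geometricMixture p (y i) -
      (w i : ℂ) • (1 - (p : ℂ)) • geometricMixture p (z i) = (l i : ℂ) •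
        (geometricMixture p (y i) - ((1 - p ^ (d i + 1) : ℝ) : ℂ) • geometricMixture p (z i)) := by
    rw [smul_sub, smul_smul, smul_smul]
    congr 2
    exact_mod_cast hw i
  rw [e]
  refine (traceNorm_smul_le _ _).trans ?_
  rw [ENNReal.ofReal_mul (hl i), Complex.norm_real, Real.norm_of_nonneg (hl i)]
  refine mul_le_mul_right ((traceNorm_geometricMixture_sub_le hp0 hp1 (hy i) (hz i)
    (by linarith [hpd i])).trans (le_of_eq ?_)) _
  simp

/-! ### The trace -/

theorem sum_norm_inner_le_traceNorm {A : H →L[ℂ] H} (hA : A ∈ TraceClass H) {κ : Type*}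
    {b : κ → H} (hb : Orthonormal ℂ b) (s : Finset κ) :
    ∑ i ∈ s, ‖inner ℂ (b i) (A (b i))‖ ≤ (traceNorm A).toReal := by
  have hs : Orthonormal ℂ fun j : Fin s.card => b (s.equivFin.symm j) :=
    hb.comp _ (Subtype.val_injective.comp s.equivFin.symm.injective)
  have h := le_traceNorm A hs hs
  rw [← ENNReal.ofReal_sum_of_nonneg fun i _ => norm_nonneg _,
    s.equivFin.symm.sum_comp fun i : s => ‖inner ℂ (b i) (A (b i))‖,
    Finset.sum_coe_sort s fun i => ‖inner ℂ (b i) (A (b i))‖] at h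
  exact (ENNReal.ofReal_le_iff_le_toReal (mem_traceClass_iff.1 hA).ne).1 h

theorem summable_inner_of_mem_traceClass {A : H →L[ℂ] H} (hA : A ∈ TraceClass H) {κ : Type*}
    {b : κ → H} (hb : Orthonormal ℂ b) : Summable fun i => inner ℂ (b i) (A (b i)) :=
  Summable.of_norm (summable_of_sum_le (fun _ => norm_nonneg _) (sum_norm_inner_le_traceNorm hA hb))

theorem norm_trace_le [CompleteSpace H] {A : H →L[ℂ] H} (hA : A ∈ TraceClass H) :
    ‖trace A‖ ≤ (traceNorm A).toReal := by
  have hb := (exists_hilbertBasis ℂ H).choose_spec.choose.orthonormal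
  have h := summable_of_sum_le (fun _ => norm_nonneg _) (sum_norm_inner_le_traceNorm hA hb)
  exact (norm_tsum_le_tsum_norm h).trans
    (h.tsum_le_of_sum_le (sum_norm_inner_le_traceNorm hA hb))

variable (H) in
/-- The trace as a linear functional on the trace class. -/
def traceLinear [CompleteSpace H] : TraceClass H →ₗ[ℂ] ℂ where
  toFun A := trace (A : H →L[ℂ] H)
  map_add' A B := by
    have hb := (exists_hilbertBasis ℂ H).choose_spec.choose.orthonormal
    simp only [trace, Submodule.coe_add, _root_.add_apply, inner_add_right]
    exact (summable_inner_of_mem_traceClass A.2 hb).tsum_add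
      (summable_inner_of_mem_traceClass B.2 hb)
  map_smul' c A := by
    simp only [trace, Submodule.coe_smul, _root_.smul_apply, inner_smul_right]
    exact tsum_mul_left

theorem traceLinear_apply [CompleteSpace H] (A : TraceClass H) :
    traceLinear H A = trace (A : H →L[ℂ] H) := rfl

/-- Parseval in the basis chosen by `trace`. Every explicit evaluation of a trace below concerns a
finite sum of rank-one operators, so this is the only form in which independence of the basis is
needed. -/
theorem trace_rankOne [CompleteSpace H] (x y : H) : trace (rankOne ℂ x y) = inner ℂ y x := by
  rw [trace, ← ((exists_hilbertBasis ℂ H).choose_spec.choose.hasSum_inner_mul_inner y x).tsum_eq]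
  simp

theorem trace_sum_rankOne [CompleteSpace H] {κ : Type*} (s : Finset κ) (x y : κ → H) :
    trace (∑ i ∈ s, rankOne ℂ (x i) (y i)) = ∑ i ∈ s, inner ℂ (y i) (x i) := by
  have h := map_sum (traceLinear H) (fun i => ⟨_, rankOne_mem_traceClass (x i) (y i)⟩) s
  simp only [traceLinear_apply, trace_rankOne, Submodule.coe_sum] at h
  exact h

theorem eq_sum_rankOne {κ : Type*} [Fintype κ] (b : OrthonormalBasis κ ℂ H) (A : H →L[ℂ] K) :
    A = ∑ i, rankOne ℂ (A (b i)) (b i) := by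
  ext1 x
  conv_lhs => rw [← b.sum_repr' x]
  simp 

theorem conj_eq_sum_rankOne [CompleteSpace H] [CompleteSpace K] {κ : Type*} [Fintype κ]
    (b : OrthonormalBasis κ ℂ H) (V : H →L[ℂ] K) (A : H →L[ℂ] H) :
    V ∘L A ∘L ContinuousLinearMap.adjoint V = ∑ i, rankOne ℂ (V (A (b i))) (V (b i)) := by
  ext1 x
  conv_lhs => rw [eq_sum_rankOne b A]
  simp [ContinuousLinearMap.adjoint_inner_right]

/-- The operator has finite rank because `H` is finite-dimensional. In the opposite direction, from
the oscillator to the qubits, the target is finite-dimensional and membership is automatic; so the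
general ideal property of the trace class is never used. -/
theorem conj_mem_traceClass [FiniteDimensional ℂ H] [CompleteSpace H] [CompleteSpace K]
    (V : H →L[ℂ] K) (A : H →L[ℂ] H) :
    V ∘L A ∘L ContinuousLinearMap.adjoint V ∈ TraceClass K := by
  rw [conj_eq_sum_rankOne (stdOrthonormalBasis ℂ H)]
  exact Submodule.sum_mem _ fun i _ => rankOne_mem_traceClass _ _

/-- For positive `A`, no orthonormal family sees more than the trace. -/
theorem sum_inner_le_trace [CompleteSpace H] {A : H →L[ℂ] H} (hA : A ∈ TraceClass H)
    (hpos : ∀ x, 0 ≤ inner ℂ x (A x)) {κ : Type*} {f : κ → H} (hf : Orthonormal ℂ f)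
    (s : Finset κ) : ∑ k ∈ s, inner ℂ (f k) (A (f k)) ≤ trace A := by
  have hApos : (0 : H →L[ℂ] H) ≤ A := by
    rw [ContinuousLinearMap.nonneg_iff_isPositive, ContinuousLinearMap.isPositive_iff_complex]
    intro x
    have h := hpos x
    rw [← inner_conj_symm] at h
    have h' := (Complex.nonneg_iff.1 h)
    rw [Complex.conj_re, Complex.conj_im] at h'
    refine ⟨Complex.ext (by simp) (by simp only [RCLike.re_to_complex, Complex.ofReal_im]; linarith [h'.2]), h'.1⟩
  -- With A = S², the left side is the sum of |⟨f_k, S b_i⟩|² over k ∈ s and all i, and the right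
  -- side is ∑ᵢ ‖S b_i‖². Bessel for `f` compares them for each i.
  set S := CFC.sqrt A with hS
  have hSS : S * S = A := CFC.sqrt_mul_sqrt_self A hApos
  have hSa : ContinuousLinearMap.adjoint S = S := by
    have : IsSelfAdjoint S := (CFC.sqrt_nonneg A).isSelfAdjoint
    exact this
  have key : ∀ x, inner ℂ x (A x) = ((‖S x‖ ^ 2 : ℝ) : ℂ) := by
    intro x
    rw [← hSS, mul_apply_eq_comp]
    nth_rewrite 1 [← hSa]
    rw [ContinuousLinearMap.adjoint_inner_right, inner_self_eq_norm_sq_to_K]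
    norm_cast
  set b := (exists_hilbertBasis ℂ H).choose_spec.choose
  have hsum : Summable fun i => ‖S (b i)‖ ^ 2 := by
    have := summable_inner_of_mem_traceClass hA b.orthonormal
    simp_rw [key] at this
    exact Complex.summable_ofReal.1 this
  have htr : trace A = ((∑' i, ‖S (b i)‖ ^ 2 : ℝ) : ℂ) := by
    rw [Complex.ofReal_tsum]
    exact tsum_congr fun i => key _
  have hpars : ∀ k, HasSum (fun i => ‖inner ℂ (f k) (S (b i))‖ ^ 2) (‖S (f k)‖ ^ 2) := by
    intro k
    have h := b.hasSum_inner_mul_inner (S (f k)) (S (f k))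
    rw [inner_self_eq_norm_sq_to_K] at h
    have h' := (Complex.hasSum_iff _ _).1 h |>.1
    convert! h' using 1
    · ext i
      rw [← inner_conj_symm (S (f k)) (b i)]
      rw [Complex.conj_mul', ← hSa, ContinuousLinearMap.adjoint_inner_right, hSa,
        norm_inner_symm]
      norm_cast
    · norm_cast
  simp_rw [key]
  rw [htr, ← Complex.ofReal_sum]
  norm_cast
  refine hasSum_le (fun i => ?_) (hasSum_sum fun k _ => hpars k) hsum.hasSum
  exact hf.sum_inner_products_le (S (b i))

/-! ### Channels in Kraus form -/

/-- The map `A ↦ V A V^*`. -/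
def conjMap [CompleteSpace H] [CompleteSpace K] (V : H →L[ℂ] K)
    (hV : ∀ A ∈ TraceClass H, V ∘L A ∘L ContinuousLinearMap.adjoint V ∈ TraceClass K) :
    TraceClass H →ₗ[ℂ] TraceClass K where
  toFun A := ⟨_, hV A A.2⟩
  map_add' A B := by
    ext1
    simp [ContinuousLinearMap.add_comp]
  map_smul' c A := by
    ext1
    simp

theorem coe_conjMap [CompleteSpace H] [CompleteSpace K] (V : H →L[ℂ] K)
    (hV : ∀ A ∈ TraceClass H, V ∘L A ∘L ContinuousLinearMap.adjoint V ∈ TraceClass K)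
    (A : TraceClass H) : (conjMap V hV A : K →L[ℂ] K) =
      V ∘L (A : H →L[ℂ] H) ∘L ContinuousLinearMap.adjoint V := rfl

theorem isCompletelyPositive_conjMap [CompleteSpace H] [CompleteSpace K] (V : H →L[ℂ] K)
    (hV : ∀ A ∈ TraceClass H, V ∘L A ∘L ContinuousLinearMap.adjoint V ∈ TraceClass K) :
    IsCompletelyPositive (conjMap V hV) := by
  intro k A hA v
  have h := hA fun i => ContinuousLinearMap.adjoint V (v i)
  simpa [coe_conjMap, ContinuousLinearMap.adjoint_inner_left] using h

theorem IsCompletelyPositive.sum {ι : Type*} {s : Finset ι}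
    {T : ι → TraceClass H →ₗ[ℂ] TraceClass K} (hT : ∀ i, IsCompletelyPositive (T i)) :
    IsCompletelyPositive (∑ i ∈ s, T i) := by
  intro k A hA v
  have h : ∀ i ∈ s, 0 ≤ ∑ a, ∑ b, inner ℂ (v a) ((T i (A a b) : K →L[ℂ] K) (v b)) :=
    fun i _ => hT i k A hA v
  refine (Finset.sum_nonneg h).trans (le_of_eq ?_)
  simp only [LinearMap.sum_apply, Submodule.coe_sum, _root_.sum_apply, inner_sum]
  rw [Finset.sum_comm]
  exact Finset.sum_congr rfl fun a _ => Finset.sum_comm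

theorem IsCompletelyPositive.add {T S : TraceClass H →ₗ[ℂ] TraceClass K}
    (hT : IsCompletelyPositive T) (hS : IsCompletelyPositive S) :
    IsCompletelyPositive (T + S) := by
  intro k A hA v
  refine (add_nonneg (hT k A hA v) (hS k A hA v)).trans (le_of_eq ?_)
  simp only [LinearMap.add_apply, Submodule.coe_add, _root_.add_apply, inner_add_right,
    Finset.sum_add_distrib]

theorem IsCompletelyPositive.smul {T : TraceClass H →ₗ[ℂ] TraceClass K}
    (hT : IsCompletelyPositive T) {c : ℝ} (hc : 0 ≤ c) :
    IsCompletelyPositive ((c : ℂ) • T) := by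
  intro k A hA v
  have hc' : (0 : ℂ) ≤ c := by exact_mod_cast hc
  refine (mul_nonneg hc' (hT k A hA v)).trans (le_of_eq ?_)
  simp only [LinearMap.smul_apply, Submodule.coe_smul, _root_.smul_apply, inner_smul_right,
    Finset.mul_sum]

/-- A positive functional followed by the preparation of a pure state is completely positive. -/
theorem isCompletelyPositive_smulRight {t : TraceClass H →ₗ[ℂ] ℂ}
    (ht : ∀ A : TraceClass H, (∀ x, 0 ≤ inner ℂ x ((A : H →L[ℂ] H) x)) → 0 ≤ t A) (w : K) :
    IsCompletelyPositive (t.smulRight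
      (⟨rankOne ℂ w w, rankOne_mem_traceClass w w⟩ : TraceClass K)) := by
  intro k A hA v
  -- The block form to be estimated is `t` applied to one operator, ∑ ⟨v_i, w⟩⟨w, v_j⟩ A_ij. The
  -- quadratic form of that operator at x is the block form of A at the vectors ⟨w, v_i⟩ x, hence
  -- nonnegative.
  have h := ht (∑ i, ∑ j, (inner ℂ (v i) w * inner ℂ w (v j)) • A i j) (by
    intro x
    refine (hA fun i => inner ℂ w (v i) • x).trans (le_of_eq ?_)
    simp only [Submodule.coe_sum, Submodule.coe_smul, _root_.sum_apply,
      _root_.smul_apply, inner_sum, inner_smul_right, inner_smul_left, map_smul, inner_conj_symm]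
    refine Finset.sum_congr rfl fun i _ => Finset.sum_congr rfl fun j _ => by ring)
  refine h.trans (le_of_eq ?_)
  simp only [map_sum, map_smul, LinearMap.smulRight_apply, Submodule.coe_smul, _root_.smul_apply,
    rankOne_apply, inner_smul_right, smul_eq_mul]
  refine Finset.sum_congr rfl fun i _ => Finset.sum_congr rfl fun j _ => by ring

/-- Writing A = ∑ |A b⟩⟨b| in an orthonormal basis, Tr V A V^* = ∑ ⟨V b, V A b⟩; the completeness
relation ∑ V^* V = 1 then removes the V. -/
theorem isTracePreserving_sum_conjMap [FiniteDimensional ℂ H] [CompleteSpace H] [CompleteSpace K]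
    {ι : Type*} [Fintype ι] (V : ι → H →L[ℂ] K)
    (hV : ∀ i, ∀ A ∈ TraceClass H,
      V i ∘L A ∘L ContinuousLinearMap.adjoint (V i) ∈ TraceClass K)
    (h1 : ∀ x, ∑ i, ContinuousLinearMap.adjoint (V i) (V i x) = x) :
    IsTracePreserving (∑ i, conjMap (V i) (hV i)) := by
  intro A
  set b := stdOrthonormalBasis ℂ H
  rw [← traceLinear_apply, LinearMap.sum_apply, map_sum]
  simp only [traceLinear_apply, coe_conjMap, conj_eq_sum_rankOne b, trace_sum_rankOne]
  rw [Finset.sum_comm]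
  conv_rhs => rw [eq_sum_rankOne b (A : H →L[ℂ] H), trace_sum_rankOne]
  refine Finset.sum_congr rfl fun x _ => ?_
  simp only [← ContinuousLinearMap.adjoint_inner_right]
  rw [← inner_sum, h1]

end TraceClassTheory

/-! ### Finite-dimensional representations of 𝔰𝔲(2) and their orthonormal ladders. -/

section Ladder

variable {H : Type*} [NormedAddCommGroup H] [InnerProductSpace ℂ H]

/-- A representation of `𝔰𝔲(2)` by a lowering operator `L`, its adjoint `R` and the weight
operator `Z`. -/
structure IsSpinTriple (L R Z : H →L[ℂ] H) : Prop where
  adjoint : ∀ x y, inner ℂ (L x) y = inner ℂ x (R y)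
  symm : ∀ x y, inner ℂ (Z x) y = inner ℂ x (Z y)
  raise_lower : ∀ x, R (L x) = L (R x) + Z x
  weight_lower : ∀ x, Z (L x) = L (Z x) - (2 : ℂ) • L x
  weight_raise : ∀ x, Z (R x) = R (Z x) + (2 : ℂ) • R x

/-- The matrix element `√((k+1)(d-k))` of the lowering operator in the representation of
dimension `d + 1`. -/
def ladderCoeff (d k : ℕ) : ℝ := √(((k : ℝ) + 1) * ((d : ℝ) - k))

/-- `e 0, …, e d` is the standard basis of an irreducible representation of dimension `d + 1`,
and `e k = 0` for `k > d`. -/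
structure IsLadder (L R Z : H →L[ℂ] H) (d : ℕ) (e : ℕ → H) : Prop where
  orthonormal : ∀ k l, inner ℂ (e k) (e l) = if k = l ∧ k ≤ d then (1 : ℂ) else 0
  lower : ∀ k, L (e k) = (ladderCoeff d k : ℂ) • e (k + 1)
  raise_zero : R (e 0) = 0
  raise_succ : ∀ k, R (e (k + 1)) = (ladderCoeff d k : ℂ) • e k
  weight : ∀ k, Z (e k) = ((d : ℂ) - 2 * k) • e k

theorem IsLadder.norm_eq_one {L R Z : H →L[ℂ] H} {d : ℕ} {e : ℕ → H} (h : IsLadder L R Z d e)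
    {k : ℕ} (hk : k ≤ d) : ‖e k‖ = 1 := by
  have h1 := h.orthonormal k k
  rw [if_pos ⟨rfl, hk⟩, inner_self_eq_ofReal] at h1
  have h2 : ‖e k‖ ^ 2 = 1 := by exact_mod_cast h1
  nlinarith [norm_nonneg (e k)]

theorem IsLadder.eq_zero {L R Z : H →L[ℂ] H} {d : ℕ} {e : ℕ → H} (h : IsLadder L R Z d e)
    {k : ℕ} (hk : d < k) : e k = 0 := by
  have h1 := h.orthonormal k k
  rw [if_neg (by omega)] at h1
  exact inner_self_eq_zero.1 h1

theorem IsLadder.norm_le_one {L R Z : H →L[ℂ] H} {d : ℕ} {e : ℕ → H} (h : IsLadder L R Z d e)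
    (k : ℕ) : ‖e k‖ ≤ 1 := by
  rcases le_or_gt k d with hk | hk
  · exact (h.norm_eq_one hk).le
  · simp [h.eq_zero hk]

/-- Take an eigenvector of Z in W with eigenvalue of largest real part. R would raise the eigenvalue
by 2, so it must annihilate this vector; the eigenvalue is real since Z is symmetric. -/
theorem IsSpinTriple.exists_highest_weight [FiniteDimensional ℂ H] {L R Z : H →L[ℂ] H}
    (h : IsSpinTriple L R Z) {W : Submodule ℂ H} (hW : W ≠ ⊥) (hR : ∀ x ∈ W, R x ∈ W)
    (hZ : ∀ x ∈ W, Z x ∈ W) :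
    ∃ v ∈ W, ∃ z : ℝ, v ≠ 0 ∧ R v = 0 ∧ Z v = (z : ℂ) • v := by
  have : Nontrivial W := Submodule.nontrivial_iff_ne_bot.2 hW
  set f : Module.End ℂ W := (Z : H →ₗ[ℂ] H).restrict hZ with hf
  have hfin : {a | f.HasEigenvalue a}.Finite := f.finite_hasEigenvalue
  obtain ⟨a, ha, hmax⟩ := Set.exists_max_image {a | f.HasEigenvalue a} Complex.re hfin
    (Module.End.exists_eigenvalue f)
  obtain ⟨v, hv⟩ := Module.End.HasEigenvalue.exists_hasEigenvector ha
  have hZv : Z v = a • (v : H) := congrArg Subtype.val hv.apply_eq_smul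
  have hv0 : (v : H) ≠ 0 := fun h0 => hv.2 (Subtype.ext h0)
  have hreal : conj a = a := by
    have h1 := h.symm v v
    rw [hZv, inner_smul_left, inner_smul_right] at h1
    exact mul_right_cancel₀ (inner_self_ne_zero.2 hv0) h1
  refine ⟨v, v.2, a.re, hv0, ?_, ?_⟩
  · by_contra hne
    have hev : f.HasEigenvector (a + 2) ⟨R v, hR v v.2⟩ := by
      refine ⟨Module.End.mem_eigenspace_iff.2 (Subtype.ext ?_), fun h0 => hne (congrArg Subtype.val h0)⟩
      change Z (R v) = (a + 2) • R v
      rw [h.weight_raise, hZv, map_smul, add_smul]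
    have := hmax _ (Module.End.hasEigenvalue_of_hasEigenvector hev)
    simp at this
    linarith
  · rw [hZv, Complex.conj_eq_iff_re.1 hreal]

theorem IsSpinTriple.weight_pow {L R Z : H →L[ℂ] H} (h : IsSpinTriple L R Z) {v : H} {z : ℂ}
    (hZ : Z v = z • v) (k : ℕ) : Z ((L ^ k) v) = (z - 2 * k) • (L ^ k) v := by
  induction k with
  | zero => simp [hZ]
  | succ k ih =>
    rw [pow_succ', mul_apply_eq_comp, h.weight_lower, ih, map_smul, ← sub_smul]
    congr 1
    push_cast
    ring

theorem IsSpinTriple.raise_pow {L R Z : H →L[ℂ] H} (h : IsSpinTriple L R Z) {v : H} {z : ℂ}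
    (hR : R v = 0) (hZ : Z v = z • v) (k : ℕ) :
    R ((L ^ (k + 1)) v) = (((k : ℂ) + 1) * (z - k)) • (L ^ k) v := by
  induction k with
  | zero => simp [h.raise_lower, hR, hZ]
  | succ k ih =>
    rw [pow_succ', mul_apply_eq_comp, h.raise_lower, ih, map_smul, h.weight_pow hZ,
      ← mul_apply_eq_comp, ← pow_succ', ← add_smul]
    congr 1
    push_cast
    ring

theorem IsSpinTriple.norm_pow_sq {L R Z : H →L[ℂ] H} (h : IsSpinTriple L R Z) {v : H} {z : ℝ}
    (hR : R v = 0) (hZ : Z v = (z : ℂ) • v) (k : ℕ) :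
    ‖(L ^ (k + 1)) v‖ ^ 2 = ((k : ℝ) + 1) * (z - k) * ‖(L ^ k) v‖ ^ 2 := by
  have h1 : inner ℂ ((L ^ (k + 1)) v) ((L ^ (k + 1)) v) =
      (((k : ℂ) + 1) * (z - k)) * inner ℂ ((L ^ k) v) ((L ^ k) v) := by
    rw [← inner_smul_right, ← h.raise_pow hR hZ, ← h.adjoint, ← mul_apply_eq_comp, ← pow_succ']
  rw [inner_self_eq_ofReal, inner_self_eq_ofReal] at h1
  exact_mod_cast h1

/-- If z were not a natural number, the ratio (k+1)(z-k) of consecutive squared norms would never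
vanish, so no Lᵏ v would be zero; but for k > z this ratio is negative. -/
theorem IsSpinTriple.exists_nat_weight {L R Z : H →L[ℂ] H} (h : IsSpinTriple L R Z) {v : H}
    {z : ℝ} (hv : v ≠ 0) (hR : R v = 0) (hZ : Z v = (z : ℂ) • v) : ∃ d : ℕ, z = d := by
  by_contra! hne
  have hn : ∀ k : ℕ, ‖(L ^ k) v‖ ≠ 0 := by
    intro k
    induction k with
    | zero => simpa using hv
    | succ k ih =>
      intro h0
      have h1 := h.norm_pow_sq hR hZ k
      rw [h0] at h1
      have h2 : z - k ≠ 0 := sub_ne_zero.2 (hne k)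
      have h3 : (k : ℝ) + 1 ≠ 0 := by positivity
      exact (mul_ne_zero (mul_ne_zero h3 h2) (pow_ne_zero 2 ih)) (by rw [← h1]; simp)
  obtain ⟨k, hk⟩ := exists_nat_gt z
  have h1 := h.norm_pow_sq hR hZ k
  have h2 : 0 < ‖(L ^ k) v‖ ^ 2 := pow_pos (lt_of_le_of_ne (norm_nonneg _) (hn k).symm) 2
  have h3 : ((k : ℝ) + 1) * (z - k) < 0 := mul_neg_of_pos_of_neg (by positivity) (by linarith)
  nlinarith [sq_nonneg ‖(L ^ (k + 1)) v‖]

theorem IsSpinTriple.exists_ladder {L R Z : H →L[ℂ] H} (h : IsSpinTriple L R Z) {v : H} {z : ℝ}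
    (hv : v ≠ 0) (hR : R v = 0) (hZ : Z v = (z : ℂ) • v) :
    ∃ (d : ℕ) (e : ℕ → H), IsLadder L R Z d e ∧ (∃ c : ℂ, e 0 = c • v) ∧
      ∀ k, ∃ c : ℂ, e k = c • (L ^ k) v := by
  obtain ⟨d, rfl⟩ := h.exists_nat_weight hv hR hZ
  obtain ⟨x, hx⟩ : ∃ x : ℕ → H, ∀ k, x k = (L ^ k) v := ⟨_, fun _ => rfl⟩
  have hx0 : x 0 = v := by rw [hx]; simp
  have hLx : ∀ k, L (x k) = x (k + 1) := fun k => by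
    rw [hx, hx, pow_succ' L k, mul_apply_eq_comp]
  have hZx : ∀ k, Z (x k) = ((d : ℂ) - 2 * k) • x k := fun k => by
    rw [hx, h.weight_pow hZ]
    norm_cast
  have hRx : ∀ k, R (x (k + 1)) = (((k : ℂ) + 1) * (d - k)) • x k := fun k => by
    rw [hx, hx, h.raise_pow hR hZ]
    norm_cast
  have hnx : ∀ k, ‖x (k + 1)‖ ^ 2 = ((k : ℝ) + 1) * (d - k) * ‖x k‖ ^ 2 := fun k => by
    rw [hx, hx, h.norm_pow_sq hR hZ]
  -- The factor z - k of the norm recursion vanishes at k = d, so the orbit stops exactly there.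
  have hzero : ∀ k, d < k → x k = 0 := by
    intro k hk
    obtain ⟨j, rfl⟩ := Nat.exists_eq_add_of_lt hk
    induction j with
    | zero => simpa using hnx d
    | succ j ih =>
      rw [show d + (j + 1) + 1 = (d + j + 1) + 1 by ring, ← hLx, ih (by omega), map_zero]
  have hnorm : ∀ k, k ≤ d → ‖x (k + 1)‖ = ladderCoeff d k * ‖x k‖ := by
    intro k hk
    have hk' : (k : ℝ) ≤ d := by exact_mod_cast hk
    rw [ladderCoeff, ← Real.sqrt_sq (norm_nonneg (x (k + 1))), hnx,
      Real.sqrt_mul (mul_nonneg (by positivity) (by linarith)), Real.sqrt_sq (norm_nonneg _)]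
  have hpos : ∀ k, k < d → 0 < ladderCoeff d k := by
    intro k hk
    have hk' : (k : ℝ) < d := by exact_mod_cast hk
    exact Real.sqrt_pos.2 (mul_pos (by positivity) (by linarith))
  have hne : ∀ k, k ≤ d → ‖x k‖ ≠ 0 := by
    intro k
    induction k with
    | zero => intro _; simpa [hx0] using hv
    | succ k ih =>
      intro hk
      rw [hnorm k (by omega)]
      exact mul_ne_zero (hpos k (by omega)).ne' (ih (by omega))
  have hsq : ∀ k, k ≤ d → (ladderCoeff d k : ℂ) * ladderCoeff d k = ((k : ℂ) + 1) * (d - k) := by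
    intro k hk
    have hk' : (k : ℝ) ≤ d := by exact_mod_cast hk
    have := Real.mul_self_sqrt (show 0 ≤ ((k : ℝ) + 1) * ((d : ℝ) - k) from
      mul_nonneg (by positivity) (by linarith))
    rw [ladderCoeff, ← Complex.ofReal_mul, this]
    push_cast
    rfl
  have hd : ladderCoeff d d = 0 := by simp [ladderCoeff]
  obtain ⟨e, he⟩ : ∃ e : ℕ → H, ∀ k, e k = ((‖x k‖ : ℂ)⁻¹) • x k := ⟨_, fun _ => rfl⟩
  have hw : ∀ k, Z (e k) = ((d : ℂ) - 2 * k) • e k := by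
    intro k
    rw [he, map_smul, hZx, smul_comm]
  refine ⟨d, e, ⟨?_, ?_, ?_, ?_, hw⟩, ⟨(‖v‖ : ℂ)⁻¹, by rw [he, hx0]⟩,
    fun k => ⟨(‖x k‖ : ℂ)⁻¹, by rw [he, hx]⟩⟩
  · intro k l
    split_ifs with hkl
    · obtain ⟨rfl, hk⟩ := hkl
      have h' : (‖x k‖ : ℂ) ≠ 0 := by exact_mod_cast hne k hk
      rw [he, inner_smul_left, inner_smul_right, inner_self_eq_ofReal, map_inv₀,
        Complex.conj_ofReal]
      push_cast
      field_simp
    · by_cases hk : k = l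
      · subst hk
        rw [he, hzero k (by omega), smul_zero, inner_zero_left]
      -- Eigenvectors of the symmetric operator Z for the distinct weights d - 2k and d - 2l.
      · have h1 := h.symm (e k) (e l)
        rw [hw, hw, inner_smul_left, inner_smul_right] at h1
        have h2 : conj ((d : ℂ) - 2 * k) = (d : ℂ) - 2 * k := by
          rw [map_sub, map_mul, Complex.conj_natCast, Complex.conj_natCast, Complex.conj_ofNat]
        rw [h2] at h1
        have h3 : ((2 : ℂ) * (l - k)) * inner ℂ (e k) (e l) = 0 := by linear_combination h1
        refine (mul_eq_zero.1 h3).resolve_left (mul_ne_zero two_ne_zero (sub_ne_zero.2 ?_))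
        intro h'
        exact hk (by exact_mod_cast h'.symm)
  · intro k
    rw [he, map_smul, hLx]
    rcases lt_trichotomy k d with hk | rfl | hk
    · have a1 : (‖x k‖ : ℂ) ≠ 0 := by exact_mod_cast hne k hk.le
      have a2 : (ladderCoeff d k : ℂ) ≠ 0 := by exact_mod_cast (hpos k hk).ne'
      rw [he, smul_smul, hnorm k hk.le]
      congr 1
      push_cast
      field_simp
    · simp [hd, hzero (k + 1) (by omega)]
    · simp [he, hzero (k + 1) (by omega)]
  · rw [he, hx0, map_smul, hR, smul_zero]
  · intro k
    rw [he, map_smul, hRx, smul_smul]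
    rcases lt_trichotomy k d with hk | rfl | hk
    · have a1 : (‖x k‖ : ℂ) ≠ 0 := by exact_mod_cast hne k hk.le
      have a2 : (ladderCoeff d k : ℂ) ≠ 0 := by exact_mod_cast (hpos k hk).ne'
      rw [he, smul_smul, hnorm k hk.le, ← hsq k hk.le]
      congr 1
      push_cast
      field_simp
    · simp [hd]
    · simp [he, hzero k hk]

/-- Complete reducibility of an invariant subspace, with explicit bases. -/
theorem IsSpinTriple.exists_ladders_span [FiniteDimensional ℂ H] {L R Z : H →L[ℂ] H}
    (h : IsSpinTriple L R Z) (N : ℕ) : ∀ W : Submodule ℂ H, Module.finrank ℂ W ≤ N →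
      (∀ x ∈ W, L x ∈ W) → (∀ x ∈ W, R x ∈ W) → (∀ x ∈ W, Z x ∈ W) →
      ∃ (ι : Type) (_ : Fintype ι) (d : ι → ℕ) (e : ι → ℕ → H),
        (∀ i, IsLadder L R Z (d i) (e i)) ∧
        (∀ i j, i ≠ j → ∀ k l, inner ℂ (e i k) (e j l) = 0) ∧
        Submodule.span ℂ (⋃ i, Set.range (e i)) = W := by
  induction N with
  | zero =>
    intro W hN _ _ _
    have : W = ⊥ := Submodule.finrank_eq_zero.1 (by omega)
    exact ⟨Empty, inferInstance, Empty.elim, Empty.elim, fun i => i.elim, fun i => i.elim,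
      by simp [this]⟩
  | succ N ih =>
    intro W hN hL hR hZ
    by_cases hW : W = ⊥
    · exact ih W (by rw [hW]; simp) hL hR hZ
    -- Split off the ladder through a highest weight vector. Its span C is stable under L, R and Z,
    -- and these operators are adjoint to one another, so the orthogonal complement of C in W is
    -- stable as well; its dimension is smaller because it does not contain e 0.
    obtain ⟨v, hvW, z, hv, hRv, hZv⟩ := h.exists_highest_weight hW hR hZ
    obtain ⟨d, e, he, ⟨c, hc⟩, hek⟩ := h.exists_ladder hv hRv hZv
    set C : Submodule ℂ H := Submodule.span ℂ (Set.range e) with hC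
    have hLv : ∀ k, (L ^ k) v ∈ W := by
      intro k
      induction k with
      | zero => simpa using hvW
      | succ k ihk =>
        rw [pow_succ', mul_apply_eq_comp]
        exact hL _ ihk
    have heW : ∀ k, e k ∈ W := by
      intro k
      obtain ⟨a, ha⟩ := hek k
      rw [ha]
      exact W.smul_mem _ (hLv k)
    have hCW : C ≤ W := Submodule.span_le.2 (by rintro _ ⟨k, rfl⟩; exact heW k)
    have hmem : ∀ x, x ∈ Cᗮ ↔ ∀ k, inner ℂ (e k) x = 0 := by
      intro x
      rw [hC, Submodule.mem_orthogonal]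
      refine ⟨fun hx k => hx _ (Submodule.subset_span ⟨k, rfl⟩), fun hx u hu => ?_⟩
      induction hu using Submodule.span_induction with
      | mem u hu => obtain ⟨k, rfl⟩ := hu; exact hx k
      | zero => simp
      | add a b _ _ ha hb => rw [inner_add_left, ha, hb, add_zero]
      | smul a b _ hb => rw [inner_smul_left, hb, mul_zero]
    have hL' : ∀ x ∈ Cᗮ, L x ∈ Cᗮ := by
      intro x hx
      rw [hmem] at hx ⊢
      intro k
      rw [← inner_conj_symm, h.adjoint, inner_conj_symm]
      cases k with
      | zero => rw [he.raise_zero, inner_zero_left]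
      | succ k => rw [he.raise_succ, inner_smul_left, hx, mul_zero]
    have hR' : ∀ x ∈ Cᗮ, R x ∈ Cᗮ := by
      intro x hx
      rw [hmem] at hx ⊢
      intro k
      rw [← h.adjoint, he.lower, inner_smul_left, hx, mul_zero]
    have hZ' : ∀ x ∈ Cᗮ, Z x ∈ Cᗮ := by
      intro x hx
      rw [hmem] at hx ⊢
      intro k
      rw [← h.symm, he.weight, inner_smul_left, hx, mul_zero]
    have hlt : Module.finrank ℂ (Cᗮ ⊓ W : Submodule ℂ H) < Module.finrank ℂ W := by
      refine Submodule.finrank_lt_finrank_of_lt (lt_of_le_of_ne inf_le_right fun heq => ?_)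
      have h1 : e 0 ∈ Cᗮ ⊓ W := by rw [heq]; exact heW 0
      have h2 := (hmem _).1 h1.1 0
      rw [he.orthonormal, if_pos ⟨rfl, Nat.zero_le _⟩] at h2
      exact one_ne_zero h2
    obtain ⟨ι, _, d', e', h1, h2, h3⟩ := ih (Cᗮ ⊓ W) (by omega)
      (fun x hx => ⟨hL' x hx.1, hL x hx.2⟩) (fun x hx => ⟨hR' x hx.1, hR x hx.2⟩)
      (fun x hx => ⟨hZ' x hx.1, hZ x hx.2⟩)
    have horth : ∀ i k l, inner ℂ (e k) (e' i l) = 0 := by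
      intro i k l
      have : e' i l ∈ Cᗮ ⊓ W := by
        rw [← h3]
        exact Submodule.subset_span (Set.mem_iUnion.2 ⟨i, l, rfl⟩)
      exact (hmem _).1 this.1 k
    refine ⟨Option ι, inferInstance, fun i => i.elim d d', fun i => i.elim e e', ?_, ?_, ?_⟩
    · rintro (_ | i)
      exacts [he, h1 i]
    · rintro (_ | i) (_ | j) hij k l
      · exact absurd rfl hij
      · exact horth j k l
      · change inner ℂ (e' i k) (e l) = 0
        rw [← inner_conj_symm, horth, map_zero]
      · exact h2 i j (fun h' => hij (by rw [h'])) k l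
    · have : (⋃ i : Option ι, Set.range (i.elim e e' : ℕ → H)) =
          Set.range e ∪ ⋃ i, Set.range (e' i) := by
        ext x
        simp [Option.exists]
      rw [this, Submodule.span_union, h3, ← hC,
        Submodule.sup_orthogonal_inf_of_hasOrthogonalProjection hCW]

/-- A decomposition of `H` into irreducible representations with standard bases. -/
structure IsLadderBasis (L R Z : H →L[ℂ] H) {ι : Type} [Fintype ι] (d : ι → ℕ)
    (e : ι → ℕ → H) : Prop where
  ladder : ∀ i, IsLadder L R Z (d i) (e i)
  orthogonal : ∀ i j, i ≠ j → ∀ k l, inner ℂ (e i k) (e j l) = 0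
  complete : ∀ x, ∑ i, ∑ k ∈ Finset.range (d i + 1), inner ℂ (e i k) x • e i k = x

theorem IsLadder.sum_inner_smul {L R Z : H →L[ℂ] H} {d : ℕ} {e : ℕ → H}
    (h : IsLadder L R Z d e) (l : ℕ) :
    ∑ k ∈ Finset.range (d + 1), inner ℂ (e k) (e l) • e k = e l := by
  simp_rw [h.orthonormal]
  rcases le_or_gt l d with hl | hl
  · rw [Finset.sum_eq_single l]
    · simp [hl]
    · intro k _ hk
      simp [hk]
    · intro h'
      exact absurd (Finset.mem_range.2 (by omega)) h'
  · rw [h.eq_zero hl]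
    refine Finset.sum_eq_zero fun k hk => ?_
    rw [if_neg, zero_smul]
    have := Finset.mem_range.1 hk
    omega

theorem IsSpinTriple.exists_ladderBasis [FiniteDimensional ℂ H] {L R Z : H →L[ℂ] H}
    (h : IsSpinTriple L R Z) : ∃ (ι : Type) (_ : Fintype ι) (d : ι → ℕ) (e : ι → ℕ → H),
      IsLadderBasis L R Z d e := by
  obtain ⟨ι, hι, d, e, h1, h2, h3⟩ := h.exists_ladders_span (Module.finrank ℂ H) ⊤
    (by simp) (by simp) (by simp) (by simp)
  refine ⟨ι, hι, d, e, h1, h2, fun x => ?_⟩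
  have hx : x ∈ Submodule.span ℂ (⋃ i, Set.range (e i)) := by rw [h3]; trivial
  induction hx using Submodule.span_induction with
  | mem x hx =>
    obtain ⟨j, l, rfl⟩ := Set.mem_iUnion.1 hx
    rw [Finset.sum_eq_single j]
    · exact (h1 j).sum_inner_smul l
    · intro i _ hij
      exact Finset.sum_eq_zero fun k _ => by rw [h2 i j hij, zero_smul]
    · intro h'
      exact absurd (Finset.mem_univ _) h'
  | zero => simp
  | add a b _ _ ha hb =>
    simp only [inner_add_right, add_smul, Finset.sum_add_distrib]
    rw [ha, hb]
  | smul c b _ hb =>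
    simp only [inner_smul_right, mul_smul, ← Finset.smul_sum]
    rw [hb]

end Ladder

/-! ### Taylor expansion of one-parameter unitary groups on ladders -/

section Taylor

variable {E : Type*} [NormedAddCommGroup E] [NormedSpace ℝ E]

/-- The derivative of the remainder of order R + 1 is the remainder of order R for the shifted
family, so the bound follows by induction from the mean value inequality. In the applications F r t
= U_t Gʳ x; only differentiability along orbits is required, and G may be unbounded. -/
theorem norm_sub_taylor_le_pow {F : ℕ → ℝ → E} (hF : ∀ r t, HasDerivAt (F r) (F (r + 1) t) t)
    {M : ℝ} (R : ℕ) (hM : ∀ t, ‖F R t‖ ≤ M) : ∀ t ∈ Set.Icc (0 : ℝ) 1,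
      ‖F 0 t - ∑ r ∈ Finset.range R, (t ^ r / r.factorial) • F r 0‖ ≤ M * (t ^ R / R.factorial) := by
  induction R generalizing F with
  | zero => intro t _; simpa using hM t
  | succ R ih =>
    have ih' := ih (F := fun r => F (r + 1)) (fun r t => hF (r + 1) t) hM
    have hpow : ∀ (r : ℕ) (t : ℝ), HasDerivAt (fun t : ℝ => t ^ (r + 1) / (r + 1).factorial)
        (t ^ r / r.factorial) t := by
      intro r t
      have h := (hasDerivAt_pow (r + 1) t).div_const ((r + 1).factorial : ℝ)
      convert! h using 1
      rw [Nat.factorial_succ]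
      push_cast
      have : (r.factorial : ℝ) ≠ 0 := by positivity
      field_simp
    have hf : ∀ t, HasDerivAt
        (fun t => F 0 t - ∑ r ∈ Finset.range (R + 1), (t ^ r / r.factorial) • F r 0)
        (F 1 t - ∑ r ∈ Finset.range R, (t ^ r / r.factorial) • F (r + 1) 0) t := by
      intro t
      have h : HasDerivAt
          (fun t : ℝ => (∑ r ∈ Finset.range R, (t ^ (r + 1) / (r + 1).factorial) • F (r + 1) 0) +
            F 0 0) (∑ r ∈ Finset.range R, (t ^ r / r.factorial) • F (r + 1) 0) t :=
        (HasDerivAt.fun_sum fun r _ => (hpow r t).smul_const (F (r + 1) 0)).add_const _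
      refine ((hF 0 t).sub h).congr_of_eventuallyEq (Eventually.of_forall fun s => ?_)
      simp only [Pi.sub_apply]
      rw [Finset.sum_range_succ']
      simp
    refine image_norm_le_of_norm_deriv_right_le_deriv_boundary (a := 0) (b := 1)
      (B' := fun t => M * (t ^ R / R.factorial))
      (fun t _ => (hf t).continuousAt.continuousWithinAt) (fun t _ => (hf t).hasDerivWithinAt)
      ?_ (fun t => (hpow R t).const_mul M) (fun t ht => ih' t ⟨ht.1, ht.2.le⟩)
    rw [Finset.sum_range_succ']
    simp

theorem norm_sub_taylor_le {F : ℕ → ℝ → E} (hF : ∀ r t, HasDerivAt (F r) (F (r + 1) t) t)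
    {M : ℝ} (R : ℕ) (hM : ∀ t, ‖F R t‖ ≤ M) :
    ‖F 0 1 - ∑ r ∈ Finset.range R, (r.factorial : ℝ)⁻¹ • F r 0‖ ≤ M / R.factorial := by
  simpa [div_eq_mul_inv] using norm_sub_taylor_le_pow hF R hM 1 (by simp)

end Taylor

section LadderIterate

variable {E : Type*} [NormedAddCommGroup E] [NormedSpace ℂ E]

/-- The vector `G ^ r (x k)` for an operator `G` that acts on the ladder `x` by
`G (x k) = a g(k) x(k+1) - ā g(k-1) x(k-1)`. -/
def ladderIterate {M : Type*} [AddCommGroup M] [Module ℂ M] (a : ℂ) (g : ℕ → ℝ) (x : ℕ → M) :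
    ℕ → ℕ → M
  | 0, k => x k
  | r + 1, 0 => (a * g 0) • ladderIterate a g x r 1
  | r + 1, k + 1 =>
    (a * g (k + 1)) • ladderIterate a g x r (k + 2) - (conj a * g k) • ladderIterate a g x r k

/-- The iterates depend on the coefficients and the vectors only, so linear maps transport them:
from Schwartz functions to L², and from the qubits to the oscillator. -/
theorem map_ladderIterate {M N : Type*} [AddCommGroup M] [Module ℂ M] [AddCommGroup N]
    [Module ℂ N] (f : M →ₗ[ℂ] N) (a : ℂ) (g : ℕ → ℝ) (x : ℕ → M) (r : ℕ) :
    ∀ k, f (ladderIterate a g x r k) = ladderIterate a g (fun k => f (x k)) r k := by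
  induction r with
  | zero => intro k; rfl
  | succ r ih =>
    rintro (_ | k)
    · simp only [ladderIterate, map_smul, ih]
    · simp only [ladderIterate, map_sub, map_smul, ih]

/-- The recursion defining `ladderIterate` applies the innermost G first, as Gʳ (G x_k).
Differentiating an orbit produces an outermost G instead; the two agree. -/
theorem apply_ladderIterate {M : Type*} [AddCommGroup M] [Module ℂ M] (G : M →ₗ[ℂ] M) {a : ℂ}
    {g : ℕ → ℝ} {x : ℕ → M} (h0 : G (x 0) = (a * g 0) • x 1)
    (hs : ∀ k, G (x (k + 1)) = (a * g (k + 1)) • x (k + 2) - (conj a * g k) • x k) (r : ℕ) :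
    ∀ k, G (ladderIterate a g x r k) = ladderIterate a g x (r + 1) k := by
  induction r with
  | zero =>
    rintro (_ | k)
    · exact h0
    · exact hs k
  | succ r ih =>
    rintro (_ | k)
    · rw [ladderIterate, map_smul, ih, ladderIterate]
    · rw [ladderIterate, map_sub, map_smul, map_smul, ih, ih]
      rfl

/-- The bound `(2A)^r √((k+1)⋯(k+r))` for `ladderIterate`. -/
def ladderBound (A : ℝ) (r k : ℕ) : ℝ := (2 * A) ^ r * ∏ s ∈ Finset.range r, √((k : ℝ) + 1 + s)

theorem ladderBound_nonneg {A : ℝ} (hA : 0 ≤ A) (r k : ℕ) : 0 ≤ ladderBound A r k :=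
  mul_nonneg (by positivity) (Finset.prod_nonneg fun _ _ => Real.sqrt_nonneg _)

theorem ladderBound_succ (A : ℝ) (r k : ℕ) :
    ladderBound A (r + 1) k = 2 * A * (√((k : ℝ) + 1) * ladderBound A r (k + 1)) := by
  rw [ladderBound, ladderBound, Finset.prod_range_succ', pow_succ]
  push_cast
  have : ∀ s : ℕ, (k : ℝ) + 1 + (s + 1) = k + 1 + 1 + s := fun s => by ring
  simp only [this, add_zero]
  ring

theorem ladderBound_mono {A : ℝ} (hA : 0 ≤ A) (r : ℕ) {k l : ℕ} (hkl : k ≤ l) :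
    ladderBound A r k ≤ ladderBound A r l := by
  have : (k : ℝ) ≤ l := by exact_mod_cast hkl
  unfold ladderBound
  gcongr

/-- The factor 2 in 2A allots half of the next bound to each neighbour of an index. The upper
neighbour is covered by `ladderBound_succ`, the lower one by this inequality. -/
theorem ladderBound_step {A : ℝ} (hA : 0 ≤ A) (r k : ℕ) :
    A * (√((k : ℝ) + 1) * ladderBound A r k) ≤ ladderBound A (r + 1) (k + 1) / 2 := by
  rw [ladderBound_succ]
  have h1 := ladderBound_mono hA r (show k ≤ k + 1 + 1 by omega)
  have h2 : √((k : ℝ) + 1) ≤ √(((k + 1 : ℕ) : ℝ) + 1) := by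
    refine Real.sqrt_le_sqrt ?_
    push_cast
    linarith
  have h3 := ladderBound_nonneg hA r k
  have := mul_le_mul_of_nonneg_left (mul_le_mul h2 h1 h3 (Real.sqrt_nonneg _)) hA
  linarith

theorem norm_smul_ladder_le {A : ℝ} {a : ℂ} (ha : ‖a‖ ≤ A) {s g : ℝ} (hg0 : 0 ≤ g) (hg : g ≤ s)
    {v : E} {B : ℝ} (hv : ‖v‖ ≤ B) : ‖(a * g) • v‖ ≤ A * (s * B) := by
  rw [norm_smul, norm_mul, Complex.norm_real, Real.norm_of_nonneg hg0, mul_assoc]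
  have h0 := norm_nonneg v
  have h1 := norm_nonneg a
  exact mul_le_mul ha (mul_le_mul hg hv h0 (hg0.trans hg)) (by positivity) (h1.trans ha)

theorem norm_ladderIterate_le {A : ℝ} {a : ℂ} (ha : ‖a‖ ≤ A) {g : ℕ → ℝ} (hg0 : ∀ m, 0 ≤ g m)
    (hg : ∀ m, g m ≤ √((m : ℝ) + 1)) {x : ℕ → E} (hx : ∀ k, ‖x k‖ ≤ 1) (r : ℕ) :
    ∀ k, ‖ladderIterate a g x r k‖ ≤ ladderBound A r k := by
  have hA : 0 ≤ A := (norm_nonneg a).trans ha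
  induction r with
  | zero => intro k; simpa [ladderBound, ladderIterate] using hx k
  | succ r ih =>
    have h1 : ∀ k, ‖(a * g k) • ladderIterate a g x r (k + 1)‖ ≤ ladderBound A (r + 1) k / 2 := by
      intro k
      refine (norm_smul_ladder_le ha (hg0 k) (hg k) (ih (k + 1))).trans (le_of_eq ?_)
      rw [ladderBound_succ]
      ring
    rintro (_ | k)
    · refine (h1 0).trans ?_
      linarith [ladderBound_nonneg hA (r + 1) 0]
    · rw [ladderIterate]
      have ha' : ‖conj a‖ ≤ A := by rwa [Complex.norm_conj]
      have h2 := (norm_smul_ladder_le ha' (hg0 k) (hg k) (ih k)).trans (ladderBound_step hA r k)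
      refine (norm_sub_le _ _).trans ((add_le_add (h1 (k + 1)) h2).trans (le_of_eq ?_))
      ring

/-- Each of the r steps costs one relative coefficient error η, which explains the factor r η.
Starting from k, only indices up to k + r ≤ N are reached, so the vectors and the coefficients need
to be compared up to N only. -/
theorem norm_ladderIterate_sub_le {A : ℝ} {a : ℂ} (ha : ‖a‖ ≤ A) {g h : ℕ → ℝ}
    (hg0 : ∀ m, 0 ≤ g m) (hg : ∀ m, g m ≤ √((m : ℝ) + 1)) (hh0 : ∀ m, 0 ≤ h m)
    (hh : ∀ m, h m ≤ √((m : ℝ) + 1)) {x y : ℕ → E} (hy : ∀ k, ‖y k‖ ≤ 1) {N : ℕ}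
    (hxy : ∀ k ≤ N, x k = y k) {η : ℝ} (hη : ∀ m ≤ N, |g m - h m| ≤ η * √((m : ℝ) + 1)) (r : ℕ) :
    ∀ k, k + r ≤ N →
      ‖ladderIterate a g x r k - ladderIterate a h y r k‖ ≤ r * η * ladderBound A r k := by
  have hA : 0 ≤ A := (norm_nonneg a).trans ha
  have hη0 : 0 ≤ η := by
    have h0 := (abs_nonneg _).trans (hη 0 (Nat.zero_le _))
    simpa using h0
  induction r with
  | zero => intro k hk; simp [ladderIterate, hxy k (by omega)]
  | succ r ih =>
    have key : ∀ (b : ℂ), ‖b‖ ≤ A → ∀ m l, m ≤ N → l + r ≤ N →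
        ‖(b * g m) • ladderIterate a g x r l - (b * h m) • ladderIterate a h y r l‖ ≤
          (r + 1) * η * (A * (√((m : ℝ) + 1) * ladderBound A r l)) := by
      intro b hb m l hm hl
      have e : (b * g m) • ladderIterate a g x r l - (b * h m) • ladderIterate a h y r l =
          (b * g m) • (ladderIterate a g x r l - ladderIterate a h y r l) +
            (b * (g m - h m : ℝ)) • ladderIterate a h y r l := by
        push_cast
        module
      rw [e]
      have t1 := norm_smul_ladder_le hb (hg0 m) (hg m) (ih l hl)
      have t2 : ‖(b * (g m - h m : ℝ)) • ladderIterate a h y r l‖ ≤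
          A * (η * √((m : ℝ) + 1) * ladderBound A r l) := by
        rw [norm_smul, norm_mul, Complex.norm_real, Real.norm_eq_abs, mul_assoc]
        have q := norm_ladderIterate_le ha hh0 hh hy r l
        have q1 := hη m hm
        gcongr
      refine (norm_add_le _ _).trans ((add_le_add t1 t2).trans (le_of_eq ?_))
      ring
    rintro (_ | k) hk
    · simp only [ladderIterate]
      refine (key a ha 0 1 (by omega) (by omega)).trans ?_
      have := ladderBound_succ A r 0
      have h0 : 0 ≤ (r + 1) * η * ladderBound A (r + 1) 0 :=
        mul_nonneg (by positivity) (ladderBound_nonneg hA _ _)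
      push_cast at this ⊢
      rw [this] at h0 ⊢
      linarith
    · simp only [ladderIterate]
      have ha' : ‖conj a‖ ≤ A := by rwa [Complex.norm_conj]
      have t1 := key a ha (k + 1) (k + 2) (by omega) (by omega)
      have t2 := key (conj a) ha' k k (by omega) (by omega)
      have t3 := mul_le_mul_of_nonneg_left (ladderBound_step hA r k)
        (show 0 ≤ ((r : ℝ) + 1) * η by positivity)
      have t4 := ladderBound_succ A r (k + 1)
      rw [sub_sub_sub_comm]
      refine (norm_sub_le _ _).trans ((add_le_add t1 (t2.trans t3)).trans (le_of_eq ?_))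
      push_cast at t4 ⊢
      rw [t4]
      ring

/-- From k + 1 + s ≤ (k+1)(s+1) the bound is at most √(cʳ r!) with c = (2A)²(k+1); it grows only
like the square root of a factorial. -/
theorem tendsto_ladderBound_div_factorial {A : ℝ} (hA : 0 ≤ A) (k : ℕ) :
    Tendsto (fun r => ladderBound A r k / r.factorial) atTop (𝓝 0) := by
  set c : ℝ := (2 * A) ^ 2 * (k + 1) with hc
  have h1 : Tendsto (fun r : ℕ => √(c ^ r / r.factorial)) atTop (𝓝 0) := by
    have := (Real.continuous_sqrt.tendsto 0).comp
      (FloorSemiring.tendsto_pow_div_factorial_atTop c)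
    rwa [Real.sqrt_zero] at this
  refine squeeze_zero (fun r => div_nonneg (ladderBound_nonneg hA r k) (by positivity))
    (fun r => ?_) h1
  have hprod : ∏ s ∈ Finset.range r, √((k : ℝ) + 1 + s) ≤ √(((k : ℝ) + 1) ^ r * r.factorial) := by
    induction r with
    | zero => simp
    | succ r ih =>
      rw [Finset.prod_range_succ, Nat.factorial_succ, pow_succ]
      push_cast
      rw [show ((k : ℝ) + 1) ^ r * (k + 1) * (((r : ℝ) + 1) * r.factorial) =
        ((k : ℝ) + 1) ^ r * r.factorial * ((k + 1) * (r + 1)) by ring,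
        Real.sqrt_mul (by positivity)]
      refine mul_le_mul ih (Real.sqrt_le_sqrt ?_) (Real.sqrt_nonneg _) (Real.sqrt_nonneg _)
      nlinarith [show (0 : ℝ) ≤ k * r by positivity]
  have hfac : (0 : ℝ) < r.factorial := by positivity
  have h2 : ladderBound A r k ≤ √(c ^ r * r.factorial) := by
    rw [hc, mul_pow, ← pow_mul, mul_comm 2 r, pow_mul, mul_assoc, Real.sqrt_mul (by positivity),
      Real.sqrt_sq (by positivity)]
    exact mul_le_mul_of_nonneg_left hprod (by positivity)
  rw [div_le_iff₀ hfac]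
  refine h2.trans (le_of_eq ?_)
  rw [show c ^ r * r.factorial = c ^ r / r.factorial * (r.factorial : ℝ) ^ 2 by field_simp,
    Real.sqrt_mul' _ (by positivity), Real.sqrt_sq hfac.le]

end LadderIterate

/-! ### Number states -/

/-- For a monomial: |xⁿ| ≤ 1 + x²ⁿ and x²ⁿ ≤ 2ⁿ n! exp(x²/2). Together with the next lemma this
gives the decay that makes the Gaussian a Schwartz function. -/
theorem exists_bound_poly_gauss (q : Polynomial ℝ) :
    ∃ C, ∀ x : ℝ, |q.eval x * Real.exp (-(x ^ 2 / 2))| ≤ C := by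
  induction q using Polynomial.induction_on' with
  | add p q hp hq =>
    obtain ⟨C, hC⟩ := hp
    obtain ⟨C', hC'⟩ := hq
    refine ⟨C + C', fun x => ?_⟩
    rw [Polynomial.eval_add, add_mul]
    exact (abs_add_le _ _).trans (add_le_add (hC x) (hC' x))
  | monomial n a =>
    refine ⟨|a| * (1 + 2 ^ n * n.factorial), fun x => ?_⟩
    rw [Polynomial.eval_monomial, abs_mul, abs_mul, Real.abs_exp, mul_assoc]
    refine mul_le_mul_of_nonneg_left ?_ (abs_nonneg a)
    have h1 : |x ^ n| ≤ 1 + (x ^ 2) ^ n := by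
      rw [← pow_mul, mul_comm 2 n, pow_mul, ← sq_abs]
      nlinarith [sq_nonneg (|x ^ n| - 1), abs_nonneg (x ^ n)]
    have h2 := Real.pow_div_factorial_le_exp (x ^ 2 / 2) (by positivity) n
    have h3 : Real.exp (x ^ 2 / 2) * Real.exp (-(x ^ 2 / 2)) = 1 := by
      rw [← Real.exp_add, add_neg_cancel, Real.exp_zero]
    have h4 : Real.exp (-(x ^ 2 / 2)) ≤ 1 := Real.exp_le_one_iff.2 (by linarith [sq_nonneg x])
    have h5 : (x ^ 2) ^ n ≤ 2 ^ n * n.factorial * Real.exp (x ^ 2 / 2) := by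
      rw [div_pow, div_div, div_le_iff₀ (by positivity)] at h2
      linarith
    have h6 := Real.exp_pos (-(x ^ 2 / 2))
    calc |x ^ n| * Real.exp (-(x ^ 2 / 2))
        ≤ (1 + 2 ^ n * n.factorial * Real.exp (x ^ 2 / 2)) * Real.exp (-(x ^ 2 / 2)) := by
          gcongr
          linarith
      _ = Real.exp (-(x ^ 2 / 2)) +
          2 ^ n * n.factorial * (Real.exp (x ^ 2 / 2) * Real.exp (-(x ^ 2 / 2))) := by ring
      _ ≤ _ := by rw [h3]; linarith

theorem exists_iteratedDeriv_gauss (n : ℕ) : ∃ q : Polynomial ℝ,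
    iteratedDeriv n (fun x : ℝ => ((Real.exp (-(x ^ 2 / 2)) : ℝ) : ℂ)) =
      fun x => ((q.eval x * Real.exp (-(x ^ 2 / 2)) : ℝ) : ℂ) := by
  induction n with
  | zero => exact ⟨1, by simp⟩
  | succ n ih =>
    obtain ⟨q, hq⟩ := ih
    refine ⟨Polynomial.derivative q - Polynomial.X * q, ?_⟩
    rw [iteratedDeriv_succ, hq]
    ext x
    have h1 : HasDerivAt (fun y : ℝ => -(y ^ 2 / 2)) (-x) x := by
      have := ((hasDerivAt_pow 2 x).div_const 2).neg
      convert! this using 1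
      simp
    have h2 := ((q.hasDerivAt x).mul h1.exp).ofReal_comp
    refine h2.deriv.trans ?_
    congr 1
    simp
    ring

/-- The Gaussian `x ↦ exp(-x²/2)` as a Schwartz function. -/
def gaussSchwartz : 𝓢(ℝ, ℂ) where
  toFun x := ((Real.exp (-(x ^ 2 / 2)) : ℝ) : ℂ)
  smooth' := Complex.ofRealCLM.contDiff.comp
    (g := Complex.ofRealCLM) (f := fun x : ℝ => Real.exp (-(x ^ 2 / 2))) (by fun_prop)
  decay' k n := by
    obtain ⟨q, hq⟩ := exists_iteratedDeriv_gauss n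
    obtain ⟨C, hC⟩ := exists_bound_poly_gauss (Polynomial.X ^ k * q)
    refine ⟨C, fun x => ?_⟩
    rw [norm_iteratedFDeriv_eq_norm_iteratedDeriv, hq, Complex.norm_real, Real.norm_eq_abs,
      Real.norm_eq_abs, ← abs_pow, ← abs_mul, ← mul_assoc]
    simpa using hC x

/-- The number states as Schwartz functions. -/
def numberSchwartz : ℕ → 𝓢(ℝ, ℂ)
  | 0 => ((√(√Real.pi) : ℝ) : ℂ)⁻¹ • gaussSchwartz
  | k + 1 => ((√((k : ℝ) + 1) : ℝ) : ℂ)⁻¹ • creationOp (numberSchwartz k)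

theorem positionOp_apply (f : 𝓢(ℝ, ℂ)) (x : ℝ) : positionOp f x = (x : ℂ) * f x := by
  rw [positionOp, SchwartzMap.smulLeftCLM_apply_apply (by fun_prop)]
  rfl

theorem momentumOp_apply (f : 𝓢(ℝ, ℂ)) (x : ℝ) : momentumOp f x = -Complex.I * deriv f x := by
  simp [momentumOp]

theorem creationOp_apply (f : 𝓢(ℝ, ℂ)) (x : ℝ) :
    creationOp f x = ((√2 : ℝ) : ℂ)⁻¹ * (x * f x - deriv f x) := by
  have : creationOp f x =
      ((√2 : ℝ) : ℂ)⁻¹ * (positionOp f x - Complex.I * momentumOp f x) := rfl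
  rw [this, positionOp_apply, momentumOp_apply]
  linear_combination (((√2 : ℝ) : ℂ)⁻¹ * deriv f x) * Complex.I_mul_I

theorem annihilationOp_apply (f : 𝓢(ℝ, ℂ)) (x : ℝ) :
    annihilationOp f x = ((√2 : ℝ) : ℂ)⁻¹ * (x * f x + deriv f x) := by
  have : annihilationOp f x =
      ((√2 : ℝ) : ℂ)⁻¹ * (positionOp f x + Complex.I * momentumOp f x) := rfl
  rw [this, positionOp_apply, momentumOp_apply]
  linear_combination (-((√2 : ℝ) : ℂ)⁻¹ * deriv f x) * Complex.I_mul_I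

theorem numberFun_eq (k : ℕ) (x : ℝ) : numberFun k x =
    (hermiteR k).eval (√2 * x) * Real.exp (-x ^ 2 / 2) / √(√Real.pi * (k.factorial : ℝ)) := by
  have h1 : (Polynomial.aeval (√2 * x) (Polynomial.hermite k) : ℝ) =
      (hermiteR k).eval (√2 * x) := by
    rw [hermiteR, Polynomial.eval_map, Polynomial.aeval_def]
    rfl
  rw [numberFun, h1]

theorem hasDerivAt_numberFun (k : ℕ) (x : ℝ) : HasDerivAt (numberFun k)
    ((√2 * (Polynomial.derivative (hermiteR k)).eval (√2 * x) - x * (hermiteR k).eval (√2 * x)) *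
      Real.exp (-x ^ 2 / 2) / √(√Real.pi * (k.factorial : ℝ))) x := by
  rw [show numberFun k = fun x => _ from funext (numberFun_eq k)]
  have h1 : HasDerivAt (fun y : ℝ => -y ^ 2 / 2) (-x) x := by
    have := ((hasDerivAt_pow 2 x).neg).div_const 2
    convert! this using 1
    simp
    ring
  have h2 : HasDerivAt (fun y : ℝ => √2 * y) √2 x := by
    simpa using (hasDerivAt_id x).const_mul √2
  have h3 := ((((hermiteR k).hasDerivAt (√2 * x)).comp x h2).mul h1.exp).div_const
    √(√Real.pi * (k.factorial : ℝ))
  convert! h3 using 1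
  simp only [Function.comp_apply]
  ring

theorem sqrt_pi_factorial_succ (k : ℕ) : √(√Real.pi * ((k + 1).factorial : ℝ)) =
    √((k : ℝ) + 1) * √(√Real.pi * (k.factorial : ℝ)) := by
  rw [← Real.sqrt_mul (by positivity), Nat.factorial_succ]
  push_cast
  congr 1
  ring

/-- This is the recursion He_{k+1} = X He_k - He_k' of the Hermite polynomials; the lowering
relation rests on He_{k+1}' = (k+1) He_k. -/
theorem numberFun_raise (k : ℕ) (x : ℝ) :
    x * numberFun k x - deriv (numberFun k) x = √2 * √((k : ℝ) + 1) * numberFun (k + 1) x := by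
  rw [(hasDerivAt_numberFun k x).deriv, numberFun_eq, numberFun_eq, sqrt_pi_factorial_succ,
    hermiteR_succ, Polynomial.eval_sub, Polynomial.eval_mul, Polynomial.eval_X]
  have h2 : √(2 : ℝ) * √2 = 2 := Real.mul_self_sqrt (by norm_num)
  have h3 : √((k : ℝ) + 1) ≠ 0 := by positivity
  have h4 : √(√Real.pi * (k.factorial : ℝ)) ≠ 0 := by
    have := Real.pi_pos
    positivity
  field_simp
  rw [mul_comm x √2]
  linear_combination (-x * (hermiteR k).eval (√2 * x)) * h2

theorem numberFun_lower_zero (x : ℝ) : x * numberFun 0 x + deriv (numberFun 0) x = 0 := by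
  rw [(hasDerivAt_numberFun 0 x).deriv, numberFun_eq]
  simp [hermiteR]
  ring

theorem numberFun_lower_succ (k : ℕ) (x : ℝ) :
    x * numberFun (k + 1) x + deriv (numberFun (k + 1)) x =
      √2 * √((k : ℝ) + 1) * numberFun k x := by
  rw [(hasDerivAt_numberFun (k + 1) x).deriv, numberFun_eq, numberFun_eq, sqrt_pi_factorial_succ,
    derivative_hermiteR_succ, Polynomial.eval_mul, Polynomial.eval_C]
  have h2 : √((k : ℝ) + 1) * √((k : ℝ) + 1) = k + 1 := Real.mul_self_sqrt (by positivity)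
  have h3 : √((k : ℝ) + 1) ≠ 0 := by positivity
  have h4 : √(√Real.pi * (k.factorial : ℝ)) ≠ 0 := by
    have := Real.pi_pos
    positivity
  field_simp
  rw [sq, h2]
  ring

theorem deriv_ofReal_numberFun (k : ℕ) (x : ℝ) :
    deriv (fun x => (numberFun k x : ℂ)) x = ((deriv (numberFun k) x : ℝ) : ℂ) := by
  have h := (hasDerivAt_numberFun k x)
  rw [h.deriv]
  exact h.ofReal_comp.deriv

/-- Identifies the Schwartz functions built by repeated creation with the explicit Hermite
functions, so that the ladder relations hold for the number states. -/
theorem coe_numberSchwartz (k : ℕ) :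
    (numberSchwartz k : ℝ → ℂ) = fun x => (numberFun k x : ℂ) := by
  induction k with
  | zero =>
    ext x
    have : numberSchwartz 0 x = ((√(√Real.pi) : ℝ) : ℂ)⁻¹ * ((Real.exp (-(x ^ 2 / 2)) : ℝ) : ℂ) :=
      rfl
    rw [this, numberFun_eq]
    simp [hermiteR]
    rw [div_eq_inv_mul]
    ring_nf
  | succ k ih =>
    ext x
    have h1 : numberSchwartz (k + 1) x =
        ((√((k : ℝ) + 1) : ℝ) : ℂ)⁻¹ * creationOp (numberSchwartz k) x := rfl
    rw [h1, creationOp_apply, ih, deriv_ofReal_numberFun]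
    have h := numberFun_raise k x
    have h3 : ((√((k : ℝ) + 1) : ℝ) : ℂ) ≠ 0 := by
      have : √((k : ℝ) + 1) ≠ 0 := by positivity
      exact_mod_cast this
    have h4 : ((√2 : ℝ) : ℂ) ≠ 0 := by
      have : √(2 : ℝ) ≠ 0 := by positivity
      exact_mod_cast this
    rw [mul_comm √2] at h
    field_simp
    exact_mod_cast h

theorem creationOp_numberSchwartz (k : ℕ) :
    creationOp (numberSchwartz k) = ((√((k : ℝ) + 1) : ℝ) : ℂ) • numberSchwartz (k + 1) := by
  have h3 : ((√((k : ℝ) + 1) : ℝ) : ℂ) ≠ 0 := by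
    have : √((k : ℝ) + 1) ≠ 0 := by positivity
    exact_mod_cast this
  rw [numberSchwartz, smul_smul, mul_inv_cancel₀ h3, one_smul]

theorem annihilationOp_numberSchwartz_zero : annihilationOp (numberSchwartz 0) = 0 := by
  ext x
  rw [annihilationOp_apply, coe_numberSchwartz, deriv_ofReal_numberFun]
  have h := numberFun_lower_zero x
  have h' : (x : ℂ) * numberFun 0 x + ((deriv (numberFun 0) x : ℝ) : ℂ) = 0 := by exact_mod_cast h
  rw [h', mul_zero]
  rfl

theorem annihilationOp_numberSchwartz_succ (k : ℕ) : annihilationOp (numberSchwartz (k + 1)) =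
    ((√((k : ℝ) + 1) : ℝ) : ℂ) • numberSchwartz k := by
  ext x
  rw [annihilationOp_apply, coe_numberSchwartz, deriv_ofReal_numberFun, _root_.smul_apply,
    coe_numberSchwartz]
  have h := numberFun_lower_succ k x
  have h' : (x : ℂ) * numberFun (k + 1) x + ((deriv (numberFun (k + 1)) x : ℝ) : ℂ) =
    (√2 : ℝ) * (√((k : ℝ) + 1) : ℝ) * numberFun k x := by exact_mod_cast h
  have h4 : ((√2 : ℝ) : ℂ) ≠ 0 := by
    have : √(2 : ℝ) ≠ 0 := by positivity
    exact_mod_cast this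
  rw [h', smul_eq_mul]
  field_simp

theorem toLp_numberSchwartz (k : ℕ) : (numberSchwartz k).toLp 2 volume = numberState k := by
  rw [SchwartzMap.toLp, numberState]
  exact MemLp.toLp_congr _ _ (ae_of_all _ fun x => by rw [coe_numberSchwartz])

/-- The generator `z a^* - z̄ a` of the displacements. -/
def displacementGenerator (z : ℂ) : 𝓢(ℝ, ℂ) →ₗ[ℂ] 𝓢(ℝ, ℂ) :=
  z • (creationOp : 𝓢(ℝ, ℂ) →ₗ[ℂ] 𝓢(ℝ, ℂ)) - conj z • (annihilationOp : 𝓢(ℝ, ℂ) →ₗ[ℂ] 𝓢(ℝ, ℂ))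

/-- The group law moves the derivative from 0 to an arbitrary time. -/
theorem hasDerivAt_displacement_smul (z : ℂ) (f : 𝓢(ℝ, ℂ)) (t : ℝ) :
    HasDerivAt (fun t : ℝ => displacement (t * z) (f.toLp 2 volume))
      (displacement (t * z) ((displacementGenerator z f).toLp 2 volume)) t := by
  have h0 : HasDerivAt (fun s : ℝ => displacement (s * z) (f.toLp 2 volume))
      ((displacementGenerator z f).toLp 2 volume) (t - t) := by
    rw [sub_self]
    exact hasDerivAt_displacement z f
  have h1 : HasDerivAt (fun s : ℝ => displacement ((s - t : ℝ) * z) (f.toLp 2 volume))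
      ((displacementGenerator z f).toLp 2 volume) t := h0.comp_sub_const t t
  have h2 := (((displacement (t * z)).toContinuousLinearMap.restrictScalars ℝ).hasFDerivAt).comp_hasDerivAt
    t h1
  refine h2.congr_of_eventuallyEq (Eventually.of_forall fun s => ?_)
  change displacement (s * z) _ = displacement (t * z) (displacement ((s - t : ℝ) * z) _)
  rw [← displacement_add_mul, add_sub_cancel]

/-- The inner product of two orbits of a unitary group is constant; its derivative at 0 is the left
side. This replaces an integration by parts. -/
theorem inner_displacementGenerator (z : ℂ) (f g : 𝓢(ℝ, ℂ)) :
    inner ℂ ((displacementGenerator z f).toLp 2 volume) (g.toLp 2 volume) +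
      inner ℂ (f.toLp 2 volume) ((displacementGenerator z g).toLp 2 volume) = 0 := by
  have h := (hasDerivAt_displacement z f).inner ℂ (hasDerivAt_displacement z g)
  simp only [LinearIsometry.inner_map_map] at h
  have h' := h.unique (hasDerivAt_const (0 : ℝ) _)
  simp only [Complex.ofReal_zero, zero_mul, displacement_zero] at h'
  rw [add_comm]
  exact h'

/-- Skewness of z a^* - z̄ a for z = 1 and for z = i gives two linear relations, from which the
adjointness of a and a^* is solved. -/
theorem inner_creationOp (f g : 𝓢(ℝ, ℂ)) :
    inner ℂ ((creationOp f).toLp 2 volume) (g.toLp 2 volume) =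
      inner ℂ (f.toLp 2 volume) ((annihilationOp g).toLp 2 volume) := by
  have h1 := inner_displacementGenerator 1 f g
  have h2 := inner_displacementGenerator Complex.I f g
  have e : ∀ (z : ℂ) (f : 𝓢(ℝ, ℂ)), (displacementGenerator z f).toLp 2 volume =
      z • (creationOp f).toLp 2 volume - conj z • (annihilationOp f).toLp 2 volume := by
    intro z f
    have := map_sub (SchwartzMap.toLpCLM ℂ ℂ 2 (volume : Measure ℝ)) (z • creationOp f)
      (conj z • annihilationOp f)
    rw [map_smul, map_smul] at this
    exact this
  simp only [e, inner_sub_left, inner_sub_right, inner_smul_left, inner_smul_right, map_one,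
    Complex.conj_I, map_neg] at h1 h2
  linear_combination (1 / 2) * h1 + (Complex.I / 2) * h2 + ((1 / 2) * (
    inner ℂ ((creationOp f).toLp 2 volume) (g.toLp 2 volume) +
    inner ℂ ((annihilationOp f).toLp 2 volume) (g.toLp 2 volume) -
    inner ℂ (f.toLp 2 volume) ((creationOp g).toLp 2 volume) -
    inner ℂ (f.toLp 2 volume) ((annihilationOp g).toLp 2 volume))) * Complex.I_mul_I

/-- Adjointness gives √(k+1) ⟨k+1|l⟩ = ⟨k| a |l⟩, which lowers both indices by one; induction ends
at a|0⟩ = 0. -/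
theorem orthonormal_numberState : Orthonormal ℂ numberState := by
  have hsmul : ∀ (c : ℂ) (f : 𝓢(ℝ, ℂ)), (c • f).toLp 2 volume = c • f.toLp 2 volume :=
    fun c f => map_smul (SchwartzMap.toLpCLM ℂ ℂ 2 (volume : Measure ℝ)) c f
  have hcreate : ∀ k l : ℕ, ((√((k : ℝ) + 1) : ℝ) : ℂ) *
      inner ℂ (numberState (k + 1)) (numberState l) =
        inner ℂ (numberState k) ((annihilationOp (numberSchwartz l)).toLp 2 volume) := by
    intro k l
    have h := inner_creationOp (numberSchwartz k) (numberSchwartz l)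
    rw [creationOp_numberSchwartz, hsmul, inner_smul_left, Complex.conj_ofReal] at h
    simpa only [toLp_numberSchwartz] using h
  have hpos : ∀ k : ℕ, ((√((k : ℝ) + 1) : ℝ) : ℂ) ≠ 0 := by
    intro k
    have : √((k : ℝ) + 1) ≠ 0 := by positivity
    exact_mod_cast this
  have h0 : ∀ k, inner ℂ (numberState (k + 1)) (numberState 0) = 0 := by
    intro k
    have h := hcreate k 0
    have hz : (0 : 𝓢(ℝ, ℂ)).toLp 2 volume = 0 := map_zero (SchwartzMap.toLpCLM ℂ ℂ 2 (volume : Measure ℝ))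
    rw [annihilationOp_numberSchwartz_zero, hz, inner_zero_right] at h
    exact (mul_eq_zero.1 h).resolve_left (hpos k)
  refine ⟨norm_numberState, fun k => ?_⟩
  induction k with
  | zero =>
    rintro (_ | l) hl
    · exact absurd rfl hl
    · rw [← inner_conj_symm, h0, map_zero]
  | succ k ih =>
    rintro (_ | l) hl
    · exact h0 k
    · have h := hcreate k (l + 1)
      rw [annihilationOp_numberSchwartz_succ, hsmul, toLp_numberSchwartz, inner_smul_right,
        ih (fun h' => hl (by rw [h'])), mul_zero] at h
      exact (mul_eq_zero.1 h).resolve_left (hpos k)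

/-- The Taylor expansion of the displacement of a number state. -/
theorem norm_displacement_sub_taylor_le {A s : ℝ} {a : ℂ} (ha : ‖a‖ ≤ A) (hs0 : 0 ≤ s)
    (hs1 : s ≤ 1) (k R : ℕ) :
    ‖displacement (s * a) (numberState k) - ∑ r ∈ Finset.range R, (r.factorial : ℝ)⁻¹ •
      ladderIterate a (fun m => s * √((m : ℝ) + 1)) numberState r k‖ ≤
        ladderBound A R k / R.factorial := by
  set g : ℕ → ℝ := fun m => s * √((m : ℝ) + 1) with hg
  have hG0 : displacementGenerator (s * a) (numberSchwartz 0) = (a * g 0) • numberSchwartz 1 := by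
    have : displacementGenerator (s * a) (numberSchwartz 0) = (s * a : ℂ) •
        creationOp (numberSchwartz 0) - conj (s * a : ℂ) • annihilationOp (numberSchwartz 0) := rfl
    rw [this, creationOp_numberSchwartz, annihilationOp_numberSchwartz_zero, smul_zero, sub_zero,
      smul_smul, hg]
    congr 1
    push_cast
    ring
  have hGs : ∀ k, displacementGenerator (s * a) (numberSchwartz (k + 1)) =
      (a * g (k + 1)) • numberSchwartz (k + 2) - (conj a * g k) • numberSchwartz k := by
    intro k
    have : displacementGenerator (s * a) (numberSchwartz (k + 1)) = (s * a : ℂ) •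
        creationOp (numberSchwartz (k + 1)) -
          conj (s * a : ℂ) • annihilationOp (numberSchwartz (k + 1)) := rfl
    rw [this, creationOp_numberSchwartz, annihilationOp_numberSchwartz_succ, smul_smul, smul_smul,
      hg, map_mul, Complex.conj_ofReal]
    congr 2 <;> push_cast <;> ring
  have hLp : ∀ r, (ladderIterate a g numberSchwartz r k).toLp 2 volume =
      ladderIterate a g numberState r k := by
    intro r
    have := map_ladderIterate
      ((SchwartzMap.toLpCLM ℂ ℂ 2 (volume : Measure ℝ)) : 𝓢(ℝ, ℂ) →ₗ[ℂ] L2R) a g numberSchwartz r k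
    refine this.trans ?_
    congr 1
    ext1 k
    exact toLp_numberSchwartz k
  -- The r-th derivative of the orbit at time t is D(t z) Gʳ |k⟩. Since D is isometric, its norm is
  -- bounded uniformly in t by the norm of the iterate.
  have hF := norm_sub_taylor_le (F := fun r t =>
      displacement (t * (s * a)) ((ladderIterate a g numberSchwartz r k).toLp 2 volume))
    (fun r t => by
      have := hasDerivAt_displacement_smul (s * a) (ladderIterate a g numberSchwartz r k) t
      rwa [apply_ladderIterate _ hG0 hGs] at this)
    (M := ladderBound A R k) R (fun t => by
      rw [LinearIsometry.norm_map, hLp]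
      exact norm_ladderIterate_le ha (fun m => mul_nonneg hs0 (Real.sqrt_nonneg _))
        (fun m => mul_le_of_le_one_left (Real.sqrt_nonneg _) hs1)
        (fun k => (norm_numberState k).le) R k)
  simp only [hLp, Complex.ofReal_one, one_mul, Complex.ofReal_zero, zero_mul,
    displacement_zero] at hF
  exact hF

/-! ### Tensor products of matrices and collective operators -/

section Tensor

variable {n : ℕ}

/-- The matrix of `M 0 ⊗ ⋯ ⊗ M (n-1)` in the product basis. -/
def tensorMatrix (M : Fin n → Matrix (Fin 2) (Fin 2) ℂ) :
    Matrix (Fin n → Fin 2) (Fin n → Fin 2) ℂ :=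
  Matrix.of fun i j => ∏ k, M k (i k) (j k)

theorem tensorMatrix_apply (M : Fin n → Matrix (Fin 2) (Fin 2) ℂ) (i j : Fin n → Fin 2) :
    tensorMatrix M i j = ∏ k, M k (i k) (j k) := rfl

theorem tensorMatrix_mul (M N : Fin n → Matrix (Fin 2) (Fin 2) ℂ) :
    tensorMatrix M * tensorMatrix N = tensorMatrix fun k => M k * N k := by
  ext i j
  simp only [Matrix.mul_apply, tensorMatrix_apply, ← Finset.prod_mul_distrib]
  rw [Finset.prod_univ_sum, Fintype.piFinset_univ]

theorem tensorMatrix_diagonal (f : Fin n → Fin 2 → ℂ) :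
    tensorMatrix (fun k => Matrix.diagonal (f k)) = Matrix.diagonal fun x => ∏ k, f k (x k) := by
  ext i j
  rw [tensorMatrix_apply]
  by_cases hij : i = j
  · subst hij
    simp
  · obtain ⟨k, hk⟩ := Function.ne_iff.1 hij
    rw [Matrix.diagonal_apply_ne _ hij]
    exact Finset.prod_eq_zero (Finset.mem_univ k) (Matrix.diagonal_apply_ne _ hk)

theorem tensorPower_diagonal (f : Fin 2 → ℂ) :
    tensorPower n (Matrix.diagonal f) = Matrix.diagonal fun x => ∏ k, f (x k) :=
  tensorMatrix_diagonal fun _ => f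

theorem tensorPower_one : tensorPower n 1 = 1 := by
  rw [← Matrix.diagonal_one, tensorPower_diagonal]
  simp

theorem tensorPower_mul (M N : Matrix (Fin 2) (Fin 2) ℂ) :
    tensorPower n (M * N) = tensorPower n M * tensorPower n N :=
  (tensorMatrix_mul (fun _ => M) fun _ => N).symm

theorem tensorPower_conjTranspose (M : Matrix (Fin 2) (Fin 2) ℂ) :
    tensorPower n M.conjTranspose = (tensorPower n M).conjTranspose := by
  ext i j
  simp [tensorPower]

/-- The matrix `A` acting on the `k`-th qubit. -/
def siteMatrix (k : Fin n) (A : Matrix (Fin 2) (Fin 2) ℂ) :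
    Matrix (Fin n → Fin 2) (Fin n → Fin 2) ℂ :=
  tensorMatrix (Function.update 1 k A)

theorem siteMatrix_apply (k : Fin n) (A : Matrix (Fin 2) (Fin 2) ℂ) (i j : Fin n → Fin 2) :
    siteMatrix k A i j = (∏ l ∈ Finset.univ.erase k, (1 : Matrix (Fin 2) (Fin 2) ℂ) (i l) (j l)) *
      A (i k) (j k) := by
  rw [siteMatrix, tensorMatrix_apply, ← Finset.prod_erase_mul _ _ (Finset.mem_univ k),
    Function.update_self]
  congr 1
  refine Finset.prod_congr rfl fun l hl => ?_
  rw [Function.update_of_ne (Finset.ne_of_mem_erase hl), Pi.one_apply]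

theorem siteMatrix_mul_self (k : Fin n) (A B : Matrix (Fin 2) (Fin 2) ℂ) :
    siteMatrix k A * siteMatrix k B = siteMatrix k (A * B) := by
  rw [siteMatrix, siteMatrix, tensorMatrix_mul, siteMatrix]
  congr 1
  ext1 l
  by_cases h : l = k
  · subst h
    simp
  · simp [Function.update_of_ne h]

theorem siteMatrix_comm {k l : Fin n} (hkl : k ≠ l) (A B : Matrix (Fin 2) (Fin 2) ℂ) :
    siteMatrix k A * siteMatrix l B = siteMatrix l B * siteMatrix k A := by
  rw [siteMatrix, siteMatrix, tensorMatrix_mul, tensorMatrix_mul]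
  congr 1
  ext1 m
  by_cases h : m = k
  · subst h
    simp [Function.update_of_ne hkl]
  · simp [Function.update_of_ne h]

variable (n) in
/-- The collective operator `∑ₖ A⁽ᵏ⁾`. -/
def collective : Matrix (Fin 2) (Fin 2) ℂ →ₗ[ℂ] Matrix (Fin n → Fin 2) (Fin n → Fin 2) ℂ where
  toFun A := ∑ k, siteMatrix k A
  map_add' A B := by
    ext i j
    simp [Matrix.sum_apply, siteMatrix_apply, mul_add, Finset.sum_add_distrib]
  map_smul' c A := by
    ext i j
    simp only [Matrix.sum_apply, siteMatrix_apply, Matrix.smul_apply, smul_eq_mul, RingHom.id_apply,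
      Finset.mul_sum]
    exact Finset.sum_congr rfl fun k _ => by ring

theorem collective_apply (A : Matrix (Fin 2) (Fin 2) ℂ) : collective n A = ∑ k, siteMatrix k A :=
  rfl

/-- Matrices at different sites commute, so only the diagonal of the double sum survives. -/
theorem collective_commutator (A B : Matrix (Fin 2) (Fin 2) ℂ) :
    collective n A * collective n B - collective n B * collective n A =
      collective n (A * B - B * A) := by
  rw [map_sub]
  simp only [collective_apply, Finset.sum_mul_sum]
  rw [Finset.sum_comm (f := fun k l => siteMatrix k B * siteMatrix l A), ← Finset.sum_sub_distrib,
    ← Finset.sum_sub_distrib]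
  refine Finset.sum_congr rfl fun k _ => ?_
  rw [← Finset.sum_sub_distrib, Finset.sum_eq_single k]
  · rw [siteMatrix_mul_self, siteMatrix_mul_self]
  · intro l _ hl
    rw [siteMatrix_comm hl.symm, sub_self]
  · intro h
    exact absurd (Finset.mem_univ k) h

theorem collective_conjTranspose (A : Matrix (Fin 2) (Fin 2) ℂ) :
    (collective n A).conjTranspose = collective n A.conjTranspose := by
  ext i j
  simp only [collective_apply, Matrix.conjTranspose_apply, Matrix.sum_apply, siteMatrix_apply,
    star_sum, star_mul', star_prod]
  refine Finset.sum_congr rfl fun k _ => ?_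
  congr 1
  refine Finset.prod_congr rfl fun l _ => ?_
  rw [← Matrix.conjTranspose_apply, Matrix.conjTranspose_one]

/-- Product rule for the entries: since `M 0 = 1`, the undifferentiated factors become identity
entries, as in `siteMatrix_apply`. -/
theorem hasDerivAt_tensorPower {M : ℝ → Matrix (Fin 2) (Fin 2) ℂ} {A : Matrix (Fin 2) (Fin 2) ℂ}
    (h1 : M 0 = 1) (hM : ∀ a b, HasDerivAt (fun t => M t a b) (A a b) 0) (i j : Fin n → Fin 2) :
    HasDerivAt (fun t => tensorPower n (M t) i j) (collective n A i j) 0 := by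
  have h := HasDerivAt.fun_finsetProd (u := Finset.univ) (f := fun k t => M t (i k) (j k))
    (f' := fun k => A (i k) (j k)) (x := (0 : ℝ)) fun k _ => hM (i k) (j k)
  convert! h using 1
  simp only [collective_apply, Matrix.sum_apply, siteMatrix_apply, h1, smul_eq_mul]

end Tensor

/-! ### The collective spin representation on n qubits. -/

section Spin

variable (n : ℕ)

/-- The lowering matrix `|1⟩⟨0|`. -/
def sigmaMinus : Matrix (Fin 2) (Fin 2) ℂ := !![0, 0; 1, 0]

/-- The raising matrix `|0⟩⟨1|`. -/
def sigmaPlus : Matrix (Fin 2) (Fin 2) ℂ := !![0, 1; 0, 0]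

/-- The Pauli matrix `σ_z`. -/
def sigmaZ : Matrix (Fin 2) (Fin 2) ℂ := Matrix.diagonal ![1, -1]

theorem sigmaZ_eq : sigmaZ = !![1, 0; 0, -1] := by
  ext i j
  fin_cases i <;> fin_cases j <;> simp [sigmaZ]

/-- The collective operator `∑ₖ A⁽ᵏ⁾` on `(ℂ²)^{⊗ n}`. -/
def collectiveOp (A : Matrix (Fin 2) (Fin 2) ℂ) : QubitSpace n →L[ℂ] QubitSpace n :=
  Matrix.toEuclideanCLM (𝕜 := ℂ) (collective n A)

theorem collectiveOp_commutator (A B : Matrix (Fin 2) (Fin 2) ℂ) (x : QubitSpace n) :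
    collectiveOp n A (collectiveOp n B x) =
      collectiveOp n B (collectiveOp n A x) + collectiveOp n (A * B - B * A) x := by
  have h := congrArg (Matrix.toEuclideanCLM (𝕜 := ℂ)) (collective_commutator (n := n) A B)
  rw [map_sub, map_mul, map_mul] at h
  have h' := congrArg (fun f : QubitSpace n →L[ℂ] QubitSpace n => f x) h
  simp only [_root_.sub_apply, mul_apply_eq_comp] at h'
  rw [collectiveOp, collectiveOp, collectiveOp, ← h', add_sub_cancel]

theorem inner_toEuclideanCLM {κ : Type*} [Fintype κ] [DecidableEq κ] (A : Matrix κ κ ℂ)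
    (x y : EuclideanSpace ℂ κ) : inner ℂ (Matrix.toEuclideanCLM (𝕜 := ℂ) A x) y =
      inner ℂ x (Matrix.toEuclideanCLM (𝕜 := ℂ) A.conjTranspose y) := by
  have h : Matrix.toEuclideanCLM (𝕜 := ℂ) A.conjTranspose =
      ContinuousLinearMap.adjoint (Matrix.toEuclideanCLM (𝕜 := ℂ) A) :=
    map_star (Matrix.toEuclideanCLM (𝕜 := ℂ) (n := κ)) A
  rw [h, ContinuousLinearMap.adjoint_inner_right]

theorem inner_collectiveOp (A : Matrix (Fin 2) (Fin 2) ℂ) (x y : QubitSpace n) :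
    inner ℂ (collectiveOp n A x) y = inner ℂ x (collectiveOp n A.conjTranspose y) := by
  rw [collectiveOp, inner_toEuclideanCLM, collective_conjTranspose, collectiveOp]

theorem collectiveOp_smul (c : ℂ) (A : Matrix (Fin 2) (Fin 2) ℂ) (x : QubitSpace n) :
    collectiveOp n (c • A) x = c • collectiveOp n A x := by
  rw [collectiveOp, map_smul, map_smul]
  rfl

theorem collectiveOp_sub (A B : Matrix (Fin 2) (Fin 2) ℂ) (x : QubitSpace n) :
    collectiveOp n (A - B) x = collectiveOp n A x - collectiveOp n B x := by
  rw [collectiveOp, map_sub, map_sub]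
  rfl

theorem isSpinTriple_collectiveOp : IsSpinTriple (collectiveOp n sigmaMinus)
    (collectiveOp n sigmaPlus) (collectiveOp n sigmaZ) where
  adjoint x y := by
    rw [inner_collectiveOp]
    congr 3
    ext i j
    fin_cases i <;> fin_cases j <;> simp [sigmaMinus, sigmaPlus]
  symm x y := by
    rw [inner_collectiveOp]
    congr 3
    ext i j
    fin_cases i <;> fin_cases j <;> simp [sigmaZ]
  raise_lower x := by
    rw [collectiveOp_commutator]
    congr 3
    ext i j
    fin_cases i <;> fin_cases j <;> simp [sigmaMinus, sigmaPlus, sigmaZ]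
  weight_lower x := by
    rw [collectiveOp_commutator, sub_eq_add_neg (collectiveOp n sigmaMinus _), ← neg_smul, ← collectiveOp_smul]
    congr 3
    ext i j
    fin_cases i <;> fin_cases j <;> norm_num [sigmaMinus, sigmaZ_eq]
  weight_raise x := by
    rw [collectiveOp_commutator, ← collectiveOp_smul]
    congr 3
    ext i j
    fin_cases i <;> fin_cases j <;> norm_num [sigmaPlus, sigmaZ_eq]

/-! ### The rotation of the qubits -/

/-- The generator `i (v_x σ_x + v_y σ_y)`. -/
def qubitGenerator (v : ℝ × ℝ) : Matrix (Fin 2) (Fin 2) ℂ :=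
  Complex.I • ((v.1 : ℂ) • pauliX + (v.2 : ℂ) • pauliY)

/-- The complex amplitude `- u_y + i u_x`. -/
def amplitude (u : ℝ × ℝ) : ℂ := -(u.2 : ℂ) + Complex.I * u.1

/-- The same shape as z a^* - z̄ a, with σ_- in the role of the creation operator: lowering the spin
raises the ladder index k. This is where the amplitude - u_y + i u_x comes from. -/
theorem qubitGenerator_eq (v : ℝ × ℝ) :
    qubitGenerator v = amplitude v • sigmaMinus - conj (amplitude v) • sigmaPlus := by
  ext i j
  fin_cases i <;> fin_cases j <;>
    simp [qubitGenerator, amplitude, sigmaMinus, sigmaPlus, pauliX, pauliY]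
  all_goals
    ring_nf
    simp [sub_eq_add_neg]

theorem qubitGenerator_smul (t : ℝ) (v : ℝ × ℝ) : qubitGenerator (t • v) = t • qubitGenerator v := by
  ext i j
  simp [qubitGenerator]
  ring

theorem conjTranspose_qubitGenerator (v : ℝ × ℝ) :
    (qubitGenerator v).conjTranspose = -qubitGenerator v := by
  rw [qubitGenerator_eq]
  ext i j
  fin_cases i <;> fin_cases j <;> simp [sigmaMinus, sigmaPlus]

theorem qubitUnitary_smul (t : ℝ) (v : ℝ × ℝ) :
    qubitUnitary (t • v) = NormedSpace.exp (t • qubitGenerator v) := by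
  rw [← qubitGenerator_smul]
  rfl

theorem qubitUnitary_add_smul (s t : ℝ) (v : ℝ × ℝ) :
    qubitUnitary ((s + t) • v) = qubitUnitary (s • v) * qubitUnitary (t • v) := by
  rw [qubitUnitary_smul, qubitUnitary_smul, qubitUnitary_smul, add_smul, Matrix.exp_add_of_commute]
  exact ((Commute.refl (qubitGenerator v)).smul_left s).smul_right t

theorem qubitUnitary_zero_smul (v : ℝ × ℝ) : qubitUnitary ((0 : ℝ) • v) = 1 := by
  rw [qubitUnitary_smul, zero_smul, NormedSpace.exp_zero]

theorem conjTranspose_qubitUnitary_mul (v : ℝ × ℝ) :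
    (qubitUnitary v).conjTranspose * qubitUnitary v = 1 := by
  change (NormedSpace.exp (qubitGenerator v)).conjTranspose *
    NormedSpace.exp (qubitGenerator v) = 1
  rw [← Matrix.exp_conjTranspose, conjTranspose_qubitGenerator, ← Matrix.exp_add_of_commute,
    neg_add_cancel, NormedSpace.exp_zero]
  exact (Commute.refl _).neg_left

open scoped Matrix.Norms.Operator in
theorem hasDerivAt_qubitUnitary (v : ℝ × ℝ) (a b : Fin 2) :
    HasDerivAt (fun t : ℝ => qubitUnitary (t • v) a b) (qubitGenerator v a b) 0 := by
  have h := hasDerivAt_exp_smul_const (𝕂 := ℝ) (qubitGenerator v) (0 : ℝ)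
  rw [zero_smul, NormedSpace.exp_zero, one_mul] at h
  let Φ : Matrix (Fin 2) (Fin 2) ℂ →L[ℝ] ℂ :=
    LinearMap.toContinuousLinearMap (Matrix.entryLinearMap ℝ ℂ a b)
  have h2 := Φ.hasFDerivAt.comp_hasDerivAt (0 : ℝ) h
  refine h2.congr_of_eventuallyEq (Eventually.of_forall fun t => ?_)
  simp only [qubitUnitary_smul]
  rfl

/-- The rotation `U(v)^{⊗ n}`. -/
def rotation (v : ℝ × ℝ) : QubitSpace n →L[ℂ] QubitSpace n :=
  Matrix.toEuclideanCLM (𝕜 := ℂ) (tensorPower n (qubitUnitary v))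

theorem adjoint_rotation (v : ℝ × ℝ) : ContinuousLinearMap.adjoint (rotation n v) =
    Matrix.toEuclideanCLM (𝕜 := ℂ) (tensorPower n (qubitUnitary v).conjTranspose) := by
  rw [tensorPower_conjTranspose]
  exact (map_star (Matrix.toEuclideanCLM (𝕜 := ℂ) (n := Fin n → Fin 2)) _).symm

theorem norm_rotation_apply (v : ℝ × ℝ) (x : QubitSpace n) : ‖rotation n v x‖ = ‖x‖ := by
  have h : inner ℂ (rotation n v x) (rotation n v x) = inner ℂ x x := by
    rw [← ContinuousLinearMap.adjoint_inner_right, adjoint_rotation, rotation,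
      ← mul_apply_eq_comp, ← map_mul, ← tensorPower_mul, conjTranspose_qubitUnitary_mul,
      tensorPower_one, map_one]
    rfl
  rw [inner_self_eq_ofReal, inner_self_eq_ofReal] at h
  have h' : ‖rotation n v x‖ ^ 2 = ‖x‖ ^ 2 := by exact_mod_cast h
  exact (pow_left_inj₀ (norm_nonneg _) (norm_nonneg _) two_ne_zero).1 h'

theorem rotation_add_smul (s t : ℝ) (v : ℝ × ℝ) (x : QubitSpace n) :
    rotation n ((s + t) • v) x = rotation n (s • v) (rotation n (t • v) x) := by
  rw [rotation, qubitUnitary_add_smul, tensorPower_mul, map_mul, mul_apply_eq_comp]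
  rfl

theorem rotation_zero_smul (v : ℝ × ℝ) (x : QubitSpace n) : rotation n ((0 : ℝ) • v) x = x := by
  rw [rotation, qubitUnitary_zero_smul, tensorPower_one, map_one]
  rfl

theorem hasDerivAt_rotation_zero (v : ℝ × ℝ) (x : QubitSpace n) :
    HasDerivAt (fun t : ℝ => rotation n (t • v) x) (collectiveOp n (qubitGenerator v) x) 0 := by
  have h : HasDerivAt (fun t : ℝ => (tensorPower n (qubitUnitary (t • v))).mulVec x.ofLp)
      ((collective n (qubitGenerator v)).mulVec x.ofLp) 0 := by
    refine hasDerivAt_pi.2 fun i => ?_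
    simp only [Matrix.mulVec, dotProduct]
    exact HasDerivAt.fun_sum fun j _ => (hasDerivAt_tensorPower (qubitUnitary_zero_smul v)
      (hasDerivAt_qubitUnitary v) i j).mul_const _
  exact (PiLp.continuousLinearEquiv 2 ℝ fun _ : Fin n → Fin 2 => ℂ).symm.hasFDerivAt.comp_hasDerivAt
    (0 : ℝ) h

theorem hasDerivAt_rotation (v : ℝ × ℝ) (x : QubitSpace n) (t : ℝ) :
    HasDerivAt (fun t : ℝ => rotation n (t • v) x)
      (rotation n (t • v) (collectiveOp n (qubitGenerator v) x)) t := by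
  have h0 : HasDerivAt (fun s : ℝ => rotation n (s • v) x)
      (collectiveOp n (qubitGenerator v) x) (t - t) := by
    rw [sub_self]
    exact hasDerivAt_rotation_zero n v x
  have h1 : HasDerivAt (fun s : ℝ => rotation n ((s - t) • v) x)
      (collectiveOp n (qubitGenerator v) x) t := h0.comp_sub_const t t
  have h2 := ((rotation n (t • v)).restrictScalars ℝ).hasFDerivAt.comp_hasDerivAt t h1
  refine h2.congr_of_eventuallyEq (Eventually.of_forall fun s => ?_)
  change rotation n (s • v) _ = rotation n (t • v) (rotation n ((s - t) • v) _)
  rw [← rotation_add_smul, add_sub_cancel]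

/-- The qubit counterpart of `norm_displacement_sub_taylor_le`. Because d ≤ n, the rescaled
coefficients are at most √(m+1), so the same `ladderBound` applies to both. -/
theorem norm_rotation_sub_taylor_le {d : ℕ} {e : ℕ → QubitSpace n}
    (he : IsLadder (collectiveOp n sigmaMinus) (collectiveOp n sigmaPlus) (collectiveOp n sigmaZ)
      d e) (hd : d ≤ n) {A : ℝ} {u : ℝ × ℝ} (hu : ‖amplitude u‖ ≤ A) (k R : ℕ) :
    ‖rotation n ((√(n : ℝ))⁻¹ • u) (e k) - ∑ r ∈ Finset.range R, (r.factorial : ℝ)⁻¹ •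
      ladderIterate (amplitude u) (fun m => ladderCoeff d m * (√(n : ℝ))⁻¹) e r k‖ ≤
        ladderBound A R k / R.factorial := by
  set g : ℕ → ℝ := fun m => ladderCoeff d m * (√(n : ℝ))⁻¹ with hg
  set v := (√(n : ℝ))⁻¹ • u with hv
  have ha : amplitude v = ((√(n : ℝ))⁻¹ : ℝ) * amplitude u := by
    simp [hv, amplitude]
    ring
  have hX : ∀ x, collectiveOp n (qubitGenerator v) x =
      (amplitude u * ((√(n : ℝ))⁻¹ : ℝ)) • collectiveOp n sigmaMinus x -
        (conj (amplitude u) * ((√(n : ℝ))⁻¹ : ℝ)) • collectiveOp n sigmaPlus x := by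
    intro x
    rw [qubitGenerator_eq, collectiveOp_sub, collectiveOp_smul, collectiveOp_smul, ha, map_mul,
      Complex.conj_ofReal, mul_comm, mul_comm _ (conj (amplitude u))]
  have hG0 : (collectiveOp n (qubitGenerator v) : QubitSpace n →ₗ[ℂ] QubitSpace n) (e 0) =
      (amplitude u * g 0) • e 1 := by
    rw [ContinuousLinearMap.coe_coe, hX, he.lower, he.raise_zero, smul_zero, sub_zero, smul_smul, hg]
    congr 1
    push_cast
    ring
  have hGs : ∀ k, (collectiveOp n (qubitGenerator v) : QubitSpace n →ₗ[ℂ] QubitSpace n) (e (k + 1)) =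
      (amplitude u * g (k + 1)) • e (k + 2) - (conj (amplitude u) * g k) • e k := by
    intro k
    rw [ContinuousLinearMap.coe_coe, hX, he.lower, he.raise_succ, smul_smul, smul_smul, hg]
    congr 2 <;> push_cast <;> ring
  have hg0 : ∀ m, 0 ≤ g m := fun m =>
    mul_nonneg (Real.sqrt_nonneg _) (inv_nonneg.2 (Real.sqrt_nonneg _))
  have hg1 : ∀ m, g m ≤ √((m : ℝ) + 1) := by
    intro m
    -- For n = 0 the convention `0⁻¹ = 0` makes g vanish.
    rcases Nat.eq_zero_or_pos n with rfl | hn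
    · simp [hg]
    have hn' : (0 : ℝ) < n := by exact_mod_cast hn
    have hd' : (d : ℝ) ≤ n := by exact_mod_cast hd
    have hm : (0 : ℝ) ≤ m := by positivity
    rw [hg]
    simp only
    rw [← div_eq_mul_inv, div_le_iff₀ (Real.sqrt_pos.2 hn'), ← Real.sqrt_mul (by positivity),
      ladderCoeff]
    exact Real.sqrt_le_sqrt (mul_le_mul_of_nonneg_left (by linarith) (by positivity))
  have hF := norm_sub_taylor_le (F := fun r t =>
      rotation n ((t : ℝ) • v) (ladderIterate (amplitude u) g e r k))
    (fun r t => by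
      have := hasDerivAt_rotation n v (ladderIterate (amplitude u) g e r k) t
      rwa [← ContinuousLinearMap.coe_coe (collectiveOp n (qubitGenerator v)),
        apply_ladderIterate _ hG0 hGs] at this)
    (M := ladderBound A R k) R (fun t => by
      rw [norm_rotation_apply]
      exact norm_ladderIterate_le hu hg0 hg1 he.norm_le_one R k)
  simp only [rotation_zero_smul] at hF
  rw [one_smul] at hF
  exact hF

end Spin

/-! ### Weights of the irreducible components -/

section Weights

variable {n : ℕ}

/-- The number of ones of a bit string. -/
def ones (x : Fin n → Fin 2) : ℕ := ∑ k, (x k : ℕ)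

theorem siteMatrix_diagonal (k : Fin n) (f : Fin 2 → ℂ) :
    siteMatrix k (Matrix.diagonal f) = Matrix.diagonal fun x => f (x k) := by
  have h : Function.update (1 : Fin n → Matrix (Fin 2) (Fin 2) ℂ) k (Matrix.diagonal f) =
      fun l => Matrix.diagonal (if l = k then f else 1) := by
    ext1 l
    by_cases hl : l = k
    · subst hl
      simp
    · rw [Function.update_of_ne hl, if_neg hl]
      exact Matrix.diagonal_one.symm
  rw [siteMatrix, h, tensorMatrix_diagonal]
  congr 1
  ext1 x
  rw [Finset.prod_eq_single k]
  · simp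
  · intro l _ hl
    simp [hl]
  · simp

theorem toEuclideanCLM_diagonal_apply {κ : Type*} [Fintype κ] [DecidableEq κ] (f : κ → ℂ)
    (v : EuclideanSpace ℂ κ) (x : κ) :
    Matrix.toEuclideanCLM (𝕜 := ℂ) (Matrix.diagonal f) v x = f x * v x := by
  have : Matrix.toEuclideanCLM (𝕜 := ℂ) (Matrix.diagonal f) v x =
      (Matrix.diagonal f).mulVec v.ofLp x := rfl
  rw [this, Matrix.mulVec_diagonal]

theorem collectiveOp_sigmaZ_apply (v : QubitSpace n) (x : Fin n → Fin 2) :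
    collectiveOp n sigmaZ v x = ((n : ℂ) - 2 * ones x) * v x := by
  have h : collective n sigmaZ = Matrix.diagonal fun x => ((n : ℂ) - 2 * ones x) := by
    rw [collective_apply]
    simp only [sigmaZ, siteMatrix_diagonal]
    ext i j
    rw [Matrix.sum_apply]
    by_cases hij : i = j
    · subst hij
      simp only [Matrix.diagonal_apply_eq]
      have : ∀ b : Fin 2, (![1, -1] b : ℂ) = 1 - 2 * ((b : ℕ) : ℂ) := by
        intro b
        fin_cases b <;> norm_num
      simp only [this, Finset.sum_sub_distrib, ← Finset.mul_sum, ones]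
      simp
    · simp [Matrix.diagonal_apply_ne _ hij]
  rw [collectiveOp, h, toEuclideanCLM_diagonal_apply]

theorem prod_bit_weights {μ : ℝ} (hμ : μ ≠ 0) (x : Fin n → Fin 2) :
    ∏ k, (![μ, 1 - μ] (x k) : ℝ) = μ ^ n * ((1 - μ) / μ) ^ ones x := by
  have : ∀ b : Fin 2, (![μ, 1 - μ] b : ℝ) = μ * ((1 - μ) / μ) ^ (b : ℕ) := by
    intro b
    fin_cases b
    · simp
    · simp [mul_div_cancel₀ _ hμ]
  simp only [this, Finset.prod_mul_distrib, Finset.prod_pow_eq_pow_sum, ones]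
  simp

theorem tensorPower_state {μ : ℝ} (hμ : μ ≠ 0) :
    tensorPower n (Matrix.diagonal ![(μ : ℂ), 1 - (μ : ℂ)]) =
      Matrix.diagonal fun x => ((μ ^ n * ((1 - μ) / μ) ^ ones x : ℝ) : ℂ) := by
  rw [tensorPower_diagonal]
  congr 1
  ext1 x
  rw [← prod_bit_weights hμ, Complex.ofReal_prod]
  refine Finset.prod_congr rfl fun k _ => ?_
  generalize x k = b
  fin_cases b <;> simp

theorem sum_bit_weights {μ : ℝ} (hμ : μ ≠ 0) :
    ∑ x : Fin n → Fin 2, μ ^ n * ((1 - μ) / μ) ^ ones x = 1 := by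
  simp only [← prod_bit_weights hμ]
  have h := Finset.prod_univ_sum (fun _ : Fin n => (Finset.univ : Finset (Fin 2)))
    (fun _ b => (![μ, 1 - μ] b : ℝ))
  rw [Fintype.piFinset_univ] at h
  rw [← h]
  simp

/-- The variance of a sum of n independent centred variables: with bits distributed as (μ, 1-μ), the
values 2(1-μ) and -2μ have mean 0 and variance 4μ(1-μ). -/
theorem sum_bit_weights_mul_sq {μ : ℝ} (hμ : μ ≠ 0) :
    ∑ x : Fin n → Fin 2, μ ^ n * ((1 - μ) / μ) ^ ones x * (n - 2 * ones x - (2 * μ - 1) * n) ^ 2 =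
      n * (4 * μ * (1 - μ)) := by
  set t : Fin 2 → ℝ := ![2 * (1 - μ), -(2 * μ)] with ht
  set w : Fin 2 → ℝ := ![μ, 1 - μ] with hw
  have h1 : ∀ x : Fin n → Fin 2, (n : ℝ) - 2 * ones x - (2 * μ - 1) * n = ∑ k, t (x k) := by
    intro x
    have : ∀ b : Fin 2, t b = 2 * (1 - μ) - 2 * ((b : ℕ) : ℝ) := by
      intro b
      fin_cases b
      · simp [ht]
      · simp [ht]
        ring
    simp only [this, Finset.sum_sub_distrib, ← Finset.mul_sum, ones]
    simp
    ring
  have h2 : ∀ k l : Fin n, ∑ x : Fin n → Fin 2, (∏ j, w (x j)) * (t (x k) * t (x l)) =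
      if k = l then 4 * μ * (1 - μ) else 0 := by
    intro k l
    -- Indicators spread t(x k) t(x l) over all sites, so that the expectation factorises; for k ≠ l
    -- the factor at site k is the mean, which is 0.
    have e : ∀ x : Fin n → Fin 2, (∏ j, w (x j)) * (t (x k) * t (x l)) = ∏ j, (w (x j) *
        ((if j = k then t (x j) else 1) * (if j = l then t (x j) else 1))) := by
      intro x
      rw [Finset.prod_mul_distrib, Finset.prod_mul_distrib, Finset.prod_ite_eq' Finset.univ k,
        Finset.prod_ite_eq' Finset.univ l]
      simp
    have h := Finset.prod_univ_sum (fun _ : Fin n => (Finset.univ : Finset (Fin 2)))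
      (fun j b => w b * ((if j = k then t b else 1) * (if j = l then t b else 1)))
    rw [Fintype.piFinset_univ] at h
    simp only [e]
    rw [← h]
    split_ifs with hkl
    · subst hkl
      rw [Finset.prod_eq_single k]
      · simp [ht, hw]
        ring
      · intro j _ hj
        simp [hj, hw]
      · simp
    · refine Finset.prod_eq_zero (Finset.mem_univ k) ?_
      simp [hkl, ht, hw]
      ring
  have h3 : ∀ x : Fin n → Fin 2,
      μ ^ n * ((1 - μ) / μ) ^ ones x * (n - 2 * ones x - (2 * μ - 1) * n) ^ 2 =
        ∑ k, ∑ l, (∏ j, w (x j)) * (t (x k) * t (x l)) := by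
    intro x
    rw [h1, ← prod_bit_weights hμ, sq, Finset.sum_mul_sum, Finset.mul_sum]
    simp only [Finset.mul_sum]
    rfl
  simp only [h3]
  rw [Finset.sum_comm]
  simp only [Finset.sum_comm (s := (Finset.univ : Finset (Fin n → Fin 2))), h2]
  simp

theorem sum_bit_weights_mul_abs_le {μ : ℝ} (hμ0 : 0 < μ) (hμ1 : μ ≤ 1) (hn : 0 < n) :
    ∑ x : Fin n → Fin 2, μ ^ n * ((1 - μ) / μ) ^ ones x * |n - 2 * ones x - (2 * μ - 1) * n| ≤
      √n := by
  have hn' : (0 : ℝ) < n := by exact_mod_cast hn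
  set s := √(n : ℝ) with hs
  have hs0 : 0 < s := Real.sqrt_pos.2 hn'
  have hss : s * s = n := Real.mul_self_sqrt hn'.le
  have hp : 0 ≤ (1 - μ) / μ := div_nonneg (by linarith) hμ0.le
  have hle : ∀ x : Fin n → Fin 2,
      μ ^ n * ((1 - μ) / μ) ^ ones x * |n - 2 * ones x - (2 * μ - 1) * n| ≤
        (2 * s)⁻¹ * (μ ^ n * ((1 - μ) / μ) ^ ones x * (n - 2 * ones x - (2 * μ - 1) * n) ^ 2) +
          s / 2 * (μ ^ n * ((1 - μ) / μ) ^ ones x) := by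
    intro x
    set y : ℝ := n - 2 * ones x - (2 * μ - 1) * n
    -- Arithmetic–geometric mean at scale s = √n, which passes from the second moment, at most n, to
    -- a first moment of at most √n.
    have hy : |y| ≤ (2 * s)⁻¹ * y ^ 2 + s / 2 := by
      rw [← sq_abs y]
      have h1 : (2 * s)⁻¹ * |y| ^ 2 + s / 2 - |y| = (|y| - s) ^ 2 / (2 * s) := by
        field_simp
        ring
      have h2 : 0 ≤ (|y| - s) ^ 2 / (2 * s) := by positivity
      linarith
    calc _ ≤ μ ^ n * ((1 - μ) / μ) ^ ones x * ((2 * s)⁻¹ * y ^ 2 + s / 2) := by gcongr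
      _ = _ := by ring
  refine (Finset.sum_le_sum fun x _ => hle x).trans ?_
  rw [Finset.sum_add_distrib, ← Finset.mul_sum, ← Finset.mul_sum, sum_bit_weights hμ0.ne',
    sum_bit_weights_mul_sq hμ0.ne', ← hss]
  have h4 : 4 * μ * (1 - μ) ≤ 1 := by nlinarith [sq_nonneg (2 * μ - 1)]
  have h5 : (2 * s)⁻¹ * (s * s * (4 * μ * (1 - μ))) = s / 2 * (4 * μ * (1 - μ)) := by
    field_simp
  rw [h5]
  nlinarith

/-- Irreducible components of `(ℂ²)^{⊗ n}`. -/
abbrev IsQubitLadder (n d : ℕ) (e : ℕ → QubitSpace n) : Prop :=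
  IsLadder (collectiveOp n sigmaMinus) (collectiveOp n sigmaPlus) (collectiveOp n sigmaZ) d e

/-- Compares the weight d - 2k of e k with the diagonal entries n - 2 · (number of ones) of the
collective σ_z: e k lives on strings with one fixed number of ones. -/
theorem IsLadder.ones_eq {d : ℕ} {e : ℕ → QubitSpace n} (he : IsQubitLadder n d e) {k : ℕ}
    {x : Fin n → Fin 2} (hx : e k x ≠ 0) : d + 2 * ones x = n + 2 * k := by
  have h := collectiveOp_sigmaZ_apply (e k) x
  rw [he.weight] at h
  have h1 : ((d : ℂ) - 2 * k) * e k x = ((n : ℂ) - 2 * ones x) * e k x := h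
  have h2 := mul_right_cancel₀ hx h1
  have h3 : (d : ℂ) + 2 * ones x = n + 2 * k := by linear_combination h2
  exact_mod_cast h3

theorem IsLadder.exists_apply_ne_zero {d : ℕ} {e : ℕ → QubitSpace n} (he : IsQubitLadder n d e)
    {k : ℕ} (hk : k ≤ d) : ∃ x, e k x ≠ 0 := by
  by_contra! h
  have h0 : e k = 0 := by
    ext x
    exact h x
  have h1 := he.norm_eq_one hk
  rw [h0, norm_zero] at h1
  exact zero_ne_one h1

/-- Says that d ≤ n and that n - d is even, so that the truncated operations in (n - d) / 2 are
exact; read off from the support of e 0. -/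
theorem IsLadder.add_two_mul {d : ℕ} {e : ℕ → QubitSpace n} (he : IsQubitLadder n d e) :
    d + 2 * ((n - d) / 2) = n := by
  obtain ⟨x, hx⟩ := he.exists_apply_ne_zero (Nat.zero_le d)
  have := he.ones_eq hx
  omega

theorem IsLadder.ones_eq_add {d : ℕ} {e : ℕ → QubitSpace n} (he : IsQubitLadder n d e) {k : ℕ}
    {x : Fin n → Fin 2} (hx : e k x ≠ 0) : ones x = (n - d) / 2 + k := by
  have h1 := he.add_two_mul
  have h2 := he.ones_eq hx
  omega

/-- A decomposition of `(ℂ²)^{⊗ n}` into irreducible representations. -/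
abbrev IsQubitLadderBasis (n : ℕ) {ι : Type} [Fintype ι] (d : ι → ℕ) (e : ι → ℕ → QubitSpace n) :
    Prop :=
  IsLadderBasis (collectiveOp n sigmaMinus) (collectiveOp n sigmaPlus) (collectiveOp n sigmaZ) d e

variable {ι : Type} [Fintype ι] {d : ι → ℕ} {e : ι → ℕ → QubitSpace n}

/-- The trace of the diagonal operator F(number of ones), computed once in the product basis and
once in the ladder basis. It transfers the binomial statistics of the bits to the components. -/
theorem IsLadderBasis.sum_ones (hb : IsQubitLadderBasis n d e) (F : ℕ → ℝ) :
    ∑ x : Fin n → Fin 2, F (ones x) =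
      ∑ i, ∑ k ∈ Finset.range (d i + 1), F ((n - d i) / 2 + k) := by
  have h1 : ∀ x, ∑ i, ∑ k ∈ Finset.range (d i + 1), ‖e i k x‖ ^ 2 = 1 := by
    intro x
    have h := congrArg (fun v : QubitSpace n => v x) (hb.complete (EuclideanSpace.single x 1))
    simp only [WithLp.ofLp_sum, Finset.sum_apply, PiLp.smul_apply, EuclideanSpace.inner_single_right, smul_eq_mul,
      PiLp.single_apply, if_true, one_mul, Complex.conj_mul'] at h
    exact_mod_cast h
  have h2 : ∀ x, F (ones x) =
      ∑ i, ∑ k ∈ Finset.range (d i + 1), F ((n - d i) / 2 + k) * ‖e i k x‖ ^ 2 := by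
    intro x
    rw [← mul_one (F (ones x)), ← h1 x, Finset.mul_sum]
    refine Finset.sum_congr rfl fun i _ => ?_
    rw [Finset.mul_sum]
    refine Finset.sum_congr rfl fun k _ => ?_
    by_cases hx : e i k x = 0
    · simp [hx]
    · rw [(hb.ladder i).ones_eq_add hx]
  simp only [h2]
  rw [Finset.sum_comm]
  refine Finset.sum_congr rfl fun i _ => ?_
  rw [Finset.sum_comm]
  refine Finset.sum_congr rfl fun k hk => ?_
  have h3 := (hb.ladder i).norm_eq_one (Nat.lt_succ_iff.1 (Finset.mem_range.1 hk))
  rw [← Finset.mul_sum, ← EuclideanSpace.norm_sq_eq, h3]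
  simp

/-- The eigenvalue `λ` of the product state on the highest weight vector of a component. -/
def topWeight (μ : ℝ) (n d : ℕ) : ℝ := μ ^ n * ((1 - μ) / μ) ^ ((n - d) / 2)

/-- The probability of a component. -/
def componentProb (μ : ℝ) (n d : ℕ) : ℝ :=
  topWeight μ n d * ∑ k ∈ Finset.range (d + 1), ((1 - μ) / μ) ^ k

theorem topWeight_nonneg {μ : ℝ} (hμ0 : 0 < μ) (hμ1 : μ ≤ 1) (n d : ℕ) : 0 ≤ topWeight μ n d :=
  mul_nonneg (by positivity) (pow_nonneg (div_nonneg (by linarith) hμ0.le) _)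

theorem topWeight_le_componentProb {μ : ℝ} (hμ0 : 0 < μ) (hμ1 : μ ≤ 1) (n d : ℕ) :
    topWeight μ n d ≤ componentProb μ n d := by
  have hp : 0 ≤ (1 - μ) / μ := div_nonneg (by linarith) hμ0.le
  refine le_mul_of_one_le_right (topWeight_nonneg hμ0 hμ1 n d) ?_
  rw [Finset.sum_range_succ', pow_zero]
  have : 0 ≤ ∑ k ∈ Finset.range d, ((1 - μ) / μ) ^ (k + 1) := Finset.sum_nonneg fun k _ => by positivity
  linarith

theorem componentProb_nonneg {μ : ℝ} (hμ0 : 0 < μ) (hμ1 : μ ≤ 1) (n d : ℕ) :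
    0 ≤ componentProb μ n d :=
  (topWeight_nonneg hμ0 hμ1 n d).trans (topWeight_le_componentProb hμ0 hμ1 n d)

theorem IsLadderBasis.sum_componentProb (hb : IsQubitLadderBasis n d e) {μ : ℝ} (hμ : μ ≠ 0) :
    ∑ i, componentProb μ n (d i) = 1 := by
  rw [← sum_bit_weights (n := n) hμ, hb.sum_ones fun m => μ ^ n * ((1 - μ) / μ) ^ m]
  refine Finset.sum_congr rfl fun i _ => ?_
  rw [componentProb, topWeight, Finset.mul_sum]
  refine Finset.sum_congr rfl fun k _ => ?_
  rw [pow_add]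
  ring

/-- The spin of the components concentrates. -/
theorem IsLadderBasis.sum_topWeight_mul_abs_le (hb : IsQubitLadderBasis n d e) {μ : ℝ}
    (hμ0 : 1 / 2 < μ) (hμ1 : μ ≤ 1) (hn : 0 < n) :
    ∑ i, topWeight μ n (d i) * |d i - (2 * μ - 1) * n| ≤
      √n + 2 * ∑' k : ℕ, ((1 - μ) / μ) ^ k * k := by
  have hμ : 0 < μ := by linarith
  set p := (1 - μ) / μ with hp
  have hp0 : 0 ≤ p := div_nonneg (by linarith) hμ.le
  have hp1 : p < 1 := (div_lt_one hμ).2 (by linarith)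
  have hsum : Summable fun k : ℕ => p ^ k * (k : ℝ) := by
    have := summable_pow_mul_geometric_of_norm_lt_one 1
      (show ‖p‖ < 1 by rwa [Real.norm_of_nonneg hp0])
    refine this.congr fun k => ?_
    rw [pow_one, mul_comm]
  have hl0 : ∀ i, 0 ≤ topWeight μ n (d i) := fun i => topWeight_nonneg hμ hμ1 n _
  have h1 : ∀ i, topWeight μ n (d i) * |d i - (2 * μ - 1) * n| ≤
      ∑ k ∈ Finset.range (d i + 1), μ ^ n * p ^ ((n - d i) / 2 + k) *
        |n - 2 * (((n - d i) / 2 + k : ℕ) : ℝ) - (2 * μ - 1) * n| +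
      2 * (topWeight μ n (d i) * ∑' k : ℕ, p ^ k * k) := by
    intro i
    -- Adding the terms pᵏ for k ≥ 1 to p⁰ = 1 restores the full distribution on the component,
    -- which `sum_ones` can convert into a sum over bit strings.
    have ht : topWeight μ n (d i) * |d i - (2 * μ - 1) * n| ≤
        ∑ k ∈ Finset.range (d i + 1), topWeight μ n (d i) * (p ^ k * |d i - (2 * μ - 1) * n|) := by
      rw [← Finset.mul_sum]
      refine mul_le_mul_of_nonneg_left ?_ (hl0 i)
      rw [Finset.sum_range_succ', pow_zero, one_mul]
      have : 0 ≤ ∑ k ∈ Finset.range (d i), p ^ (k + 1) * |(d i : ℝ) - (2 * μ - 1) * n| :=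
        Finset.sum_nonneg fun k _ => by positivity
      linarith
    have hk : ∑ k ∈ Finset.range (d i + 1), p ^ k * (k : ℝ) ≤ ∑' k : ℕ, p ^ k * (k : ℝ) :=
      hsum.sum_le_tsum _ fun k _ => by positivity
    refine ht.trans ((Finset.sum_le_sum (g := fun k => μ ^ n * p ^ ((n - d i) / 2 + k) *
        |n - 2 * (((n - d i) / 2 + k : ℕ) : ℝ) - (2 * μ - 1) * n| +
          2 * (topWeight μ n (d i) * (p ^ k * k))) fun k _ => ?_).trans ?_)
    · have hd : (d i : ℝ) + 2 * (((n - d i) / 2 : ℕ) : ℝ) = n := by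
        exact_mod_cast (hb.ladder i).add_two_mul
      -- The weight d - 2k is the spin of the bit string; replacing it by d costs 2k, whose
      -- contribution is the convergent sum in the bound.
      have e1 : (d i : ℝ) - (2 * μ - 1) * n =
          (n - 2 * (((n - d i) / 2 + k : ℕ) : ℝ) - (2 * μ - 1) * n) + 2 * k := by
        push_cast
        linear_combination hd
      have e2 : |(d i : ℝ) - (2 * μ - 1) * n| ≤
          |n - 2 * (((n - d i) / 2 + k : ℕ) : ℝ) - (2 * μ - 1) * n| + 2 * k := by
        rw [e1]
        refine (abs_add_le _ _).trans (le_of_eq ?_)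
        rw [abs_of_nonneg (show (0 : ℝ) ≤ 2 * k by positivity)]
      refine (mul_le_mul_of_nonneg_left (mul_le_mul_of_nonneg_left e2 (pow_nonneg hp0 k))
        (hl0 i)).trans (le_of_eq ?_)
      rw [topWeight, pow_add, ← hp]
      ring
    · rw [Finset.sum_add_distrib, ← Finset.mul_sum, ← Finset.mul_sum]
      have := mul_le_mul_of_nonneg_left hk (hl0 i)
      linarith
  refine (Finset.sum_le_sum fun i _ => h1 i).trans ?_
  rw [Finset.sum_add_distrib, ← hb.sum_ones fun m =>
    μ ^ n * p ^ m * |n - 2 * (m : ℝ) - (2 * μ - 1) * n|]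
  refine add_le_add (sum_bit_weights_mul_abs_le hμ hμ1 hn) ?_
  rw [← Finset.mul_sum, ← Finset.sum_mul]
  have hle : ∑ i, topWeight μ n (d i) ≤ 1 := by
    rw [← hb.sum_componentProb hμ.ne']
    exact Finset.sum_le_sum fun i _ => topWeight_le_componentProb hμ hμ1 n _
  have := mul_le_mul_of_nonneg_right hle
    (show 0 ≤ ∑' k : ℕ, p ^ k * (k : ℝ) from tsum_nonneg fun k => by positivity)
  linarith

end Weights

open InnerProductSpace (rankOne rankOne_apply)

/-! ### Embedding the irreducible components into the oscillator -/

section Modes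

variable {H : Type*} [NormedAddCommGroup H] [InnerProductSpace ℂ H]
  {L R Z : H →L[ℂ] H} {d : ℕ} {e : ℕ → H}

/-- The partial isometry `e k ↦ |k⟩` for `k ≤ d`. -/
def modeMap (d : ℕ) (e : ℕ → H) : H →L[ℂ] L2R :=
  ∑ k ∈ Finset.range (d + 1), rankOne ℂ (numberState k) (e k)

theorem modeMap_apply (x : H) : modeMap d e x =
    ∑ k ∈ Finset.range (d + 1), inner ℂ (e k) x • numberState k := by
  simp [modeMap]

theorem IsLadder.modeMap_apply_of_le (he : IsLadder L R Z d e) {k : ℕ} (hk : k ≤ d) :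
    modeMap d e (e k) = numberState k := by
  rw [modeMap_apply, Finset.sum_eq_single k]
  · rw [he.orthonormal, if_pos ⟨rfl, hk⟩, one_smul]
  · intro l _ hl
    rw [he.orthonormal, if_neg (fun h => hl h.1), zero_smul]
  · intro h
    exact absurd (Finset.mem_range.2 (by omega)) h

variable [CompleteSpace H]

theorem adjoint_modeMap_apply (f : L2R) : ContinuousLinearMap.adjoint (modeMap d e) f =
    ∑ k ∈ Finset.range (d + 1), inner ℂ (numberState k) f • e k := by
  simp [modeMap, map_sum]

theorem adjoint_modeMap_numberState {k : ℕ} (hk : k ≤ d) :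
    ContinuousLinearMap.adjoint (modeMap d e) (numberState k) = e k := by
  rw [adjoint_modeMap_apply, Finset.sum_eq_single k]
  · rw [inner_self_eq_ofReal, norm_numberState]
    simp
  · intro l _ hl
    rw [orthonormal_numberState.2 hl, zero_smul]
  · intro h
    exact absurd (Finset.mem_range.2 (by omega)) h

theorem adjoint_modeMap_modeMap (x : H) :
    ContinuousLinearMap.adjoint (modeMap d e) (modeMap d e x) =
      ∑ k ∈ Finset.range (d + 1), inner ℂ (e k) x • e k := by
  rw [modeMap_apply, map_sum]
  refine Finset.sum_congr rfl fun k hk => ?_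
  rw [map_smul, adjoint_modeMap_numberState (Nat.lt_succ_iff.1 (Finset.mem_range.1 hk))]

theorem IsLadder.adjoint_modeMap_modeMap_self (he : IsLadder L R Z d e) (k : ℕ) :
    ContinuousLinearMap.adjoint (modeMap d e) (modeMap d e (e k)) = e k := by
  rw [adjoint_modeMap_modeMap, he.sum_inner_smul]

/-- With V = `modeMap` and y = V^* f, V is isometric on the span of the ladder, so ‖y‖² = ⟨V y, f⟩ ≤
‖y‖ ‖f‖. -/
theorem IsLadder.norm_adjoint_modeMap_apply_le (he : IsLadder L R Z d e) (f : L2R) :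
    ‖ContinuousLinearMap.adjoint (modeMap d e) f‖ ≤ ‖f‖ := by
  set y := ContinuousLinearMap.adjoint (modeMap d e) f with hy
  have h1 : ContinuousLinearMap.adjoint (modeMap d e) (modeMap d e y) = y := by
    have hy' := adjoint_modeMap_apply (d := d) (e := e) f
    rw [← hy] at hy'
    rw [hy']
    simp only [map_sum, map_smul, he.adjoint_modeMap_modeMap_self]
  have h2 : inner ℂ (modeMap d e y) (modeMap d e y) = inner ℂ y y := by
    rw [← ContinuousLinearMap.adjoint_inner_right, h1]
  have h3 : inner ℂ (modeMap d e y) f = inner ℂ y y := by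
    rw [← ContinuousLinearMap.adjoint_inner_right]
  have h4 : ‖modeMap d e y‖ = ‖y‖ := by
    rw [inner_self_eq_ofReal, inner_self_eq_ofReal] at h2
    have h2' : ‖modeMap d e y‖ ^ 2 = ‖y‖ ^ 2 := by exact_mod_cast h2
    exact (pow_left_inj₀ (norm_nonneg _) (norm_nonneg _) two_ne_zero).1 h2'
  have h5 := norm_inner_le_norm (𝕜 := ℂ) (modeMap d e y) f
  rw [h3, h4, inner_self_eq_ofReal, Complex.norm_real, Real.norm_of_nonneg (by positivity), sq] at h5
  rcases (norm_nonneg y).eq_or_lt with h0 | h0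
  · rw [← h0]
    exact norm_nonneg f
  · exact le_of_mul_le_mul_left h5 h0

theorem IsLadder.norm_modeMap_apply_le (he : IsLadder L R Z d e) (x : H) :
    ‖modeMap d e x‖ ≤ ‖x‖ := by
  have h1 : ‖ContinuousLinearMap.adjoint (modeMap d e)‖ ≤ 1 :=
    ContinuousLinearMap.opNorm_le_bound _ zero_le_one fun f => by
      rw [one_mul]
      exact he.norm_adjoint_modeMap_apply_le f
  rw [LinearIsometryEquiv.norm_map] at h1
  exact (modeMap d e).le_of_opNorm_le h1 x |>.trans (by rw [one_mul])

theorem trace_conj_adjoint_modeMap (he : IsLadder L R Z d e) (A : L2R →L[ℂ] L2R) :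
    trace (ContinuousLinearMap.adjoint (modeMap d e) ∘L A ∘L
        ContinuousLinearMap.adjoint (ContinuousLinearMap.adjoint (modeMap d e))) =
      ∑ k ∈ Finset.range (d + 1), inner ℂ (numberState k) (A (numberState k)) := by
  have h : ContinuousLinearMap.adjoint (modeMap d e) ∘L A ∘L
        ContinuousLinearMap.adjoint (ContinuousLinearMap.adjoint (modeMap d e)) =
      ∑ k ∈ Finset.range (d + 1),
        rankOne ℂ (ContinuousLinearMap.adjoint (modeMap d e) (A (numberState k))) (e k) := by
    ext1 x
    rw [ContinuousLinearMap.adjoint_adjoint]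
    simp [modeMap_apply]
  rw [h, trace_sum_rankOne]
  refine Finset.sum_congr rfl fun k hk => ?_
  rw [ContinuousLinearMap.adjoint_inner_right,
    he.modeMap_apply_of_le (Nat.lt_succ_iff.1 (Finset.mem_range.1 hk))]

end Modes

/-! ### The rotations converge to displacements -/

section Rotation

variable {n d : ℕ} {e : ℕ → QubitSpace n}

theorem IsLadder.le_card (he : IsQubitLadder n d e) : d ≤ n := by
  have := he.add_two_mul
  omega

/-- Rotations preserve the component: the Taylor sums of the orbit lie in the span of the ladder,
which V^* V fixes, and they converge to the rotated vector. -/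
theorem IsLadder.adjoint_modeMap_modeMap_rotation (he : IsQubitLadder n d e) (u : ℝ × ℝ) (k : ℕ) :
    ContinuousLinearMap.adjoint (modeMap d e) (modeMap d e (rotation n ((√(n : ℝ))⁻¹ • u) (e k))) =
      rotation n ((√(n : ℝ))⁻¹ • u) (e k) := by
  set P : QubitSpace n →L[ℂ] QubitSpace n :=
    ContinuousLinearMap.adjoint (modeMap d e) ∘L modeMap d e with hP
  have hPn : ∀ x, ‖P x‖ ≤ ‖x‖ := fun x =>
    (he.norm_adjoint_modeMap_apply_le _).trans (he.norm_modeMap_apply_le x)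
  set v := rotation n ((√(n : ℝ))⁻¹ • u) (e k) with hv
  change P v = v
  rw [← sub_eq_zero, ← norm_le_zero_iff]
  have hlim := (tendsto_ladderBound_div_factorial (norm_nonneg (amplitude u)) k).const_mul 2
  rw [mul_zero] at hlim
  refine ge_of_tendsto' hlim fun R => ?_
  have h := norm_rotation_sub_taylor_le n he he.le_card (le_refl ‖amplitude u‖) k R
  rw [← hv] at h
  set s := ∑ r ∈ Finset.range R, (r.factorial : ℝ)⁻¹ • ladderIterate (amplitude u)
    (fun m => ladderCoeff d m * (√(n : ℝ))⁻¹) e r k with hs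
  have hPs : P s = s := by
    rw [hs, map_sum]
    refine Finset.sum_congr rfl fun r _ => ?_
    rw [ContinuousLinearMap.map_smul_of_tower]
    congr 1
    have := map_ladderIterate (P : QubitSpace n →ₗ[ℂ] QubitSpace n) (amplitude u)
      (fun m => ladderCoeff d m * (√(n : ℝ))⁻¹) e r k
    refine this.trans ?_
    congr 1
    ext1 k
    exact he.adjoint_modeMap_modeMap_self k
  have e1 : P v - v = P (v - s) - (v - s) := by
    rw [map_sub, hPs]
    abel
  rw [e1]
  refine (norm_sub_le _ _).trans ?_
  linarith [hPn (v - s)]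

/-- Here x may be negative, with √x = 0; in the application x = (d - m)/n. -/
theorem abs_sqrt_sub_sqrt_le (x : ℝ) {y : ℝ} (hy : 0 ≤ y) : |√x - √y| ≤ √|x - y| := by
  refine Real.abs_le_sqrt ?_
  rcases le_total 0 x with hx | hx
  · have h1 := Real.mul_self_sqrt hx
    have h2 := Real.mul_self_sqrt hy
    have h3 := Real.sqrt_nonneg x
    have h4 := Real.sqrt_nonneg y
    rcases le_total y x with h | h
    · rw [abs_of_nonneg (sub_nonneg.2 h)]
      nlinarith [Real.sqrt_le_sqrt h]
    · rw [abs_of_nonpos (sub_nonpos.2 h)]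
      nlinarith [Real.sqrt_le_sqrt h]
  · rw [Real.sqrt_eq_zero_of_nonpos hx, zero_sub, neg_sq, Real.sq_sqrt hy,
      abs_of_nonpos (by linarith)]
    linarith

/-- Both coefficients carry the factor √(m+1), and what is left is √((d-m)/n) against √c. This
supplies the relative error η of `norm_ladderIterate_sub_le`. -/
theorem abs_ladderCoeff_sub_le {c δ : ℝ} (hc0 : 0 ≤ c) (hn : 0 < n)
    (hd : |(d : ℝ) - c * n| ≤ δ * n) {m N : ℕ} (hm : m ≤ N) :
    |ladderCoeff d m * (√(n : ℝ))⁻¹ - √c * √((m : ℝ) + 1)| ≤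
      √(δ + N / n) * √((m : ℝ) + 1) := by
  have hn' : (0 : ℝ) < n := by exact_mod_cast hn
  have hm' : (m : ℝ) ≤ N := by exact_mod_cast hm
  have h1 : ladderCoeff d m * (√(n : ℝ))⁻¹ = √(((d : ℝ) - m) / n) * √((m : ℝ) + 1) := by
    rw [ladderCoeff, Real.sqrt_mul (by positivity), Real.sqrt_div' _ hn'.le]
    ring
  rw [h1, ← sub_mul, abs_mul, abs_of_nonneg (Real.sqrt_nonneg ((m : ℝ) + 1))]
  refine mul_le_mul_of_nonneg_right ((abs_sqrt_sub_sqrt_le _ hc0).trans (Real.sqrt_le_sqrt ?_))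
    (Real.sqrt_nonneg _)
  have h2 : ((d : ℝ) - m) / n - c = ((d : ℝ) - c * n) / n - m / n := by
    field_simp
    ring
  rw [h2]
  refine (abs_sub _ _).trans ?_
  rw [abs_div, abs_of_pos hn', abs_of_nonneg (show (0 : ℝ) ≤ m / n by positivity)]
  refine add_le_add ((div_le_iff₀ hn').2 hd) ?_
  gcongr

/-- Two Taylor remainders of order R, one on each side, plus the difference of the two Taylor sums.
The condition k + R ≤ d guarantees that every e_l that occurs is mapped to |l⟩. -/
theorem IsLadder.norm_modeMap_rotation_sub_le (he : IsQubitLadder n d e) {A c δ : ℝ} {u : ℝ × ℝ}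
    (hu : ‖amplitude u‖ ≤ A) (hc0 : 0 ≤ c) (hc1 : c ≤ 1) (hn : 0 < n)
    (hd : |(d : ℝ) - c * n| ≤ δ * n) {k R : ℕ} (hkR : k + R ≤ d) :
    ‖modeMap d e (rotation n ((√(n : ℝ))⁻¹ • u) (e k)) -
        displacement (√c * amplitude u) (numberState k)‖ ≤
      2 * (ladderBound A R k / R.factorial) + √(δ + (k + R : ℕ) / n) *
        ∑ r ∈ Finset.range R, (r.factorial : ℝ)⁻¹ * (r * ladderBound A r k) := by
  have hn' : (0 : ℝ) < n := by exact_mod_cast hn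
  set g : ℕ → ℝ := fun m => ladderCoeff d m * (√(n : ℝ))⁻¹ with hg
  set h : ℕ → ℝ := fun m => √c * √((m : ℝ) + 1) with hh
  have hs1 : √c ≤ 1 := Real.sqrt_le_one.2 hc1
  have t1 := norm_rotation_sub_taylor_le n he he.le_card hu k R
  have t2 := norm_displacement_sub_taylor_le hu (Real.sqrt_nonneg c) hs1 k R
  have hg1 : ∀ m, g m ≤ √((m : ℝ) + 1) := by
    intro m
    have hd' : (d : ℝ) ≤ n := by exact_mod_cast he.le_card
    have hm : (0 : ℝ) ≤ m := by positivity
    rw [hg]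
    simp only
    rw [← div_eq_mul_inv, div_le_iff₀ (Real.sqrt_pos.2 hn'), ← Real.sqrt_mul (by positivity),
      ladderCoeff]
    exact Real.sqrt_le_sqrt (mul_le_mul_of_nonneg_left (by linarith) (by positivity))
  set v := rotation n ((√(n : ℝ))⁻¹ • u) (e k)
  set s := ∑ r ∈ Finset.range R, (r.factorial : ℝ)⁻¹ • ladderIterate (amplitude u) g e r k with hs
  set s' := ∑ r ∈ Finset.range R, (r.factorial : ℝ)⁻¹ •
    ladderIterate (amplitude u) h numberState r k with hs'
  have hVs : modeMap d e s = ∑ r ∈ Finset.range R, (r.factorial : ℝ)⁻¹ •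
      ladderIterate (amplitude u) g (fun k => modeMap d e (e k)) r k := by
    rw [hs, map_sum]
    refine Finset.sum_congr rfl fun r _ => ?_
    rw [ContinuousLinearMap.map_smul_of_tower]
    congr 1
    exact map_ladderIterate (modeMap d e : QubitSpace n →ₗ[ℂ] L2R) (amplitude u) g e r k
  have t3 : ‖modeMap d e s - s'‖ ≤ √(δ + (k + R : ℕ) / n) *
      ∑ r ∈ Finset.range R, (r.factorial : ℝ)⁻¹ * (r * ladderBound A r k) := by
    rw [hVs, hs', ← Finset.sum_sub_distrib, Finset.mul_sum]
    refine (norm_sum_le _ _).trans (Finset.sum_le_sum fun r hr => ?_)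
    rw [← smul_sub, norm_smul, Real.norm_of_nonneg (by positivity)]
    have hr' := Finset.mem_range.1 hr
    have t := norm_ladderIterate_sub_le (N := k + R) hu
      (g := g) (h := h) (x := fun k => modeMap d e (e k)) (y := numberState)
      (fun m => mul_nonneg (Real.sqrt_nonneg _) (inv_nonneg.2 (Real.sqrt_nonneg _))) hg1
      (fun m => mul_nonneg (Real.sqrt_nonneg _) (Real.sqrt_nonneg _))
      (fun m => mul_le_of_le_one_left (Real.sqrt_nonneg _) hs1)
      (fun k => (norm_numberState k).le) (fun l hl => he.modeMap_apply_of_le (hl.trans hkR))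
      (fun m hm => abs_ladderCoeff_sub_le hc0 hn hd hm) r k (by omega)
    refine (mul_le_mul_of_nonneg_left t (by positivity)).trans (le_of_eq ?_)
    ring
  have e1 : modeMap d e v - displacement (√c * amplitude u) (numberState k) =
      modeMap d e (v - s) + (modeMap d e s - s') -
        (displacement (√c * amplitude u) (numberState k) - s') := by
    rw [map_sub]
    abel
  rw [e1]
  refine (norm_sub_le _ _).trans ((add_le_add_left (norm_add_le _ _) _).trans ?_)
  have t4 := (he.norm_modeMap_apply_le (v - s)).trans t1
  linarith

/-- On the components whose spin is close to its typical value, the rotations are uniformly close to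
the displacements. -/
theorem exists_forall_norm_modeMap_rotation_sub_le {A c : ℝ} (hA : 0 ≤ A) (hc0 : 0 < c)
    (hc1 : c ≤ 1) (k : ℕ) {ε : ℝ} (hε : 0 < ε) : ∃ δ > 0, ∃ N : ℕ, ∀ n ≥ N, ∀ (d : ℕ)
      (e : ℕ → QubitSpace n), IsQubitLadder n d e → |(d : ℝ) - c * n| ≤ δ * n → ∀ u : ℝ × ℝ,
      ‖amplitude u‖ ≤ A → ‖modeMap d e (rotation n ((√(n : ℝ))⁻¹ • u) (e k)) -
        displacement (√c * amplitude u) (numberState k)‖ ≤ ε := by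
  -- The order R is fixed first, to make both remainders small; only then does the sum S become a
  -- constant, against which the coefficient error η is chosen.
  obtain ⟨R, hR⟩ := ((tendsto_ladderBound_div_factorial hA k).eventually
    (gt_mem_nhds (show 0 < ε / 4 by positivity))).exists
  set S := ∑ r ∈ Finset.range R, (r.factorial : ℝ)⁻¹ * (r * ladderBound A r k) with hS
  have hS0 : 0 ≤ S := Finset.sum_nonneg fun r _ =>
    mul_nonneg (by positivity) (mul_nonneg (by positivity) (ladderBound_nonneg hA r k))
  set η := ε / (2 * (S + 1)) with hη
  have hη0 : 0 < η := by positivity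
  -- η²/2 leaves room for both δ and (k+R)/n ≤ δ under the square root; c/2 forces d ≥ (c - δ) n ≥ δ
  -- n ≥ k + R.
  set δ := min (η ^ 2 / 2) (c / 2) with hδ
  have hδ0 : 0 < δ := lt_min (by positivity) (by positivity)
  obtain ⟨N, hN⟩ := exists_nat_gt ((k + R : ℕ) / δ)
  refine ⟨δ, hδ0, N + 1, fun n hn d e he hd u hu => ?_⟩
  have hn0 : 0 < n := by omega
  have hn' : (0 : ℝ) < n := by exact_mod_cast hn0
  have hNn : (N : ℝ) ≤ n := by exact_mod_cast (show N ≤ n by omega)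
  have h1 : ((k + R : ℕ) : ℝ) ≤ δ * n := by
    have := (div_lt_iff₀ hδ0).1 (hN.trans_le hNn)
    linarith
  have h2 : k + R ≤ d := by
    have h3 := (abs_le.1 hd).1
    have h4 : δ ≤ c / 2 := min_le_right _ _
    have : ((k + R : ℕ) : ℝ) ≤ d := by nlinarith
    exact_mod_cast this
  refine (he.norm_modeMap_rotation_sub_le hu hc0.le hc1 hn0 hd h2).trans ?_
  have h5 : √(δ + (k + R : ℕ) / n) ≤ η := by
    refine Real.sqrt_le_iff.2 ⟨hη0.le, ?_⟩
    have h6 : ((k + R : ℕ) : ℝ) / n ≤ δ := (div_le_iff₀ hn').2 h1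
    have h7 : δ ≤ η ^ 2 / 2 := min_le_left _ _
    linarith
  have h8 : η * S ≤ ε / 2 := by
    rw [hη, div_mul_eq_mul_div, div_le_div_iff₀ (by positivity) (by positivity)]
    nlinarith
  have h9 := mul_le_mul_of_nonneg_right h5 hS0
  linarith

theorem exists_forall_lt_norm_modeMap_rotation_sub_le {A c : ℝ} (hA : 0 ≤ A) (hc0 : 0 < c)
    (hc1 : c ≤ 1) {ε : ℝ} (hε : 0 < ε) (K : ℕ) : ∃ δ > 0, ∃ N : ℕ, ∀ n ≥ N, ∀ (d : ℕ)
      (e : ℕ → QubitSpace n), IsQubitLadder n d e → |(d : ℝ) - c * n| ≤ δ * n → ∀ u : ℝ × ℝ,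
      ‖amplitude u‖ ≤ A → ∀ k < K, ‖modeMap d e (rotation n ((√(n : ℝ))⁻¹ • u) (e k)) -
        displacement (√c * amplitude u) (numberState k)‖ ≤ ε := by
  induction K with
  | zero => exact ⟨1, one_pos, 0, fun _ _ _ _ _ _ _ _ k hk => absurd hk (Nat.not_lt_zero k)⟩
  | succ K ih =>
    obtain ⟨δ₁, hδ₁, N₁, h₁⟩ := ih
    obtain ⟨δ₂, hδ₂, N₂, h₂⟩ := exists_forall_norm_modeMap_rotation_sub_le hA hc0 hc1 K hε
    refine ⟨min δ₁ δ₂, lt_min hδ₁ hδ₂, max N₁ N₂, fun n hn d e he hd u hu k hk => ?_⟩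
    have hn0 : (0 : ℝ) ≤ n := n.cast_nonneg
    rcases Nat.lt_succ_iff_lt_or_eq.1 hk with hk | rfl
    · exact h₁ n ((le_max_left _ _).trans hn) d e he
        (hd.trans (mul_le_mul_of_nonneg_right (min_le_left _ _) hn0)) u hu k hk
    · exact h₂ n ((le_max_right _ _).trans hn) d e he
        (hd.trans (mul_le_mul_of_nonneg_right (min_le_right _ _) hn0)) u hu

/-- The error of a component in the comparison of the qubits with the oscillator. -/
def componentError (p c : ℝ) (n d : ℕ) (e : ℕ → QubitSpace n) (u : ℝ × ℝ) : ℝ :=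
  ∑' k, p ^ k * (2 * ‖modeMap d e (rotation n ((√(n : ℝ))⁻¹ • u) (e k)) -
    displacement (√c * amplitude u) (numberState k)‖ + p ^ (d + 1))

theorem IsLadder.norm_modeMap_rotation_le_one (he : IsQubitLadder n d e) (v : ℝ × ℝ) (k : ℕ) :
    ‖modeMap d e (rotation n v (e k))‖ ≤ 1 :=
  (he.norm_modeMap_apply_le _).trans ((norm_rotation_apply n _ _).trans_le (he.norm_le_one k))

theorem IsLadder.norm_modeMap_rotation_sub_le_two (he : IsQubitLadder n d e) (v : ℝ × ℝ) (z : ℂ)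
    (k : ℕ) : ‖modeMap d e (rotation n v (e k)) - displacement z (numberState k)‖ ≤ 2 := by
  refine (norm_sub_le _ _).trans ?_
  rw [LinearIsometry.norm_map, norm_numberState]
  linarith [he.norm_modeMap_rotation_le_one v k]

theorem IsLadder.summable_componentError (he : IsQubitLadder n d e) {p : ℝ} (hp0 : 0 ≤ p)
    (hp1 : p < 1) (c : ℝ) (u : ℝ × ℝ) :
    Summable fun k => p ^ k * (2 * ‖modeMap d e (rotation n ((√(n : ℝ))⁻¹ • u) (e k)) -
      displacement (√c * amplitude u) (numberState k)‖ + p ^ (d + 1)) := by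
  refine summable_geometric_mul hp0 hp1 (M := 4 + p ^ (d + 1)) (fun k => by positivity) fun k => ?_
  linarith [he.norm_modeMap_rotation_sub_le_two ((√(n : ℝ))⁻¹ • u) (√c * amplitude u) k]

theorem IsLadder.componentError_nonneg (p c : ℝ) (hp0 : 0 ≤ p) (u : ℝ × ℝ) :
    0 ≤ componentError p c n d e u := tsum_nonneg fun k => by positivity

/-- Terms with k < K use ε; the others use the trivial bound 2 on the distance, twice, and leave the
geometric tail 4 p^K / (1 - p). -/
theorem IsLadder.componentError_le_sum_add (he : IsQubitLadder n d e) {p : ℝ} (hp0 : 0 ≤ p)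
    (hp1 : p < 1) (c : ℝ) (u : ℝ × ℝ) {ε : ℝ} (hε : 0 ≤ ε) {K : ℕ}
    (hK : ∀ k < K, ‖modeMap d e (rotation n ((√(n : ℝ))⁻¹ • u) (e k)) -
        displacement (√c * amplitude u) (numberState k)‖ ≤ ε) :
    componentError p c n d e u ≤ (2 * ε + p ^ (d + 1) + 4 * p ^ K) / (1 - p) := by
  have hs := he.summable_componentError hp0 hp1 c u
  have hgeo := summable_geometric_of_lt_one hp0 hp1
  have hsh : ∀ k, p ^ k * (2 * ‖modeMap d e (rotation n ((√(n : ℝ))⁻¹ • u) (e k)) -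
      displacement (√c * amplitude u) (numberState k)‖ + p ^ (d + 1)) ≤
        p ^ k * (2 * ε + p ^ (d + 1)) + (if k < K then 0 else p ^ k * 4) := by
    intro k
    split_ifs with hk
    · have := hK k hk
      rw [add_zero]
      gcongr
    · have := he.norm_modeMap_rotation_sub_le_two ((√(n : ℝ))⁻¹ • u) (√c * amplitude u) k
      rw [← mul_add]
      refine mul_le_mul_of_nonneg_left ?_ (by positivity)
      linarith
  have hs2 : HasSum (fun k => if k < K then 0 else p ^ k * 4) ((1 - p)⁻¹ * (p ^ K * 4)) := by
    rw [← hasSum_nat_add_iff' K, Finset.sum_eq_zero (fun k hk => if_pos (Finset.mem_range.1 hk)),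
      sub_zero]
    refine ((hasSum_geometric_of_lt_one hp0 hp1).mul_right (p ^ K * 4)).congr_fun ?_
    intro k
    rw [if_neg (by omega), pow_add]
    ring
  refine (hasSum_le hsh hs.hasSum
    (((hasSum_geometric_of_lt_one hp0 hp1).mul_right (2 * ε + p ^ (d + 1))).add hs2)).trans
    (le_of_eq ?_)
  rw [div_eq_inv_mul]
  ring

end Rotation

/-! ### The total error over all components tends to zero. -/

section TotalError

/-- The error in the comparison of the qubits with the oscillator. -/
def totalError (μ : ℝ) (n : ℕ) {ι : Type} [Fintype ι] (d : ι → ℕ) (e : ι → ℕ → QubitSpace n)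
    (u : ℝ × ℝ) : ℝ :=
  ∑ i, topWeight μ n (d i) * componentError ((1 - μ) / μ) (2 * μ - 1) n (d i) (e i) u

/-- On components with |d - c n| ≤ δ n the error is at most ε/2. On the others it is bounded by a
constant, and their weight is small by Markov's inequality, since the first moment of |d - c n| is
O(√n). -/
theorem exists_forall_totalError_le {μ : ℝ} (hμ0 : 1 / 2 < μ) (hμ1 : μ ≤ 1) {A : ℝ} (hA : 0 ≤ A)
    {ε : ℝ} (hε : 0 < ε) : ∃ N : ℕ, ∀ n ≥ N, ∀ (ι : Type) [Fintype ι] (d : ι → ℕ)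
      (e : ι → ℕ → QubitSpace n), IsQubitLadderBasis n d e → ∀ u : ℝ × ℝ, ‖amplitude u‖ ≤ A →
      totalError μ n d e u ≤ ε := by
  have hμ : 0 < μ := by linarith
  unfold totalError
  set p := (1 - μ) / μ with hp
  set c := 2 * μ - 1 with hc
  have hp0 : 0 ≤ p := div_nonneg (by linarith) hμ.le
  have hp1 : p < 1 := (div_lt_one hμ).2 (by linarith)
  have hc0 : 0 < c := by rw [hc]; linarith
  have hc1 : c ≤ 1 := by rw [hc]; linarith
  have hq : 0 < 1 - p := by linarith
  have hpow : ∀ η > 0, ∃ K : ℕ, p ^ K < η := fun η hη => exists_pow_lt_of_lt_one hη hp1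
  -- The three sources in `componentError_le_sum_add`, namely 4 p^K, p^(d+1) and twice the distance,
  -- each contribute at most ε/8 after division by 1 - p.
  obtain ⟨K, hK⟩ := hpow (ε * (1 - p) / 32) (by positivity)
  obtain ⟨D, hD⟩ := hpow (ε * (1 - p) / 8) (by positivity)
  obtain ⟨δ₀, hδ₀, N₀, h₀⟩ := exists_forall_lt_norm_modeMap_rotation_sub_le hA hc0 hc1
    (show 0 < ε * (1 - p) / 16 by positivity) K
  set δ := min δ₀ (c / 2) with hδ
  have hδ0 : 0 < δ := lt_min hδ₀ (by positivity)
  -- The bound of `componentError_le_sum_add` with K = 0 and ε = 0, where the numerator is p^(d+1) +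
  -- 4 ≤ 5.
  set B := 5 / (1 - p) with hB
  have hB0 : 0 < B := by positivity
  set C := 2 * ∑' k : ℕ, p ^ k * (k : ℝ) with hC
  have hC0 : 0 ≤ C := mul_nonneg two_pos.le (tsum_nonneg fun k => by positivity)
  -- Makes B/(δ n) times the first moment, at most (1 + C) √n, no larger than ε/2.
  obtain ⟨N₁, hN₁⟩ := exists_nat_gt ((2 * B * (1 + C) / (δ * ε)) ^ 2)
  -- On typical components d ≥ c n / 2, so this forces d ≥ D.
  obtain ⟨N₂, hN₂⟩ := exists_nat_gt (2 * D / c)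
  refine ⟨N₀ + N₁ + N₂ + 1, fun n hn ι _ d e hb u hu => ?_⟩
  have hn0 : 0 < n := by omega
  have hn' : (0 : ℝ) < n := by exact_mod_cast hn0
  have hgood : ∀ i, |(d i : ℝ) - c * n| ≤ δ * n → componentError p c n (d i) (e i) u ≤ ε / 2 := by
    intro i hi
    have h1 := h₀ n (by omega) (d i) (e i) (hb.ladder i)
      (hi.trans (mul_le_mul_of_nonneg_right (min_le_left _ _) hn'.le)) u hu
    have h2 := (hb.ladder i).componentError_le_sum_add hp0 hp1 c u (by positivity) h1
    have h3 : D ≤ d i + 1 := by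
      have h4 := (abs_le.1 hi).1
      have h5 : δ ≤ c / 2 := min_le_right _ _
      have h6 : (N₂ : ℝ) ≤ n := by exact_mod_cast (show N₂ ≤ n by omega)
      have h7 : 2 * (D : ℝ) < n * c := (div_lt_iff₀ hc0).1 (hN₂.trans_le h6)
      have h8 : (D : ℝ) ≤ d i := by nlinarith
      have : D ≤ d i := by exact_mod_cast h8
      omega
    have h9 : p ^ (d i + 1) ≤ p ^ D := pow_le_pow_of_le_one hp0 hp1.le h3
    refine h2.trans ((div_le_iff₀ hq).2 ?_)
    nlinarith
  have hbad : ∀ i, componentError p c n (d i) (e i) u ≤ B := by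
    intro i
    have h2 := (hb.ladder i).componentError_le_sum_add hp0 hp1 c u le_rfl (K := 0)
      (fun k hk => absurd hk (Nat.not_lt_zero k))
    refine h2.trans ?_
    rw [hB]
    have h3 : p ^ (d i + 1) ≤ 1 := pow_le_one₀ hp0 hp1.le
    refine div_le_div_of_nonneg_right ?_ hq.le
    rw [pow_zero]
    linarith
  -- Pointwise Markov: on an atypical component the second summand already exceeds B.
  have hall : ∀ i, componentError p c n (d i) (e i) u ≤
      ε / 2 + B / (δ * n) * |(d i : ℝ) - c * n| := by
    intro i
    rcases le_or_gt |(d i : ℝ) - c * n| (δ * n) with hi | hi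
    · have : 0 ≤ B / (δ * n) * |(d i : ℝ) - c * n| := by positivity
      linarith [hgood i hi]
    · have h1 : B ≤ B / (δ * n) * |(d i : ℝ) - c * n| := by
        rw [div_mul_eq_mul_div, le_div_iff₀ (by positivity)]
        exact mul_le_mul_of_nonneg_left hi.le hB0.le
      linarith [hbad i]
  have hl0 : ∀ i, 0 ≤ topWeight μ n (d i) := fun i => topWeight_nonneg hμ hμ1 n _
  have hl1 : ∑ i, topWeight μ n (d i) ≤ 1 := by
    rw [← hb.sum_componentProb hμ.ne']
    exact Finset.sum_le_sum fun i _ => topWeight_le_componentProb hμ hμ1 n _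
  refine (Finset.sum_le_sum fun i _ => mul_le_mul_of_nonneg_left (hall i) (hl0 i)).trans ?_
  have e1 : ∑ i, topWeight μ n (d i) * (ε / 2 + B / (δ * n) * |(d i : ℝ) - c * n|) =
      ε / 2 * ∑ i, topWeight μ n (d i) +
        B / (δ * n) * ∑ i, topWeight μ n (d i) * |(d i : ℝ) - c * n| := by
    rw [Finset.mul_sum, Finset.mul_sum, ← Finset.sum_add_distrib]
    exact Finset.sum_congr rfl fun i _ => by ring
  rw [e1]
  have hconc := hb.sum_topWeight_mul_abs_le hμ0 hμ1 hn0
  rw [← hp, ← hC, ← hc] at hconc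
  set s := √(n : ℝ) with hs
  have hss : s * s = n := Real.mul_self_sqrt hn'.le
  have hs1 : 1 ≤ s := Real.one_le_sqrt.2 (by exact_mod_cast hn0)
  have hsN : 2 * B * (1 + C) / (δ * ε) ≤ s := by
    refine Real.le_sqrt_of_sq_le (hN₁.le.trans ?_)
    exact_mod_cast (show N₁ ≤ n by omega)
  have h1 : B / (δ * n) * ∑ i, topWeight μ n (d i) * |(d i : ℝ) - c * n| ≤ ε / 2 := by
    have h2 : ∑ i, topWeight μ n (d i) * |(d i : ℝ) - c * n| ≤ (1 + C) * s := by nlinarith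
    refine (mul_le_mul_of_nonneg_left h2 (by positivity)).trans ?_
    rw [div_le_iff₀ (by positivity)] at hsN
    rw [div_mul_eq_mul_div, div_le_iff₀ (by positivity), ← hss]
    nlinarith
  have h2 := mul_le_mul_of_nonneg_left hl1 (show 0 ≤ ε / 2 by positivity)
  linarith

end TotalError

/-! ### Both states as sums of geometric mixtures over the components. -/

section States

variable {n : ℕ} {ι : Type} [Fintype ι] {d : ι → ℕ} {e : ι → ℕ → QubitSpace n}

theorem IsLadder.geometricMixture_apply {H : Type*} [NormedAddCommGroup H] [InnerProductSpace ℂ H]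
    {L R Z : H →L[ℂ] H} {d : ℕ} {e : ℕ → H} (he : IsLadder L R Z d e) (p : ℝ) (y : H) :
    geometricMixture p e y =
      ∑ k ∈ Finset.range (d + 1), (p : ℂ) ^ k • inner ℂ (e k) y • e k := by
  rw [geometricMixture, tsum_eq_sum (s := Finset.range (d + 1)) fun k hk => by
    rw [he.eq_zero (by simpa using hk)]
    simp]
  simp

theorem IsLadder.tensorPower_state_apply {d : ℕ} {e : ℕ → QubitSpace n} (he : IsQubitLadder n d e)
    {μ : ℝ} (hμ : μ ≠ 0) (k : ℕ) :
    Matrix.toEuclideanCLM (𝕜 := ℂ) (tensorPower n (Matrix.diagonal ![(μ : ℂ), 1 - (μ : ℂ)])) (e k) =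
      ((topWeight μ n d : ℝ) : ℂ) • (((1 - μ) / μ : ℝ) : ℂ) ^ k • e k := by
  ext x
  rw [tensorPower_state hμ, toEuclideanCLM_diagonal_apply, PiLp.smul_apply, PiLp.smul_apply]
  by_cases hx : e k x = 0
  · simp [hx]
  · rw [he.ones_eq_add hx, topWeight, pow_add]
    simp only [smul_eq_mul]
    push_cast
    ring

/-- The state is a function of the number of ones, hence scalar on each e i k; completeness of the
ladders determines the operator. -/
theorem IsLadderBasis.tensorPower_state_eq (hb : IsQubitLadderBasis n d e) {μ : ℝ} (hμ : μ ≠ 0) :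
    Matrix.toEuclideanCLM (𝕜 := ℂ) (tensorPower n (Matrix.diagonal ![(μ : ℂ), 1 - (μ : ℂ)])) =
      ∑ i, (topWeight μ n (d i) : ℂ) • geometricMixture ((1 - μ) / μ) (e i) := by
  ext1 y
  conv_lhs => rw [← hb.complete y]
  rw [map_sum, _root_.sum_apply]
  refine Finset.sum_congr rfl fun i _ => ?_
  rw [_root_.smul_apply, (hb.ladder i).geometricMixture_apply, map_sum, Finset.smul_sum]
  refine Finset.sum_congr rfl fun k _ => ?_
  rw [map_smul, (hb.ladder i).tensorPower_state_apply hμ, smul_comm]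
  congr 1
  rw [smul_comm]

theorem IsLadderBasis.coe_qubitState (hb : IsQubitLadderBasis n d e) {μ : ℝ} (hμ0 : 1 / 2 < μ)
    (hμ1 : μ ≤ 1) (u : ℝ × ℝ) : (qubitState μ n u : QubitSpace n →L[ℂ] QubitSpace n) =
      ∑ i, (topWeight μ n (d i) : ℂ) •
        geometricMixture ((1 - μ) / μ) fun k => rotation n ((√(n : ℝ))⁻¹ • u) (e i k) := by
  have hμ : 0 < μ := by linarith
  have hp0 : 0 ≤ (1 - μ) / μ := div_nonneg (by linarith) hμ.le
  have hp1 : (1 - μ) / μ < 1 := (div_lt_one hμ).2 (by linarith)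
  have h : (qubitState μ n u : QubitSpace n →L[ℂ] QubitSpace n) =
      rotation n ((√(n : ℝ))⁻¹ • u) ∘L Matrix.toEuclideanCLM (𝕜 := ℂ)
        (tensorPower n (Matrix.diagonal ![(μ : ℂ), 1 - (μ : ℂ)])) ∘L
          ContinuousLinearMap.adjoint (rotation n ((√(n : ℝ))⁻¹ • u)) := by
    rw [adjoint_rotation, rotation, ← ContinuousLinearMap.mul_def, ← ContinuousLinearMap.mul_def,
      ← map_mul, ← map_mul, ← tensorPower_mul, ← tensorPower_mul, ← mul_assoc]
    rfl
  rw [h, hb.tensorPower_state_eq hμ.ne', comp_sum_smul_comp]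
  refine Finset.sum_congr rfl fun i _ => ?_
  rw [conj_geometricMixture hp0 hp1 (hb.ladder i).norm_le_one]

/-- The oscillator state is split artificially with the weights `componentProb`, which sum to 1, so
that it can be compared with the qubit state component by component. -/
theorem IsLadderBasis.coe_oscillatorState (hb : IsQubitLadderBasis n d e) {μ : ℝ}
    (hμ : 1 / 2 < μ ∧ μ ≤ 1) (u : ℝ × ℝ) : (oscillatorState μ hμ u : L2R →L[ℂ] L2R) =
      ∑ i, (componentProb μ n (d i) : ℂ) • (1 - (((1 - μ) / μ : ℝ) : ℂ)) •
        geometricMixture ((1 - μ) / μ) fun k =>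
          displacement (√(2 * μ - 1) * amplitude u) (numberState k) := by
  have hμ0 : 0 < μ := by linarith [hμ.1]
  have hp0 : 0 ≤ (1 - μ) / μ := div_nonneg (by linarith [hμ.2]) hμ0.le
  have hp1 : (1 - μ) / μ < 1 := (div_lt_one hμ0).2 (by linarith [hμ.1])
  have h1 : ∑ i, (componentProb μ n (d i) : ℂ) = 1 := by
    exact_mod_cast hb.sum_componentProb hμ0.ne'
  rw [← Finset.sum_smul, h1, one_smul]
  have h := conj_geometricMixture hp0 hp1 (fun k => (norm_numberState k).le)
    (displacement (√(2 * μ - 1) * amplitude u)).toContinuousLinearMap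
  have h2 : (fun k => displacement (√(2 * μ - 1) * amplitude u) (numberState k)) =
      fun k => (displacement (√(2 * μ - 1) * amplitude u)).toContinuousLinearMap
        (numberState k) := rfl
  rw [h2, ← h]
  ext1 x
  simp [oscillatorState, displacedThermalOp, thermalOp, geometricMixture, amplitude]

end States

/-! ### The two channels and their errors. -/

section Channels

variable {n : ℕ} {ι : Type} [Fintype ι] {d : ι → ℕ} {e : ι → ℕ → QubitSpace n}

/-- The channel that maps the qubits to the oscillator. -/
def qubitsToOscillator {n : ℕ} {ι : Type} [Fintype ι] (d : ι → ℕ) (e : ι → ℕ → QubitSpace n) :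
    TraceClass (QubitSpace n) →ₗ[ℂ] TraceClass L2R :=
  ∑ i, conjMap (modeMap (d i) (e i)) fun A _ => conj_mem_traceClass _ A

/-- The trace-nonincreasing part of the map from the oscillator to the qubits. -/
def compression (μ : ℝ) {n : ℕ} {ι : Type} [Fintype ι] (d : ι → ℕ) (e : ι → ℕ → QubitSpace n) :
    TraceClass L2R →ₗ[ℂ] TraceClass (QubitSpace n) :=
  ∑ i, (componentProb μ n (d i) : ℂ) •
    conjMap (ContinuousLinearMap.adjoint (modeMap (d i) (e i)))
      fun _ _ => mem_traceClass_of_finiteDimensional _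

/-- The vector `|0 ⋯ 0⟩`. -/
def groundVector (n : ℕ) : QubitSpace n := EuclideanSpace.single 0 1

theorem traceLinear_groundVector : traceLinear (QubitSpace n)
    ⟨rankOne ℂ (groundVector n) (groundVector n), rankOne_mem_traceClass _ _⟩ = 1 := by
  refine (trace_rankOne (groundVector n) (groundVector n)).trans ?_
  simp [groundVector]

/-- The channel that maps the oscillator to the qubits. -/
def oscillatorToQubits (μ : ℝ) {n : ℕ} {ι : Type} [Fintype ι] (d : ι → ℕ)
    (e : ι → ℕ → QubitSpace n) : TraceClass L2R →ₗ[ℂ] TraceClass (QubitSpace n) :=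
  compression μ d e +
    (traceLinear L2R - traceLinear (QubitSpace n) ∘ₗ compression μ d e).smulRight
      (⟨rankOne ℂ (groundVector n) (groundVector n), rankOne_mem_traceClass _ _⟩ :
        TraceClass (QubitSpace n))

theorem IsLadderBasis.isChannel_qubitsToOscillator (hb : IsQubitLadderBasis n d e) :
    IsChannel (qubitsToOscillator d e) := by
  refine ⟨IsCompletelyPositive.sum fun i => isCompletelyPositive_conjMap _ _,
    isTracePreserving_sum_conjMap _ _ fun x => ?_⟩
  simp only [adjoint_modeMap_modeMap]
  exact hb.complete x

theorem IsLadderBasis.traceLinear_compression (hb : IsQubitLadderBasis n d e) (μ : ℝ)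
    (A : TraceClass L2R) : traceLinear (QubitSpace n) (compression μ d e A) =
      ∑ i, (componentProb μ n (d i) : ℂ) * ∑ k ∈ Finset.range (d i + 1),
        inner ℂ (numberState k) ((A : L2R →L[ℂ] L2R) (numberState k)) := by
  rw [compression, LinearMap.sum_apply, map_sum]
  refine Finset.sum_congr rfl fun i _ => ?_
  rw [LinearMap.smul_apply, map_smul, traceLinear_apply, coe_conjMap,
    trace_conj_adjoint_modeMap (hb.ladder i), smul_eq_mul]

/-- The lost trace is a positive functional: the diagonal sum over the first d + 1 number states is
at most Tr A for positive A, and the weights of the components sum to 1. Trace preservation then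
holds because |0⋯0⟩ is a unit vector. -/
theorem IsLadderBasis.isChannel_oscillatorToQubits (hb : IsQubitLadderBasis n d e) {μ : ℝ}
    (hμ0 : 0 < μ) (hμ1 : μ ≤ 1) : IsChannel (oscillatorToQubits μ d e) := by
  constructor
  · refine IsCompletelyPositive.add (IsCompletelyPositive.sum fun i =>
      (isCompletelyPositive_conjMap _ _).smul (componentProb_nonneg hμ0 hμ1 n _))
      (isCompletelyPositive_smulRight (fun A hA => ?_) _)
    rw [LinearMap.sub_apply, LinearMap.comp_apply, sub_nonneg, hb.traceLinear_compression]
    have h1 : ∑ i, (componentProb μ n (d i) : ℂ) = 1 := by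
      exact_mod_cast hb.sum_componentProb hμ0.ne'
    rw [← one_mul (traceLinear L2R A), ← h1, Finset.sum_mul]
    refine Finset.sum_le_sum fun i _ => mul_le_mul_of_nonneg_left
      (sum_inner_le_trace A.2 hA orthonormal_numberState _) ?_
    exact_mod_cast componentProb_nonneg hμ0 hμ1 n (d i)
  · intro A
    rw [← traceLinear_apply, ← traceLinear_apply, oscillatorToQubits, LinearMap.add_apply, map_add,
      LinearMap.smulRight_apply, map_smul, traceLinear_groundVector]
    simp

theorem coe_qubitsToOscillator (A : TraceClass (QubitSpace n)) :
    (qubitsToOscillator d e A : L2R →L[ℂ] L2R) = ∑ i, modeMap (d i) (e i) ∘L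
      (A : QubitSpace n →L[ℂ] QubitSpace n) ∘L ContinuousLinearMap.adjoint (modeMap (d i) (e i)) := by
  rw [qubitsToOscillator, LinearMap.sum_apply, Submodule.coe_sum]
  rfl

theorem coe_compression (μ : ℝ) (A : TraceClass L2R) :
    (compression μ d e A : QubitSpace n →L[ℂ] QubitSpace n) =
      ∑ i, (componentProb μ n (d i) : ℂ) • (ContinuousLinearMap.adjoint (modeMap (d i) (e i)) ∘L
        (A : L2R →L[ℂ] L2R) ∘L ContinuousLinearMap.adjoint
          (ContinuousLinearMap.adjoint (modeMap (d i) (e i)))) := by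
  rw [compression, LinearMap.sum_apply, Submodule.coe_sum]
  rfl

/-- The rotated vector stays in component i, which is orthogonal to component j. Hence the channel
to the oscillator produces no cross terms on the rotated state. -/
theorem IsLadderBasis.modeMap_rotation_of_ne (hb : IsQubitLadderBasis n d e) {i j : ι}
    (hij : i ≠ j) (u : ℝ × ℝ) (k : ℕ) :
    modeMap (d j) (e j) (rotation n ((√(n : ℝ))⁻¹ • u) (e i k)) = 0 := by
  have h0 : ∀ l, modeMap (d j) (e j) (e i l) = 0 := fun l => by
    rw [modeMap_apply]
    exact Finset.sum_eq_zero fun m _ => by rw [hb.orthogonal j i hij.symm, zero_smul]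
  rw [← (hb.ladder i).adjoint_modeMap_modeMap_rotation u k, adjoint_modeMap_apply, map_sum]
  exact Finset.sum_eq_zero fun l _ => by rw [map_smul, h0, smul_zero]

theorem IsLadderBasis.coe_qubitsToOscillator_qubitState (hb : IsQubitLadderBasis n d e) {μ : ℝ}
    (hμ0 : 1 / 2 < μ) (hμ1 : μ ≤ 1) (u : ℝ × ℝ) :
    (qubitsToOscillator d e (qubitState μ n u) : L2R →L[ℂ] L2R) =
      ∑ i, (topWeight μ n (d i) : ℂ) • geometricMixture ((1 - μ) / μ) fun k =>
        modeMap (d i) (e i) (rotation n ((√(n : ℝ))⁻¹ • u) (e i k)) := by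
  have hμ : 0 < μ := by linarith
  have hp0 : 0 ≤ (1 - μ) / μ := div_nonneg (by linarith) hμ.le
  have hp1 : (1 - μ) / μ < 1 := (div_lt_one hμ).2 (by linarith)
  have hr : ∀ i k, ‖rotation n ((√(n : ℝ))⁻¹ • u) (e i k)‖ ≤ 1 := fun i k =>
    (norm_rotation_apply n _ _).trans_le ((hb.ladder i).norm_le_one k)
  rw [coe_qubitsToOscillator, hb.coe_qubitState hμ0 hμ1]
  refine Finset.sum_congr rfl fun j _ => ?_
  have h1 : modeMap (d j) (e j) ∘L (∑ i, (topWeight μ n (d i) : ℂ) •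
        geometricMixture ((1 - μ) / μ) fun k => rotation n ((√(n : ℝ))⁻¹ • u) (e i k)) ∘L
          ContinuousLinearMap.adjoint (modeMap (d j) (e j)) =
      ∑ i, (topWeight μ n (d i) : ℂ) • geometricMixture ((1 - μ) / μ) fun k =>
        modeMap (d j) (e j) (rotation n ((√(n : ℝ))⁻¹ • u) (e i k)) := by
    rw [comp_sum_smul_comp]
    refine Finset.sum_congr rfl fun i _ => ?_
    rw [conj_geometricMixture hp0 hp1 (hr i)]
  rw [h1, Finset.sum_eq_single j]
  · intro i _ hij
    simp only [hb.modeMap_rotation_of_ne hij]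
    simp [geometricMixture]
  · intro h
    exact absurd (Finset.mem_univ j) h

theorem IsLadderBasis.coe_compression_oscillatorState (hb : IsQubitLadderBasis n d e) {μ : ℝ}
    (hμ : 1 / 2 < μ ∧ μ ≤ 1) (u : ℝ × ℝ) :
    (compression μ d e (oscillatorState μ hμ u) : QubitSpace n →L[ℂ] QubitSpace n) =
      ∑ i, (componentProb μ n (d i) : ℂ) • (1 - (((1 - μ) / μ : ℝ) : ℂ)) •
        geometricMixture ((1 - μ) / μ) fun k => ContinuousLinearMap.adjoint (modeMap (d i) (e i))
          (displacement (√(2 * μ - 1) * amplitude u) (numberState k)) := by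
  have hμ0 : 0 < μ := by linarith [hμ.1]
  have hp0 : 0 ≤ (1 - μ) / μ := div_nonneg (by linarith [hμ.2]) hμ0.le
  have hp1 : (1 - μ) / μ < 1 := (div_lt_one hμ0).2 (by linarith [hμ.1])
  have h1 : ∑ i, (componentProb μ n (d i) : ℂ) = 1 := by
    exact_mod_cast hb.sum_componentProb hμ0.ne'
  have hD : ∀ k, ‖displacement (√(2 * μ - 1) * amplitude u) (numberState k)‖ ≤ 1 := fun k => by
    rw [LinearIsometry.norm_map, norm_numberState]
  rw [coe_compression, hb.coe_oscillatorState hμ, ← Finset.sum_smul, h1, one_smul]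
  refine Finset.sum_congr rfl fun i _ => ?_
  rw [← conj_geometricMixture hp0 hp1 hD]
  ext1 x
  simp

/-- A finite geometric sum; it is the relation `hw` between the weights of the truncated and the
full thermal states required by `traceNorm_sum_geometricMixture_sub_le`. -/
theorem topWeight_mul_eq {μ : ℝ} (n d : ℕ) :
    componentProb μ n d * (1 - (1 - μ) / μ) =
      topWeight μ n d * (1 - ((1 - μ) / μ) ^ (d + 1)) := by
  rw [componentProb, mul_assoc, geom_sum_mul_neg]

theorem IsLadderBasis.traceNorm_qubitsToOscillator_sub_le (hb : IsQubitLadderBasis n d e) {μ : ℝ}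
    (hμ : 1 / 2 < μ ∧ μ ≤ 1) (u : ℝ × ℝ) :
    traceNorm ((qubitsToOscillator d e (qubitState μ n u) : L2R →L[ℂ] L2R) -
      (oscillatorState μ hμ u : L2R →L[ℂ] L2R)) ≤ ENNReal.ofReal (totalError μ n d e u) := by
  have hμ0 : 0 < μ := by linarith [hμ.1]
  have hp0 : 0 ≤ (1 - μ) / μ := div_nonneg (by linarith [hμ.2]) hμ0.le
  have hp1 : (1 - μ) / μ < 1 := (div_lt_one hμ0).2 (by linarith [hμ.1])
  rw [hb.coe_qubitsToOscillator_qubitState hμ.1 hμ.2, hb.coe_oscillatorState hμ]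
  refine traceNorm_sum_geometricMixture_sub_le hp0 hp1 (d := d)
    (fun i => topWeight_nonneg hμ0 hμ.2 n (d i)) (fun i => topWeight_mul_eq n (d i))
    (fun i k => (hb.ladder i).norm_modeMap_rotation_le_one _ k) fun i k => ?_
  rw [LinearIsometry.norm_map, norm_numberState]

/-- V^* V fixes the rotated ladder vectors and V^* is a contraction, so each distance on the qubit
side is at most the corresponding one on the oscillator side. -/
theorem IsLadderBasis.traceNorm_sub_compression_le (hb : IsQubitLadderBasis n d e) {μ : ℝ}
    (hμ : 1 / 2 < μ ∧ μ ≤ 1) (u : ℝ × ℝ) :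
    traceNorm ((qubitState μ n u : QubitSpace n →L[ℂ] QubitSpace n) -
      (compression μ d e (oscillatorState μ hμ u) : QubitSpace n →L[ℂ] QubitSpace n)) ≤
        ENNReal.ofReal (totalError μ n d e u) := by
  have hμ0 : 0 < μ := by linarith [hμ.1]
  have hp0 : 0 ≤ (1 - μ) / μ := div_nonneg (by linarith [hμ.2]) hμ0.le
  have hp1 : (1 - μ) / μ < 1 := (div_lt_one hμ0).2 (by linarith [hμ.1])
  have hl := fun i => topWeight_nonneg hμ0 hμ.2 n (d i)
  rw [hb.coe_compression_oscillatorState hμ, hb.coe_qubitState hμ.1 hμ.2]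
  have hD : ∀ k, ‖displacement (√(2 * μ - 1) * amplitude u) (numberState k)‖ ≤ 1 := fun k => by
    rw [LinearIsometry.norm_map, norm_numberState]
  have hy : ∀ i k, ‖rotation n ((√(n : ℝ))⁻¹ • u) (e i k)‖ ≤ 1 := fun i k =>
    (norm_rotation_apply n _ _).trans_le ((hb.ladder i).norm_le_one k)
  have hz : ∀ i k, ‖ContinuousLinearMap.adjoint (modeMap (d i) (e i))
      (displacement (√(2 * μ - 1) * amplitude u) (numberState k))‖ ≤ 1 := fun i k =>
    ((hb.ladder i).norm_adjoint_modeMap_apply_le _).trans (hD k)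
  refine (traceNorm_sum_geometricMixture_sub_le hp0 hp1 (d := d) hl
    (fun i => topWeight_mul_eq n (d i)) hy hz).trans (ENNReal.ofReal_le_ofReal ?_)
  refine Finset.sum_le_sum fun i _ => mul_le_mul_of_nonneg_left ?_ (hl i)
  refine Summable.tsum_le_tsum (fun k => ?_) ?_
    ((hb.ladder i).summable_componentError hp0 hp1 (2 * μ - 1) u)
  · refine mul_le_mul_of_nonneg_left ?_ (by positivity)
    have h1 := (hb.ladder i).adjoint_modeMap_modeMap_rotation u k
    have h2 := (hb.ladder i).norm_adjoint_modeMap_apply_le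
      (modeMap (d i) (e i) (rotation n ((√(n : ℝ))⁻¹ • u) (e i k)) -
        displacement (√(2 * μ - 1) * amplitude u) (numberState k))
    rw [map_sub, h1] at h2
    linarith
  · refine summable_geometric_mul hp0 hp1 (M := 4 + ((1 - μ) / μ) ^ (d i + 1))
      (fun k => by positivity) fun k => ?_
    have := (norm_sub_le _ _).trans (add_le_add (hy i k) (hz i k))
    linarith

theorem totalError_nonneg {μ : ℝ} (hμ0 : 0 < μ) (hμ1 : μ ≤ 1) (u : ℝ × ℝ) :
    0 ≤ totalError μ n d e u :=
  Finset.sum_nonneg fun i _ => mul_nonneg (topWeight_nonneg hμ0 hμ1 n _)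
    (IsLadder.componentError_nonneg _ _ (div_nonneg (by linarith) hμ0.le) u)

theorem norm_trace_le_of_traceNorm_le {H : Type*} [NormedAddCommGroup H] [InnerProductSpace ℂ H]
    [CompleteSpace H] {A : H →L[ℂ] H} {c : ℝ} (hc : 0 ≤ c)
    (hA : traceNorm A ≤ ENNReal.ofReal c) : ‖trace A‖ ≤ c :=
  (norm_trace_le (mem_traceClass_iff.2 (hA.trans_lt ENNReal.ofReal_lt_top))).trans
    (ENNReal.toReal_le_of_le_ofReal hc hA)

/-- One error comes from the compression C and two from the lost trace τ. As T preserves the trace,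
τ = Tr φ - Tr Cφ = Tr(ρ - Cφ) - Tr(Tρ - φ), and each trace is bounded by a trace norm already
estimated; the trace of φ itself need not be computed. -/
theorem IsLadderBasis.traceNorm_sub_oscillatorToQubits_le (hb : IsQubitLadderBasis n d e) {μ : ℝ}
    (hμ : 1 / 2 < μ ∧ μ ≤ 1) (u : ℝ × ℝ) :
    traceNorm ((qubitState μ n u : QubitSpace n →L[ℂ] QubitSpace n) -
      (oscillatorToQubits μ d e (oscillatorState μ hμ u) : QubitSpace n →L[ℂ] QubitSpace n)) ≤
        ENNReal.ofReal (3 * totalError μ n d e u) := by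
  have hμ0 : 0 < μ := by linarith [hμ.1]
  have hE := totalError_nonneg (d := d) (e := e) hμ0 hμ.2 u
  have h1 := hb.traceNorm_qubitsToOscillator_sub_le hμ u
  have h2 := hb.traceNorm_sub_compression_le hμ u
  set ρ := qubitState μ n u
  set φ := oscillatorState μ hμ u
  set τ := (traceLinear L2R - traceLinear (QubitSpace n) ∘ₗ compression μ d e) φ with hτ
  have h3 : ‖τ‖ ≤ 2 * totalError μ n d e u := by
    have t1 : ‖traceLinear L2R (qubitsToOscillator d e ρ - φ)‖ ≤ totalError μ n d e u :=
      norm_trace_le_of_traceNorm_le hE h1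
    have t2 : ‖traceLinear (QubitSpace n) (ρ - compression μ d e φ)‖ ≤ totalError μ n d e u :=
      norm_trace_le_of_traceNorm_le hE h2
    have t3 : traceLinear L2R (qubitsToOscillator d e ρ) = traceLinear (QubitSpace n) ρ :=
      hb.isChannel_qubitsToOscillator.2 ρ
    rw [map_sub, t3] at t1
    rw [map_sub] at t2
    have t4 : τ = (traceLinear (QubitSpace n) ρ -
        traceLinear (QubitSpace n) (compression μ d e φ)) -
          (traceLinear (QubitSpace n) ρ - traceLinear L2R φ) := by
      rw [hτ, LinearMap.sub_apply, LinearMap.comp_apply]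
      ring
    rw [t4]
    refine (norm_sub_le _ _).trans ?_
    linarith
  have e1 : (ρ : QubitSpace n →L[ℂ] QubitSpace n) -
      (oscillatorToQubits μ d e φ : QubitSpace n →L[ℂ] QubitSpace n) =
        ((ρ : QubitSpace n →L[ℂ] QubitSpace n) -
          (compression μ d e φ : QubitSpace n →L[ℂ] QubitSpace n)) +
            (-τ) • rankOne ℂ (groundVector n) (groundVector n) := by
    have : (oscillatorToQubits μ d e φ : QubitSpace n →L[ℂ] QubitSpace n) =
        (compression μ d e φ : QubitSpace n →L[ℂ] QubitSpace n) +
          τ • rankOne ℂ (groundVector n) (groundVector n) := rfl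
    rw [this, neg_smul]
    abel
  rw [e1]
  have h4 : traceNorm ((-τ) • rankOne ℂ (groundVector n) (groundVector n)) ≤
      ENNReal.ofReal (2 * totalError μ n d e u) := by
    refine (traceNorm_smul_le _ _).trans ?_
    have hg : ‖groundVector n‖ = 1 := by simp [groundVector]
    have h5 := traceNorm_rankOne_le_mul (groundVector n) (groundVector n)
    rw [hg, one_mul, ENNReal.ofReal_one] at h5
    refine (mul_le_mul_right h5 _).trans ?_
    rw [mul_one, norm_neg]
    exact ENNReal.ofReal_le_ofReal h3
  refine (traceNorm_add_le _ _).trans ((add_le_add h2 h4).trans (le_of_eq ?_))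
  rw [← ENNReal.ofReal_add hE (by linarith)]
  congr 1
  ring

end Channels

/-! ### Uniformity in u and the passage to the limit. -/

theorem traceNorm_sub_comm {H : Type*} [NormedAddCommGroup H] [InnerProductSpace ℂ H]
    (A B : H →L[ℂ] H) : traceNorm (A - B) ≤ traceNorm (B - A) := by
  have h := traceNorm_smul_le (-1) (B - A)
  rwa [neg_smul, one_smul, neg_sub, norm_neg, norm_one, ENNReal.ofReal_one, one_mul] at h

theorem exists_norm_amplitude_le {I : Set ℝ} (hI : Bornology.IsBounded I) :
    ∃ A, 0 ≤ A ∧ ∀ u ∈ I ×ˢ I, ‖amplitude u‖ ≤ A := by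
  obtain ⟨C, hC⟩ := hI.exists_norm_le
  refine ⟨|C| + |C|, by positivity, fun u hu => ?_⟩
  have h1 := (hC _ hu.1).trans (le_abs_self C)
  have h2 := (hC _ hu.2).trans (le_abs_self C)
  refine (norm_add_le _ _).trans (add_le_add ?_ ?_)
  · rwa [norm_neg, Complex.norm_real]
  · rwa [norm_mul, Complex.norm_I, one_mul, Complex.norm_real]

theorem tendsto_iSup_of_forall_le {S : Set (ℝ × ℝ)} {F : ℕ → ℝ × ℝ → ℝ≥0∞}
    (hF : ∀ ε : ℝ, 0 < ε → ∃ N : ℕ, ∀ n ≥ N, ∀ u ∈ S, F n u ≤ ENNReal.ofReal ε) :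
    Tendsto (fun n => ⨆ u ∈ S, F n u) atTop (𝓝 0) := by
  rw [ENNReal.tendsto_atTop_zero]
  intro ε hε
  rcases eq_or_ne ε ∞ with rfl | hε'
  · exact ⟨0, fun n _ => le_top⟩
  obtain ⟨N, hN⟩ := hF ε.toReal (ENNReal.toReal_pos hε.ne' hε')
  refine ⟨N, fun n hn => iSup₂_le fun u hu => ?_⟩
  rw [← ENNReal.ofReal_toReal hε']
  exact hN n hn u hu

end QubitLAN
end

open QubitLAN in
theorem theorem1 (μ : ℝ) (hμ : 1 / 2 < μ ∧ μ ≤ 1) :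
    ∃ (T : ∀ n : ℕ, TraceClass (QubitSpace n) →ₗ[ℂ] TraceClass L2R)
      (S : ∀ n : ℕ, TraceClass L2R →ₗ[ℂ] TraceClass (QubitSpace n)),
      (∀ n, IsChannel (T n)) ∧ (∀ n, IsChannel (S n)) ∧
      ∀ I : Set ℝ, I.OrdConnected → Bornology.IsBounded I →
        Tendsto (fun n : ℕ => ⨆ u ∈ I ×ˢ I,
          traceNorm (oscillatorState μ hμ u - T n (qubitState μ n u) : L2R →L[ℂ] L2R))
          atTop (𝓝 0) ∧
        Tendsto (fun n : ℕ => ⨆ u ∈ I ×ˢ I,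
          traceNorm (qubitState μ n u - S n (oscillatorState μ hμ u) :
            QubitSpace n →L[ℂ] QubitSpace n))
          atTop (𝓝 0) := by
  have hμ0 : 0 < μ := by linarith [hμ.1]
  -- One decomposition is fixed for every n, before I and u appear, so the channels built from it
  -- depend on n and μ only.
  choose ι hι d e hb using fun n : ℕ => (isSpinTriple_collectiveOp n).exists_ladderBasis
  refine ⟨fun n => qubitsToOscillator (d n) (e n), fun n => oscillatorToQubits μ (d n) (e n),
    fun n => (hb n).isChannel_qubitsToOscillator,
    fun n => (hb n).isChannel_oscillatorToQubits hμ0 hμ.2, fun I _ hI => ?_⟩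
  obtain ⟨A, hA, hAI⟩ := exists_norm_amplitude_le hI
  constructor
  · refine tendsto_iSup_of_forall_le fun ε hε => ?_
    obtain ⟨N, hN⟩ := exists_forall_totalError_le hμ.1 hμ.2 hA hε
    refine ⟨N, fun n hn u hu => (traceNorm_sub_comm _ _).trans
      (((hb n).traceNorm_qubitsToOscillator_sub_le hμ u).trans (ENNReal.ofReal_le_ofReal ?_))⟩
    exact hN n hn (ι n) (d n) (e n) (hb n) u (hAI u hu)
  · refine tendsto_iSup_of_forall_le fun ε hε => ?_
    obtain ⟨N, hN⟩ := exists_forall_totalError_le hμ.1 hμ.2 hA (show 0 < ε / 3 by positivity)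
    refine ⟨N, fun n hn u hu => ((hb n).traceNorm_sub_oscillatorToQubits_le hμ u).trans
      (ENNReal.ofReal_le_ofReal ?_)⟩
    have := hN n hn (ι n) (d n) (e n) (hb n) u (hAI u hu)
    linarith
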